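/- Let $n\ge 1$. A cube is an axis-parallel cube in $\mathbb{R}^n$; $Q_R$ is the cube with center $0$ and side length $R$. For a cube $Q$ and $1\le p<\infty$ put $\langle f\rangle_{p,Q}=|Q|^{-1/p}\|f\|_{L^p(Q)}$. A collection $\mathcal S$ of cubes is $\eta$-sparse ($0<\eta<1$) if there are pairwise disjoint measurable sets $E_Q\subset Q$ $(Q\in\mathcal S)$ with $|E_Q|>\eta|Q|$. For $\alpha>0$ put $$\Lambda^{\alpha}_{\mathcal S,r,s}(f,g)=\Big(\sum_{Q\in\mathcal S}|Q|\,\langle f\rangle_{r,Q}^{\alpha}\langle g\rangle_{s,Q}^{\alpha}\Big)^{1/\alpha}\in[0,\infty].$$ With $\hat f(\xi)=\int e^{-ix\cdot\xi}f(x)\,dx$, fix $\hat\psi\in C_c^\infty(\mathbb{R}^n)$ real-valued with $\hat\psi=1$ for $|\xi|\le 1$ and $\operatorname{supp}\hat\psi\subset\{|\xi|\le 2\}$, and let $\phi_j$ be given by $\hat\phi_0=\hat\psi$ and $\hat\phi_j(\xi)=\hat\psi(2^{-j}\xi)-\hat\psi(2^{-j+1}\xi)$ for $j\ge 1$. For $-1\le\rho<1$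 and $f\in\mathscr S(\mathbb{R}^n)$ let $U_\rho f(t)=e^{it(-\Delta)^{(1-\rho)/2}}f$ be the solution of $i\partial_t u+(-\Delta)^{(1-\rho)/2}u=0$, $u(0)=f$, that is, the function whose Fourier transform is $e^{it|\xi|^{1-\rho}}\hat f(\xi)$. Write $\langle F,g\rangle=\int Fg$. There is $\eta\in(0,1)$, depending only on $n$, such that the following holds for every $1\le r\le 2$. (i) Let $-1\le\rho<1$, $\rho\ne 0$, and $\frac1r+\frac12<\frac1\alpha<\frac2r$. There is a constant $C$, depending only on $n,\hat\psi,r,\rho,\alpha$, such that for all $f,g\in\mathscr S(\mathbb{R}^n)$ there are $\eta$-sparse families $\mathcal S_0,\mathcal S_1,\dots$ with $$|\langle U_\rho f(t),g\rangle|\le C\,t^{\,n\left(\frac1r-\frac12-\left(\frac1\alpha-1\right)\right)}\liminf_{R\to\infty}\sum_{j\ge 0}2^{j\kappa_4}\Lambda^{\alpha}_{\mathcal S_j,r,r}\big((\phi_j*f)1_{Q_R},g\big)\qquad\text{for all }t>0,$$ where $\kappa_4=n(1-\rho)\left(\frac1r-\frac12\right)+\rho n\left(\frac1\alpha-1\right)$.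 (ii) Let $\frac{n+1}{rn}+\frac{n-1}{2n}<\frac1\alpha<\frac2r$. There is a constant $C$, depending only on $n,\hat\psi,r,\alpha$, such that for all $f,g\in\mathscr S(\mathbb{R}^n)$ there are $\eta$-sparse families $\mathcal S_0,\mathcal S_1,\dots$ with $$|\langle U_0 f(t),g\rangle|\le C\,t^{\,(n+1)\left(\frac1r-\frac12\right)-n\left(\frac1\alpha-1\right)}\liminf_{R\to\infty}\sum_{j\ge 0}2^{j\kappa_5}\Lambda^{\alpha}_{\mathcal S_j,r,r}\big((\phi_j*f)1_{Q_R},g\big)\qquad\text{for all }t>0,$$ where $\kappa_5=(n+1)\left(\frac1r-\frac12\right)$. -/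

import Mathlib

open MeasureTheory Filter
open scoped FourierTransform SchwartzMap ENNReal NNReal ContDiff

noncomputable section

namespace SparseDispersive

/-- Euclidean space `ℝⁿ`. -/
abbrev E (n : ℕ) : Type := EuclideanSpace ℝ (Fin n)

/-- A cube in `ℝⁿ` with sides parallel to the axes, given by its center and its side length. -/
structure Cube (n : ℕ) where
  center : E n
  side : ℝ
  side_pos : 0 < side

/-- The half-open set `∏ᵢ [cᵢ - ℓ/2, cᵢ + ℓ/2)`. -/
def cubeSet {n : ℕ} (c : E n) (l : ℝ) : Set (E n) :=
  {x | ∀ i, c i - l / 2 ≤ x i ∧ x i < c i + l / 2}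

/-- The points of a cube. -/
def Cube.toSet {n : ℕ} (Q : Cube n) : Set (E n) := cubeSet Q.center Q.side

/-- A collection of cubes is `η`-sparse if there are pairwise disjoint measurable sets
`E_Q ⊆ Q` with `|E_Q| > η |Q|`. -/
def IsSparse {n : ℕ} (η : ℝ) (S : Set (Cube n)) : Prop :=
  ∃ F : Cube n → Set (E n),
    (∀ Q ∈ S, MeasurableSet (F Q) ∧ F Q ⊆ Q.toSet ∧
      ENNReal.ofReal η * volume Q.toSet < volume (F Q)) ∧
    S.PairwiseDisjoint F

/-- The average `⟨f⟩_{p,Q} = |Q|^{-1/p} ‖f‖_{L^p(Q)}`. -/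
def avg {n : ℕ} (p : ℝ) (Q : Cube n) (f : E n → ℂ) : ℝ≥0∞ :=
  (volume Q.toSet) ^ (-(1 / p)) * eLpNorm f (ENNReal.ofReal p) (volume.restrict Q.toSet)

/-- The sparse form `Λ^α_{S,r,s}(f,g) = (∑_{Q ∈ S} |Q| ⟨f⟩_{r,Q}^α ⟨g⟩_{s,Q}^α)^{1/α}`. -/
def sparseForm {n : ℕ} (α : ℝ) (S : Set (Cube n)) (r s : ℝ) (f g : E n → ℂ) : ℝ≥0∞ :=
  (∑' Q : S, volume (Q : Cube n).toSet * avg r (Q : Cube n) f ^ α * avg s (Q : Cube n) g ^ α)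
    ^ (1 / α)

/-- The function `ψ̂` that generates the dyadic partition of unity. -/
structure IsCutoff {n : ℕ} (χ : E n → ℝ) : Prop where
  smooth : ContDiff ℝ ∞ χ
  tsupport_subset : tsupport χ ⊆ Metric.closedBall 0 2
  eq_one : ∀ ξ ∈ Metric.closedBall (0 : E n) 1, χ ξ = 1

/-- The symbol `φ̂_j`: for `j ≥ 1` it is `χ(2^{-j} ξ) - χ(2^{-j+1} ξ)`, and for `j = 0` it is
the (telescoping) sum `∑_{i ≤ 0} (χ(2^{-i} ξ) - χ(2^{-i+1} ξ))`, that is `χ(ξ)`. -/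
def phiHat {n : ℕ} (χ : E n → ℝ) : ℕ → E n → ℝ
  | 0 => χ
  | (j + 1) => fun ξ => χ (((2 : ℝ) ^ (j + 1))⁻¹ • ξ) - χ (((2 : ℝ) ^ j)⁻¹ • ξ)

/-- `φ_j(x) = (2π)^{-n} ∫ e^{i x·ξ} φ̂_j(ξ) dξ`, written with the inverse Fourier transform
of kernel `e^{2π i x·ξ}`. -/
def phi {n : ℕ} (χ : E n → ℝ) (j : ℕ) : E n → ℂ :=
  𝓕⁻ (fun ξ : E n => (phiHat χ j ((2 * Real.pi) • ξ) : ℂ))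

/-- The convolution `φ_j * f`. -/
def lpPiece {n : ℕ} (χ : E n → ℝ) (j : ℕ) (f : E n → ℂ) : E n → ℂ :=
  convolution (phi χ j) f (ContinuousLinearMap.mul ℝ ℂ) volume

/-- `U_ρ(t) f = e^{it(-Δ)^{(1-ρ)/2}} f`, the solution at time `t` of
`i ∂ₜ u + (-Δ)^{(1-ρ)/2} u = 0`, `u(0) = f`. With the Fourier kernel `e^{-2π i x·ξ}` the symbol
of `(-Δ)^{(1-ρ)/2}` is `(2π|ξ|)^{1-ρ}`. -/
def U {n : ℕ} (ρ t : ℝ) (f : 𝓢(E n, ℂ)) : E n → ℂ :=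
  𝓕⁻ (fun ξ : E n =>
    Complex.exp (Complex.I * ((t * (2 * Real.pi * ‖ξ‖) ^ (1 - ρ) : ℝ) : ℂ)) * 𝓕 (f : E n → ℂ) ξ)

/-- The pairing `⟨F, g⟩ = ∫ F g`. -/
def pairing {n : ℕ} (F g : E n → ℂ) : ℂ := ∫ x, F x * g x

/-- The Besov-type sparse form
`liminf_{R → ∞} ∑_{j ≥ 0} 2^{jκ} Λ^α_{S_j,r,r}((φ_j * f) 1_{Q_R}, g)`, where `Q_R` is the cube
with center `0` and side length `R`. -/
def besovSparseForm {n : ℕ} (χ : E n → ℝ) (κ α r : ℝ) (S : ℕ → Set (Cube n))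
    (f g : E n → ℂ) : ℝ≥0∞ :=
  liminf (fun R : ℝ => ∑' j : ℕ, ENNReal.ofReal ((2 : ℝ) ^ ((j : ℝ) * κ)) *
    sparseForm α (S j) r r ((cubeSet (0 : E n) R).indicator (lpPiece χ j f)) g) atTop

end SparseDispersive

end

/-!
After rescaling, a Littlewood–Paley piece has frequencies of unit size. Cutting the frequencies
into packets of width `(1 + τ)^{-1/2}`, on which the phase `τ (2π|ξ|)^a` with `a = 1 - ρ` is affine
up to `O(1)`, bounds the kernel of the propagator at time `τ` by `(1 + τ)^{-d/2}`, where `d` is the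
rank of the Hessian of `|ξ|^a`: `n` if `a ≠ 1`, and `n - 1` for the wave equation. The packets
move with bounded speed, so the kernel is negligible at distances `≫ 1 + τ`.

Cut space into a grid of cubes of side comparable to `1 + τ`. Interpolating the kernel bound with
Plancherel's identity controls the interaction of nearby cubes by local `L^r` averages over
boundedly overlapping cubes, which split into finitely many disjoint families. Hence each piece is
bounded by the supremum of the forms `Λ^α` over *all* families of disjoint cubes. Such families
are sparse, and one that nearly attains the supremum does not depend on `t`. Undoing the scaling
produces the powers of `t` and `2^j`, and the frequencies below `1` sum up geometrically since
`κ > 0`.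
-/

noncomputable section

namespace SparseDispersive

section RapidDecay

variable {V : Type*} [NormedAddCommGroup V] [InnerProductSpace ℝ V] [FiniteDimensional ℝ V]
  [MeasurableSpace V] [BorelSpace V] {F : Type*} [NormedAddCommGroup F] [NormedSpace ℂ F]

lemma integral_norm_iteratedFDeriv_le {K : Set V} (hK : IsCompact K) {g : V → F}
    (hgK : tsupport g ⊆ K) {k : ℕ} {M : ℝ} (hM : ∀ w ∈ K, ‖iteratedFDeriv ℝ k g w‖ ≤ M) :
    ∫ w, ‖iteratedFDeriv ℝ k g w‖ ≤ M * volume.real K := by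
  have hzero : ∀ w ∉ K, ‖iteratedFDeriv ℝ k g w‖ = 0 := fun w hw => norm_eq_zero.2 <|
    image_eq_zero_of_notMem_tsupport fun h => hw (hgK (tsupport_iteratedFDeriv_subset k h))
  rw [← setIntegral_eq_integral_of_forall_compl_eq_zero hzero]
  exact (Real.le_norm_self _).trans (norm_setIntegral_le_of_norm_le_const hK.measure_lt_top
    fun w hw => (norm_norm _).trans_le (hM w hw))

lemma pow_mul_norm_fourierInv_le {N : ℕ} {K : Set V} (hK : IsCompact K) {g : V → F}
    (hg : ContDiff ℝ N g) (hgK : tsupport g ⊆ K) {M : ℝ}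
    (hM : ∀ k ≤ N, ∀ w ∈ K, ‖iteratedFDeriv ℝ k g w‖ ≤ M) (ζ : V) :
    ‖ζ‖ ^ N * ‖𝓕⁻ g ζ‖ ≤ 2 ^ N * ((N + 1) * (M * volume.real K)) := by
  have hint (k n : ℕ) (hk : (k : ℕ∞) ≤ 0) (hn : (n : ℕ∞) ≤ N) :
      Integrable fun v => ‖v‖ ^ k * ‖iteratedFDeriv ℝ n g v‖ := by
    obtain rfl : k = 0 := by simpa using hk
    have hgc : HasCompactSupport g :=
      .of_support_subset_isCompact hK ((subset_tsupport g).trans hgK)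
    have hcont := hg.continuous_iteratedFDeriv (by exact_mod_cast hn)
    simpa using (hcont.integrable_of_hasCompactSupport (hgc.iteratedFDeriv n)).norm
  have hdecay := Real.pow_mul_norm_iteratedFDeriv_fourier_le (K := 0) (N := N) (by simpa using hg)
    hint (k := 0) (n := N) le_rfl le_rfl (-ζ)
  rw [norm_neg, norm_iteratedFDeriv_zero, ← Real.fourierInv_eq_fourier_neg,
    Finset.sum_product] at hdecay
  simp only [Finset.range_one, Finset.sum_singleton, pow_zero, one_mul, Nat.cast_zero, mul_zero,
    zero_add] at hdecay
  refine hdecay.trans ?_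
  gcongr
  calc ∑ k ∈ Finset.range (N + 1), ∫ v, ‖iteratedFDeriv ℝ k g v‖
      ≤ ∑ _k ∈ Finset.range (N + 1), M * volume.real K := Finset.sum_le_sum fun k hk =>
        integral_norm_iteratedFDeriv_le hK hgK (hM k (Finset.mem_range_succ_iff.1 hk))
    _ = (N + 1) * (M * volume.real K) := by simp

lemma one_add_norm_pow_mul_norm_fourierInv_le {N : ℕ} {K : Set V} (hK : IsCompact K) {g : V → F}
    (hg : ContDiff ℝ N g) (hgK : tsupport g ⊆ K) {M : ℝ}
    (hM : ∀ k ≤ N, ∀ w ∈ K, ‖iteratedFDeriv ℝ k g w‖ ≤ M) (ζ : V) :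
    (1 + ‖ζ‖) ^ N * ‖𝓕⁻ g ζ‖ ≤
      2 ^ (N - 1) * (1 + 2 ^ N * (N + 1)) * (M * volume.real K) := by
  have h0 := pow_mul_norm_fourierInv_le hK (hg.of_le (mod_cast N.zero_le)) hgK
    (fun k hk => hM k (hk.trans N.zero_le)) ζ
  have hN := pow_mul_norm_fourierInv_le hK hg hgK hM ζ
  simp only [pow_zero, one_mul, Nat.cast_zero, zero_add] at h0
  calc (1 + ‖ζ‖) ^ N * ‖𝓕⁻ g ζ‖
      ≤ 2 ^ (N - 1) * (1 ^ N + ‖ζ‖ ^ N) * ‖𝓕⁻ g ζ‖ := by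
        gcongr
        exact add_pow_le zero_le_one (norm_nonneg ζ) N
    _ = 2 ^ (N - 1) * (‖𝓕⁻ g ζ‖ + ‖ζ‖ ^ N * ‖𝓕⁻ g ζ‖) := by ring
    _ ≤ 2 ^ (N - 1) * (M * volume.real K + 2 ^ N * ((N + 1) * (M * volume.real K))) := by gcongr
    _ = _ := by ring

end RapidDecay

section IteratedDerivatives

variable {V : Type*} [NormedAddCommGroup V] [NormedSpace ℝ V] {F : Type*} [NormedAddCommGroup F]
  [NormedSpace ℝ F]

lemma exists_bound_iteratedFDeriv {f : V → F} (N : ℕ) (hf : ContDiff ℝ N f)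
    (hc : HasCompactSupport f) : ∃ C : ℝ, 1 ≤ C ∧ ∀ k ≤ N, ∀ w, ‖iteratedFDeriv ℝ k f w‖ ≤ C := by
  have h (k : ℕ) (hk : k ≤ N) : ∃ C : ℝ, ∀ w, ‖iteratedFDeriv ℝ k f w‖ ≤ C :=
    (hc.iteratedFDeriv k).exists_bound_of_continuous
      (hf.continuous_iteratedFDeriv (mod_cast hk))
  choose! C hC using h
  obtain ⟨B, hB⟩ := ((Finset.range (N + 1)).image C).bddAbove
  refine ⟨max 1 B, le_max_left _ _, fun k hk w => (hC k hk w).trans (le_max_of_le_right (hB ?_))⟩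
  exact Finset.mem_coe.2 (Finset.mem_image_of_mem C (Finset.mem_range_succ_iff.2 hk))

lemma norm_iteratedFDeriv_comp_add_smul {f : V → F} {k : ℕ} (hf : ContDiff ℝ k f) (z w : V)
    (ε : ℝ) : ‖iteratedFDeriv ℝ k (fun w => f (z + ε • w)) w‖ =
      |ε| ^ k * ‖iteratedFDeriv ℝ k f (z + ε • w)‖ := by
  have hshift : ContDiff ℝ k fun v => f (z + v) := hf.comp (contDiff_const.add contDiff_id)
  rw [congrFun (iteratedFDeriv_comp_const_smul ε hshift) w, norm_smul, norm_pow,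
    Real.norm_eq_abs, iteratedFDeriv_comp_add_left]

lemma norm_iteratedFDeriv_mul_le_of_le {A : Type*} [NormedRing A] [NormedAlgebra ℝ A] {N : ℕ}
    {f g : V → A} (hf : ContDiff ℝ N f) (hg : ContDiff ℝ N g) {B C : ℝ} (w : V)
    (hB : ∀ k ≤ N, ‖iteratedFDeriv ℝ k f w‖ ≤ B) (hC : ∀ k ≤ N, ‖iteratedFDeriv ℝ k g w‖ ≤ C)
    {k : ℕ} (hk : k ≤ N) : ‖iteratedFDeriv ℝ k (fun w => f w * g w) w‖ ≤ 2 ^ N * (B * C) := by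
  have hB0 : 0 ≤ B := (norm_nonneg _).trans (hB 0 N.zero_le)
  have hC0 : 0 ≤ C := (norm_nonneg _).trans (hC 0 N.zero_le)
  calc ‖iteratedFDeriv ℝ k (fun w => f w * g w) w‖
      ≤ ∑ i ∈ Finset.range (k + 1), (k.choose i : ℝ) * ‖iteratedFDeriv ℝ i f w‖ *
          ‖iteratedFDeriv ℝ (k - i) g w‖ :=
        norm_iteratedFDeriv_mul_le hf hg w (mod_cast hk)
    _ ≤ ∑ i ∈ Finset.range (k + 1), (k.choose i : ℝ) * (B * C) := by
        refine Finset.sum_le_sum fun i hi => ?_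
        rw [mul_assoc]
        gcongr
        · exact hB i ((Finset.mem_range_succ_iff.1 hi).trans hk)
        · exact hC (k - i) (k.sub_le i |>.trans hk)
    _ = 2 ^ k * (B * C) := by
        rw [← Finset.sum_mul]
        exact_mod_cast congrArg (fun m : ℕ => (m : ℝ) * (B * C)) (Nat.sum_range_choose k)
    _ ≤ 2 ^ N * (B * C) := by
        gcongr
        exact one_le_two

lemma contDiff_exp_I_mul {m : WithTop ℕ∞} :
    ContDiff ℝ m fun s : ℝ => Complex.exp (Complex.I * s) :=
  (contDiff_const.mul Complex.ofRealCLM.contDiff).cexp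

lemma norm_exp_I_mul (s : ℝ) : ‖Complex.exp (Complex.I * s)‖ = 1 := by
  rw [mul_comm, Complex.norm_exp_ofReal_mul_I]

lemma iteratedDeriv_exp_I_mul (k : ℕ) :
    iteratedDeriv k (fun s : ℝ => Complex.exp (Complex.I * s)) =
      fun s : ℝ => Complex.I ^ k * Complex.exp (Complex.I * s) := by
  induction k with
  | zero => simp
  | succ k ih =>
    ext s
    have hlin : HasDerivAt (fun s : ℝ => Complex.I * (s : ℂ)) Complex.I s := by
      simpa using (Complex.ofRealCLM.hasDerivAt (x := s)).const_mul Complex.I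
    rw [iteratedDeriv_succ, ih, (hlin.cexp.const_mul (Complex.I ^ k)).deriv]
    ring

lemma norm_iteratedFDeriv_exp_I_mul (k : ℕ) (s : ℝ) :
    ‖iteratedFDeriv ℝ k (fun s : ℝ => Complex.exp (Complex.I * s)) s‖ = 1 := by
  rw [norm_iteratedFDeriv_eq_norm_iteratedDeriv, iteratedDeriv_exp_I_mul, norm_mul, norm_pow,
    Complex.norm_I, one_pow, one_mul, norm_exp_I_mul]

end IteratedDerivatives

section TaylorRemainder

variable {V : Type*} [NormedAddCommGroup V] [NormedSpace ℝ V] {P : V → ℝ}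

/-- The first order Taylor remainder of `τ P` at the point `z`, seen at scale `ε`. -/
def taylorRemainder (P : V → ℝ) (τ ε : ℝ) (z w : V) : ℝ :=
  τ * (P (z + ε • w) - P z - ε * fderiv ℝ P z w)

lemma contDiff_taylorRemainder {m : WithTop ℕ∞} (hP : ContDiff ℝ m P) (τ ε : ℝ) (z : V) :
    ContDiff ℝ m (taylorRemainder P τ ε z) := by
  have hscaled : ContDiff ℝ m fun w => P (z + ε • w) := hP.comp (by fun_prop)
  exact contDiff_const.mul ((hscaled.sub contDiff_const).sub
    (contDiff_const.mul (fderiv ℝ P z).contDiff))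

lemma fderiv_taylorRemainder (hP : Differentiable ℝ P) (τ ε : ℝ) (z : V) :
    fderiv ℝ (taylorRemainder P τ ε z) =
      fun w => (τ * ε) • (fderiv ℝ P (z + ε • w) - fderiv ℝ P z) := by
  ext1 w
  have hscaled : HasFDerivAt (fun w => P (z + ε • w)) (ε • fderiv ℝ P (z + ε • w)) w := by
    have hcomp := (hP (z + ε • w)).hasFDerivAt.comp w
      (((hasFDerivAt_id w).const_smul ε).const_add z)
    rwa [ContinuousLinearMap.comp_smul, ContinuousLinearMap.comp_id] at hcomp
  have h : HasFDerivAt (taylorRemainder P τ ε z)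
      (τ • (ε • fderiv ℝ P (z + ε • w) - ε • fderiv ℝ P z)) w :=
    ((hscaled.sub_const (P z)).sub ((fderiv ℝ P z).hasFDerivAt.const_mul ε)).const_mul τ
  rw [h.fderiv, ← smul_sub, smul_smul]

lemma norm_fderiv_taylorRemainder_le (hP : ContDiff ℝ 2 P) {D : ℝ}
    (hD : ∀ x, ‖iteratedFDeriv ℝ 2 P x‖ ≤ D) {τ ε : ℝ} (hτ : 0 ≤ τ) (hε : 0 ≤ ε)
    (hτε : τ * ε ^ 2 ≤ 1) (z : V) {w : V} (hw : ‖w‖ ≤ 1) :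
    ‖fderiv ℝ (taylorRemainder P τ ε z) w‖ ≤ D := by
  have hD0 : 0 ≤ D := (norm_nonneg _).trans (hD 0)
  have hlip : ‖fderiv ℝ P (z + ε • w) - fderiv ℝ P z‖ ≤ D * ‖z + ε • w - z‖ := by
    refine Convex.norm_image_sub_le_of_norm_fderiv_le (𝕜 := ℝ) (s := Set.univ)
      (fun x _ => (hP.fderiv_right (m := 1) (by norm_num)).differentiable one_ne_zero x)
      (fun x _ => ?_) convex_univ (Set.mem_univ _) (Set.mem_univ _)
    rw [← norm_iteratedFDeriv_zero (𝕜 := ℝ), norm_iteratedFDeriv_fderiv,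
      norm_iteratedFDeriv_fderiv]
    exact hD x
  rw [add_sub_cancel_left, norm_smul, Real.norm_of_nonneg hε] at hlip
  rw [fderiv_taylorRemainder (hP.differentiable two_ne_zero), norm_smul,
    Real.norm_of_nonneg (by positivity)]
  calc τ * ε * ‖fderiv ℝ P (z + ε • w) - fderiv ℝ P z‖
      ≤ τ * ε * (D * (ε * ‖w‖)) := by gcongr
    _ = τ * ε ^ 2 * ‖w‖ * D := by ring
    _ ≤ 1 * 1 * D := by gcongr
    _ = D := by ring

lemma norm_iteratedFDeriv_taylorRemainder_add_two_le {i : ℕ} (hP : ContDiff ℝ (i + 2 : ℕ) P) {D : ℝ}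
    (hD : ∀ x, ‖iteratedFDeriv ℝ (i + 2) P x‖ ≤ D) {τ ε : ℝ} (hτ : 0 ≤ τ) (hε : 0 ≤ ε)
    (hε1 : ε ≤ 1) (hτε : τ * ε ^ 2 ≤ 1) (z w : V) :
    ‖iteratedFDeriv ℝ (i + 2) (taylorRemainder P τ ε z) w‖ ≤ D := by
  have hdP : ContDiff ℝ (i + 1 : ℕ) (fderiv ℝ P) :=
    hP.fderiv_right (by norm_cast)
  have hscaled : ContDiff ℝ (i + 1 : ℕ) fun w => fderiv ℝ P (z + ε • w) :=
    hdP.comp (by fun_prop)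
  rw [← norm_iteratedFDeriv_fderiv,
    fderiv_taylorRemainder (hP.differentiable (by norm_cast)),
    iteratedFDeriv_const_smul_apply' (hscaled.sub contDiff_const).contDiffAt,
    fun_iteratedFDeriv_sub_apply hscaled.contDiffAt contDiff_const.contDiffAt,
    iteratedFDeriv_const_of_ne (Nat.succ_ne_zero i), Pi.zero_apply, sub_zero, norm_smul,
    norm_iteratedFDeriv_comp_add_smul hdP, Real.norm_of_nonneg (by positivity),
    abs_of_nonneg hε, norm_iteratedFDeriv_fderiv]
  calc τ * ε * (ε ^ (i + 1) * ‖iteratedFDeriv ℝ (i + 2) P (z + ε • w)‖)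
      = τ * ε ^ 2 * ε ^ i * ‖iteratedFDeriv ℝ (i + 2) P (z + ε • w)‖ := by ring
    _ ≤ 1 * 1 * D := by
        gcongr
        · exact pow_le_one₀ hε hε1
        · exact hD _
    _ = D := by ring

lemma norm_iteratedFDeriv_taylorRemainder_le {N : ℕ} (hP : ContDiff ℝ (N + 2 : ℕ) P) {D : ℝ}
    (hD : ∀ k ≤ N + 2, ∀ x, ‖iteratedFDeriv ℝ k P x‖ ≤ D) {τ ε : ℝ} (hτ : 0 ≤ τ) (hε : 0 ≤ ε)
    (hε1 : ε ≤ 1) (hτε : τ * ε ^ 2 ≤ 1) (z : V) {w : V} (hw : ‖w‖ ≤ 1) {k : ℕ} (hk : 1 ≤ k)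
    (hkN : k ≤ N + 2) : ‖iteratedFDeriv ℝ k (taylorRemainder P τ ε z) w‖ ≤ D := by
  obtain rfl | ⟨i, rfl⟩ : k = 1 ∨ ∃ i, k = i + 2 := by
    obtain rfl | h := hk.eq_or_lt
    exacts [.inl rfl, .inr (Nat.exists_eq_add_of_le' h)]
  · rw [norm_iteratedFDeriv_one]
    exact norm_fderiv_taylorRemainder_le (hP.of_le (mod_cast Nat.le_add_left 2 N))
      (hD 2 (Nat.le_add_left 2 N)) hτ hε hτε z hw
  · exact norm_iteratedFDeriv_taylorRemainder_add_two_le (hP.of_le (mod_cast hkN))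
      (hD _ hkN) hτ hε hε1 hτε z w

end TaylorRemainder

section WavePackets

variable {V : Type*} [NormedAddCommGroup V] [InnerProductSpace ℝ V] {P : V → ℝ} {b η : V → ℂ}

/-- The wave packet profile: the amplitude `b` and the phase `τ P`, seen around `z` at scale `ε`
through the window `η`, with the affine part of the phase removed. -/
def packet (P : V → ℝ) (b η : V → ℂ) (τ ε : ℝ) (z w : V) : ℂ :=
  η w * (b (z + ε • w) * Complex.exp (Complex.I * (taylorRemainder P τ ε z w : ℝ)))

lemma contDiff_packet {m : WithTop ℕ∞} (hP : ContDiff ℝ m P) (hb : ContDiff ℝ m b)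
    (hη : ContDiff ℝ m η) (τ ε : ℝ) (z : V) : ContDiff ℝ m (packet P b η τ ε z) :=
  hη.mul ((hb.comp (by fun_prop)).mul
    (contDiff_exp_I_mul.comp (contDiff_taylorRemainder hP τ ε z)))

lemma norm_iteratedFDeriv_exp_taylorRemainder_le {N : ℕ} (hP : ContDiff ℝ (N + 2 : ℕ) P) {D : ℝ}
    (hD1 : 1 ≤ D) (hD : ∀ k ≤ N + 2, ∀ x, ‖iteratedFDeriv ℝ k P x‖ ≤ D) {τ ε : ℝ} (hτ : 0 ≤ τ)
    (hε : 0 ≤ ε) (hε1 : ε ≤ 1) (hτε : τ * ε ^ 2 ≤ 1) (z : V) {w : V} (hw : ‖w‖ ≤ 1) {k : ℕ}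
    (hk : k ≤ N) :
    ‖iteratedFDeriv ℝ k ((fun s : ℝ => Complex.exp (Complex.I * s)) ∘ taylorRemainder P τ ε z) w‖ ≤
      N.factorial * D ^ N := by
  have hchain := norm_iteratedFDeriv_comp_le (n := k) (N := N) (C := 1) (D := D)
    (contDiff_exp_I_mul (m := N))
    (contDiff_taylorRemainder (hP.of_le (mod_cast Nat.le_add_right N 2)) τ ε z) (mod_cast hk) w
    (fun i _ => (norm_iteratedFDeriv_exp_I_mul i _).le)
    (fun i hi hik => (norm_iteratedFDeriv_taylorRemainder_le hP hD hτ hε hε1 hτε z hw hi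
      (by omega)).trans (le_self_pow₀ hD1 (by omega)))
  refine hchain.trans ?_
  rw [mul_one]
  gcongr

variable [FiniteDimensional ℝ V] [MeasurableSpace V] [BorelSpace V]

lemma exists_one_add_norm_pow_mul_norm_fourierInv_packet_le (N : ℕ)
    (hP : ContDiff ℝ (N + 2 : ℕ) P) (hPc : HasCompactSupport P) (hb : ContDiff ℝ N b)
    (hbc : HasCompactSupport b) (hη : ContDiff ℝ N η)
    (hη1 : tsupport η ⊆ Metric.closedBall 0 1) :
    ∃ C : ℝ, 0 ≤ C ∧ ∀ τ ε : ℝ, 0 ≤ τ → 0 ≤ ε → ε ≤ 1 → τ * ε ^ 2 ≤ 1 → ∀ z ζ : V,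
      (1 + ‖ζ‖) ^ N * ‖𝓕⁻ (packet P b η τ ε z) ζ‖ ≤ C := by
  have hηc : HasCompactSupport η :=
    (isCompact_closedBall (0 : V) 1).of_isClosed_subset (isClosed_tsupport η) hη1
  have hPN : ContDiff ℝ N P := hP.of_le (mod_cast Nat.le_add_right N 2)
  obtain ⟨D, hD1, hD⟩ := exists_bound_iteratedFDeriv (N + 2) hP hPc
  obtain ⟨B, hB1, hB⟩ := exists_bound_iteratedFDeriv N hb hbc
  obtain ⟨H, hH1, hH⟩ := exists_bound_iteratedFDeriv N hη hηc
  refine ⟨2 ^ (N - 1) * (1 + 2 ^ N * (N + 1)) *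
    (2 ^ N * (H * (2 ^ N * (B * (N.factorial * D ^ N)))) *
      volume.real (Metric.closedBall (0 : V) 1)), by positivity, fun τ ε hτ hε hε1 hτε z ζ => ?_⟩
  refine one_add_norm_pow_mul_norm_fourierInv_le (isCompact_closedBall 0 1)
    (contDiff_packet hPN hb hη τ ε z) ((tsupport_mul_subset_left (f := η)).trans hη1)
    (fun k hk w hw => ?_) ζ
  have hscaled : ContDiff ℝ N fun w => b (z + ε • w) := hb.comp (by fun_prop)
  have hosc : ContDiff ℝ N
      ((fun s : ℝ => Complex.exp (Complex.I * s)) ∘ taylorRemainder P τ ε z) :=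
    contDiff_exp_I_mul.comp (contDiff_taylorRemainder hPN τ ε z)
  refine norm_iteratedFDeriv_mul_le_of_le hη (hscaled.mul hosc) w (fun k hk => hH k hk w)
    (fun k hk => norm_iteratedFDeriv_mul_le_of_le hscaled hosc w (fun i hi => ?_) (fun i hi => ?_)
      hk) hk
  · rw [norm_iteratedFDeriv_comp_add_smul (hb.of_le (mod_cast hi)), abs_of_nonneg hε]
    calc ε ^ i * ‖iteratedFDeriv ℝ i b (z + ε • w)‖ ≤ 1 * B := by
          gcongr
          · exact pow_le_one₀ hε hε1
          · exact hB i hi _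
      _ = B := one_mul B
  · exact norm_iteratedFDeriv_exp_taylorRemainder_le hP hD1 hD hτ hε hε1 hτε z
      (mem_closedBall_zero_iff.1 hw) hi

lemma exists_contDiff_integral_eq_one {δ : ℝ} (hδ : 0 < δ) :
    ∃ η : V → ℂ, ContDiff ℝ ∞ η ∧ tsupport η ⊆ Metric.closedBall 0 δ ∧ ∫ w, η w = 1 := by
  let φ : ContDiffBump (0 : V) := ⟨δ / 2, δ, by positivity, by linarith⟩
  refine ⟨fun w => (φ.normed volume w : ℂ), Complex.ofRealCLM.contDiff.comp φ.contDiff_normed,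
    ?_, ?_⟩
  · exact (tsupport_comp_subset Complex.ofReal_zero _).trans φ.tsupport_normed_eq.subset
  · rw [integral_complex_ofReal, φ.integral_normed, Complex.ofReal_one]

lemma integrable_mul_comp_add_smul {η h : V → ℂ} (hη : Integrable η) (hh : Integrable h) (ε : ℝ) :
    Integrable (fun p : V × V => η p.1 * h (p.2 + ε • p.1)) (volume.prod volume) :=
  ((MeasurePreserving.id volume).skew_product (g := fun w z : V => z + ε • w) (by fun_prop)
    (Eventually.of_forall fun w => (measurePreserving_add_right volume (ε • w)).map_eq)
    ).integrable_comp_of_integrable (hη.mul_prod hh)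

lemma integral_eq_integral_integral_mul_comp_add_smul {η h : V → ℂ} (hη : Integrable η)
    (hη1 : ∫ w, η w = 1) (hh : Integrable h) (ε : ℝ) :
    ∫ ξ, h ξ = ∫ z, ∫ w, η w * h (z + ε • w) := by
  rw [← integral_integral_swap (integrable_mul_comp_add_smul hη hh ε)]
  simp only [integral_const_mul, integral_add_right_eq_self h]
  rw [integral_mul_const, hη1, one_mul]

omit [MeasurableSpace V] [BorelSpace V] in
lemma exp_inner_mul_exp_phase_eq (P : V → ℝ) (τ ε : ℝ) (x z w : V) :
    Complex.exp (↑(2 * Real.pi * inner ℝ (z + ε • w) x) * Complex.I) *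
        Complex.exp (Complex.I * (τ * P (z + ε • w) : ℝ)) =
      Complex.exp (↑(2 * Real.pi * inner ℝ z x) * Complex.I) *
        Complex.exp (Complex.I * (τ * P z : ℝ)) *
      (Complex.exp (↑(2 * Real.pi *
          inner ℝ w (ε • (x + (τ / (2 * Real.pi)) • gradient P z))) * Complex.I) *
        Complex.exp (Complex.I * (taylorRemainder P τ ε z w : ℝ))) := by
  have hgrad : fderiv ℝ P z w = inner ℝ w (gradient P z) := by
    rw [real_inner_comm, gradient, InnerProductSpace.toDual_symm_apply]
  have hpi : (Real.pi : ℂ) ≠ 0 := mod_cast Real.pi_ne_zero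
  simp only [taylorRemainder, hgrad, ← Complex.exp_add, inner_add_left, inner_add_right,
    real_inner_smul_left, real_inner_smul_right]
  congr 1
  push_cast
  field_simp
  ring

lemma integral_packet_eq (P : V → ℝ) (b η : V → ℂ) (τ ε : ℝ) (x z : V) :
    ∫ w, η w * (Complex.exp (↑(2 * Real.pi * inner ℝ (z + ε • w) x) * Complex.I) *
        (Complex.exp (Complex.I * (τ * P (z + ε • w) : ℝ)) * b (z + ε • w))) =
      Complex.exp (↑(2 * Real.pi * inner ℝ z x) * Complex.I) *
        Complex.exp (Complex.I * (τ * P z : ℝ)) *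
      𝓕⁻ (packet P b η τ ε z) (ε • (x + (τ / (2 * Real.pi)) • gradient P z)) := by
  rw [Real.fourierInv_eq', ← integral_const_mul]
  congr 1 with w
  simp only [packet, smul_eq_mul]
  linear_combination (η w * b (z + ε • w)) * exp_inner_mul_exp_phase_eq P τ ε x z w

/-- At the scale `ε` with `τ ε² ≤ 1` the phase is affine on each packet up to a bounded error, so
the packet at `z` is concentrated where the phase is stationary at `z`, up to `1 / ε`. -/
lemma exists_norm_fourierInv_osc_le (N : ℕ) (hP : ContDiff ℝ (N + 2 : ℕ) P)
    (hPc : HasCompactSupport P) (hb : ContDiff ℝ N b) (hbc : HasCompactSupport b) {δ : ℝ}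
    (hδ : 0 < δ) {A : Set V} (hA : IsCompact A)
    (hbA : ∀ z w : V, ‖w‖ ≤ δ → b (z + w) ≠ 0 → z ∈ A) :
    ∃ C : ℝ, 0 ≤ C ∧ ∀ τ ε : ℝ, 0 ≤ τ → 0 < ε → ε ≤ 1 → τ * ε ^ 2 ≤ 1 → ∀ x : V,
      ‖𝓕⁻ (fun ξ => Complex.exp (Complex.I * (τ * P ξ : ℝ)) * b ξ) x‖ ≤
        C * ∫ z in A, ((1 + ‖ε • (x + (τ / (2 * Real.pi)) • gradient P z)‖) ^ N)⁻¹ := by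
  obtain ⟨η, hη, hηδ, hη1⟩ := exists_contDiff_integral_eq_one (V := V) (lt_min hδ one_pos)
  have hηc : HasCompactSupport η :=
    (isCompact_closedBall (0 : V) _).of_isClosed_subset (isClosed_tsupport η) hηδ
  obtain ⟨C, hC0, hC⟩ := exists_one_add_norm_pow_mul_norm_fourierInv_packet_le N hP hPc hb hbc
    (hη.of_le (mod_cast le_top))
    (hηδ.trans (Metric.closedBall_subset_closedBall (min_le_right δ 1)))
  refine ⟨C, hC0, fun τ ε hτ hε hε1 hτε x => ?_⟩
  set h : V → ℂ := fun ξ => Complex.exp (↑(2 * Real.pi * inner ℝ ξ x) * Complex.I) *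
    (Complex.exp (Complex.I * (τ * P ξ : ℝ)) * b ξ) with hh
  have hhint : Integrable h := by
    have hPcont := hP.continuous
    have hbcont := hb.continuous
    exact Continuous.integrable_of_hasCompactSupport (by fun_prop) (hbc.mul_left.mul_left)
  have hzero : ∀ z ∉ A, ∫ w, η w * h (z + ε • w) = 0 := fun z hz => by
    refine integral_eq_zero_of_ae (Eventually.of_forall fun w => by_contra fun hne => hz ?_)
    have hw : ‖w‖ ≤ δ := (mem_closedBall_zero_iff.1
      (hηδ (subset_tsupport η (left_ne_zero_of_mul hne)))).trans (min_le_left δ 1)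
    refine hbA z (ε • w) ?_
      (right_ne_zero_of_mul (right_ne_zero_of_mul (right_ne_zero_of_mul hne)))
    rw [norm_smul, Real.norm_of_nonneg hε.le]
    exact (mul_le_of_le_one_left (norm_nonneg w) hε1).trans hw
  have hgrad : Continuous (gradient P) :=
    (InnerProductSpace.toDual ℝ V).symm.continuous.comp (hP.continuous_fderiv (by simp))
  rw [Real.fourierInv_eq']
  change ‖∫ ξ, h ξ‖ ≤ _
  rw [integral_eq_integral_integral_mul_comp_add_smul
      (hη.continuous.integrable_of_hasCompactSupport hηc) hη1 hhint ε,
    ← setIntegral_eq_integral_of_forall_compl_eq_zero hzero, ← integral_const_mul]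
  refine norm_integral_le_of_norm_le (ContinuousOn.integrableOn_compact hA ?_)
    (Eventually.of_forall fun z => ?_)
  · exact (continuous_const.mul (Continuous.inv₀ (by fun_prop)
      fun z => by positivity)).continuousOn
  · rw [hh, integral_packet_eq, norm_mul, norm_mul, Complex.norm_exp_ofReal_mul_I,
      norm_exp_I_mul, one_mul, one_mul, ← div_eq_mul_inv, le_div_iff₀ (by positivity), mul_comm]
    exact hC τ ε hτ hε.le hε1 hτε z _

end WavePackets

section PowerPhase

variable {V : Type*} [NormedAddCommGroup V] [InnerProductSpace ℝ V] {a s₁ s₂ : ℝ}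

/-- The closed annulus `s₁ ≤ ‖z‖ ≤ s₂` around the origin. -/
def annulus (V : Type*) [NormedAddCommGroup V] (s₁ s₂ : ℝ) : Set V := {z | ‖z‖ ∈ Set.Icc s₁ s₂}

lemma isCompact_annulus {V : Type*} [NormedAddCommGroup V] [ProperSpace V] (s₁ s₂ : ℝ) :
    IsCompact (annulus V s₁ s₂) :=
  (isCompact_closedBall (0 : V) s₂).of_isClosed_subset
    (isClosed_Icc.preimage continuous_norm) fun z hz => by simpa using hz.2

/-- The gradient of the phase `(2π‖z‖)^a` away from the origin. -/
def phaseGradient (a : ℝ) (z : V) : V := (a * (2 * Real.pi) ^ a * ‖z‖ ^ (a - 2)) • z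

lemma hasGradientAt_phase [CompleteSpace V] (a : ℝ) {z : V} (hz : z ≠ 0) :
    HasGradientAt (fun ξ : V => (2 * Real.pi * ‖ξ‖) ^ a) (phaseGradient a z) z := by
  have hpow (e : ℝ) (ξ : V) : (‖ξ‖ ^ 2) ^ e = ‖ξ‖ ^ (2 * e) := by
    rw [← Real.rpow_natCast, ← Real.rpow_mul (norm_nonneg _), Nat.cast_ofNat]
  have hphase : (fun ξ : V => (2 * Real.pi * ‖ξ‖) ^ a) =
      fun ξ => (2 * Real.pi) ^ a * (‖ξ‖ ^ 2) ^ (a / 2) := by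
    ext ξ
    rw [Real.mul_rpow (by positivity) (norm_nonneg _), hpow, mul_div_cancel₀ _ two_ne_zero]
  rw [hasGradientAt_iff_hasFDerivAt, hphase]
  convert! ((hasStrictFDerivAt_norm_sq z).hasFDerivAt.rpow_const (p := a / 2)
    (Or.inl (pow_ne_zero 2 (norm_ne_zero_iff.2 hz)))).const_mul ((2 * Real.pi) ^ a) using 1
  ext v
  simp only [phaseGradient, hpow, mul_sub, mul_div_cancel₀ a two_ne_zero, mul_one,
    InnerProductSpace.toDual_apply_apply, real_inner_smul_left, FunLike.coe_smul, Pi.smul_apply,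
    smul_eq_mul, innerSL_apply_apply, two_smul, FunLike.coe_add, Pi.add_apply]
  ring

lemma continuousOn_phaseGradient (a : ℝ) (h₁ : 0 < s₁) :
    ContinuousOn (phaseGradient a) (annulus V s₁ s₂) :=
  ((continuous_norm.continuousOn.rpow_const fun _ hz => Or.inl (h₁.trans_le hz.1).ne').const_mul
    _).smul continuousOn_id

lemma exists_pos_le_rpow (q : ℝ) (h₁ : 0 < s₁) :
    ∃ m : ℝ, 0 < m ∧ ∀ s ∈ Set.Icc s₁ s₂, m ≤ s ^ q := by
  rcases lt_or_ge s₂ s₁ with h | h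
  · exact ⟨1, one_pos, fun s hs => absurd (hs.1.trans hs.2) (not_le.2 h)⟩
  · obtain ⟨x, hx, hmin⟩ := isCompact_Icc.exists_isMinOn (s := Set.Icc s₁ s₂)
      (f := fun s : ℝ => s ^ q) ⟨s₁, le_rfl, h⟩
      (fun s hs => (Real.continuousAt_rpow_const s q
        (Or.inl (h₁.trans_le hs.1).ne')).continuousWithinAt)
    exact ⟨x ^ q, Real.rpow_pos_of_pos (h₁.trans_le hx.1) q, fun s hs => hmin hs⟩

lemma exists_pos_mul_abs_sub_le_abs_rpow_sub {e : ℝ} (he : e ≠ 0) (h₁ : 0 < s₁) :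
    ∃ m : ℝ, 0 < m ∧ ∀ s ∈ Set.Icc s₁ s₂, ∀ t ∈ Set.Icc s₁ s₂,
      m * |s - t| ≤ |s ^ e - t ^ e| := by
  obtain ⟨m, hm, hle⟩ := exists_pos_le_rpow (e - 1) (s₂ := s₂) h₁
  refine ⟨|e| * m, mul_pos (abs_pos.2 he) hm, fun s hs t ht => ?_⟩
  wlog hst : s < t generalizing s t
  · rcases (not_lt.1 hst).eq_or_lt with rfl | h
    · simp
    · rw [abs_sub_comm, abs_sub_comm (s ^ e)]
      exact this t ht s hs h
  obtain ⟨c, hc, hce⟩ := exists_hasDerivAt_eq_slope (fun x : ℝ => x ^ e)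
    (fun x => e * x ^ (e - 1)) hst
    (fun x hx => (Real.continuousAt_rpow_const x e
      (Or.inl (h₁.trans_le (hs.1.trans hx.1)).ne')).continuousWithinAt)
    (fun x hx => Real.hasDerivAt_rpow_const (Or.inl (h₁.trans_le (hs.1.trans hx.1.le)).ne'))
  have hmean : t ^ e - s ^ e = e * c ^ (e - 1) * (t - s) := by
    rw [hce]
    field_simp [(sub_pos.2 hst).ne']
  have hmc : m ≤ c ^ (e - 1) := hle c ⟨hs.1.trans hc.1.le, hc.2.le.trans ht.2⟩
  rw [abs_sub_comm, abs_sub_comm (s ^ e), hmean, abs_mul, abs_mul, abs_of_pos (hm.trans_le hmc)]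
  gcongr

lemma norm_sq_smul_sub_smul (p q : ℝ) (z w : V) :
    ‖p • z - q • w‖ ^ 2 = (p * ‖z‖ - q * ‖w‖) ^ 2 +
      2 * (p * q) * (‖z‖ * ‖w‖ - inner ℝ z w) := by
  rw [@norm_sub_sq ℝ, norm_smul, norm_smul, real_inner_smul_left, real_inner_smul_right,
    mul_pow, mul_pow, Real.norm_eq_abs, Real.norm_eq_abs, sq_abs, sq_abs, RCLike.re_to_real]
  ring

lemma norm_phaseGradient_sub_sq (a : ℝ) {z w : V} (hz : z ≠ 0) (hw : w ≠ 0) :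
    ‖phaseGradient a z - phaseGradient a w‖ ^ 2 =
      (a * (2 * Real.pi) ^ a * (‖z‖ ^ (a - 1) - ‖w‖ ^ (a - 1))) ^ 2 +
      2 * ((a * (2 * Real.pi) ^ a) ^ 2 * (‖z‖ ^ (a - 2) * ‖w‖ ^ (a - 2))) *
        (‖z‖ * ‖w‖ - inner ℝ z w) := by
  have hpow {s : ℝ} (hs : s ≠ 0) : s ^ (a - 1) = s ^ (a - 2) * s := by
    rw [← Real.rpow_add_one hs]
    congr 1
    ring
  rw [phaseGradient, phaseGradient, norm_sq_smul_sub_smul, hpow (norm_ne_zero_iff.2 hz),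
    hpow (norm_ne_zero_iff.2 hw)]
  ring

lemma exists_pos_mul_norm_sub_le_norm_phaseGradient_sub (ha : 0 < a) (ha1 : a ≠ 1) (h₁ : 0 < s₁) :
    ∃ c : ℝ, 0 < c ∧ ∀ z ∈ annulus V s₁ s₂, ∀ w ∈ annulus V s₁ s₂,
      c * ‖z - w‖ ≤ ‖phaseGradient a z - phaseGradient a w‖ := by
  obtain ⟨m, hm, hle⟩ := exists_pos_le_rpow (a - 2) (s₂ := s₂) h₁
  obtain ⟨m', hm', hle'⟩ := exists_pos_mul_abs_sub_le_abs_rpow_sub (sub_ne_zero.2 ha1)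
    (s₂ := s₂) h₁
  have hmin : 0 < min m m' := lt_min hm hm'
  refine ⟨a * (2 * Real.pi) ^ a * min m m', by positivity, fun z hz w hw => ?_⟩
  refine le_of_sq_le_sq ?_ (norm_nonneg _)
  have hangle : 0 ≤ ‖z‖ * ‖w‖ - inner ℝ z w := sub_nonneg.2 (real_inner_le_norm z w)
  have hradial : (min m m' * (‖z‖ - ‖w‖)) ^ 2 ≤ (‖z‖ ^ (a - 1) - ‖w‖ ^ (a - 1)) ^ 2 := by
    refine sq_le_sq.2 ?_
    rw [abs_mul, abs_of_pos hmin]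
    exact (mul_le_mul_of_nonneg_right (min_le_right _ _) (abs_nonneg _)).trans
      (hle' _ hz _ hw)
  have hangular : min m m' * min m m' ≤ ‖z‖ ^ (a - 2) * ‖w‖ ^ (a - 2) :=
    mul_le_mul ((min_le_left _ _).trans (hle _ hz)) ((min_le_left _ _).trans (hle _ hw))
      hmin.le (by positivity)
  calc (a * (2 * Real.pi) ^ a * min m m' * ‖z - w‖) ^ 2
      = (a * (2 * Real.pi) ^ a) ^ 2 * ((min m m' * (‖z‖ - ‖w‖)) ^ 2 +
          2 * (min m m' * min m m') * (‖z‖ * ‖w‖ - inner ℝ z w)) := by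
        have := norm_sq_smul_sub_smul 1 1 z w
        simp only [one_smul, one_mul, mul_one] at this
        rw [mul_pow, this]
        ring
    _ ≤ (a * (2 * Real.pi) ^ a) ^ 2 * ((‖z‖ ^ (a - 1) - ‖w‖ ^ (a - 1)) ^ 2 +
          2 * (‖z‖ ^ (a - 2) * ‖w‖ ^ (a - 2)) * (‖z‖ * ‖w‖ - inner ℝ z w)) := by gcongr
    _ = ‖phaseGradient a z - phaseGradient a w‖ ^ 2 := by
        rw [norm_phaseGradient_sub_sq a (norm_pos_iff.1 (h₁.trans_le hz.1))
          (norm_pos_iff.1 (h₁.trans_le hw.1))]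
        ring

lemma norm_mul_norm_sq_orthogonalProjectionOnto_le (z w : V) :
    ‖w‖ * ‖(Submodule.span ℝ {w})ᗮ.orthogonalProjectionOnto z‖ ^ 2 ≤
      2 * ‖z‖ * (‖z‖ * ‖w‖ - inner ℝ z w) := by
  rcases eq_or_ne w 0 with rfl | hw
  · simp
  have hw0 : 0 < ‖w‖ := norm_pos_iff.2 hw
  have hspan : ‖(Submodule.span ℝ {w}).orthogonalProjectionOnto z‖ ^ 2 =
      (inner ℝ z w) ^ 2 / ‖w‖ ^ 2 := by
    rw [Submodule.coe_norm, ← Submodule.starProjection_apply,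
      Submodule.starProjection_singleton ℝ (v := w) z, norm_smul, mul_pow, Real.norm_eq_abs,
      sq_abs, real_inner_comm]
    simp only [RCLike.ofReal_real_eq_id, id]
    field_simp
  have hpyth := Submodule.norm_sq_eq_add_norm_sq_projection z (Submodule.span ℝ {w})
  have hfactor : ‖w‖ * ‖(Submodule.span ℝ {w})ᗮ.orthogonalProjectionOnto z‖ ^ 2 =
      (‖z‖ * ‖w‖ + inner ℝ z w) / ‖w‖ * (‖z‖ * ‖w‖ - inner ℝ z w) := by
    rw [eq_sub_of_add_eq' hpyth.symm, hspan]
    field_simp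
    ring
  have hCS := real_inner_le_norm z w
  rw [hfactor]
  refine mul_le_mul_of_nonneg_right ((div_le_iff₀ hw0).2 ?_) (sub_nonneg.2 hCS)
  linarith

/-- For `a = 1` the phase gradient is constant on rays, so only the component of `z` orthogonal
to `w` is controlled. -/
lemma exists_pos_mul_norm_orthogonalProjectionOnto_le_norm_phaseGradient_sub (ha : 0 < a)
    (h₁ : 0 < s₁) (h₁₂ : s₁ ≤ s₂) :
    ∃ c : ℝ, 0 < c ∧ ∀ z ∈ annulus V s₁ s₂, ∀ w ∈ annulus V s₁ s₂,
      c * ‖(Submodule.span ℝ {w})ᗮ.orthogonalProjectionOnto z‖ ≤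
        ‖phaseGradient a z - phaseGradient a w‖ := by
  obtain ⟨m, hm, hle⟩ := exists_pos_le_rpow (a - 2) (s₂ := s₂) h₁
  have h₂ : 0 < s₂ := h₁.trans_le h₁₂
  refine ⟨a * (2 * Real.pi) ^ a * m * √(s₁ / s₂), by positivity, fun z hz w hw => ?_⟩
  refine le_of_sq_le_sq ?_ (norm_nonneg _)
  have hangle : 0 ≤ ‖z‖ * ‖w‖ - inner ℝ z w := sub_nonneg.2 (real_inner_le_norm z w)
  have hproj : s₁ / s₂ * ‖(Submodule.span ℝ {w})ᗮ.orthogonalProjectionOnto z‖ ^ 2 ≤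
      2 * (‖z‖ * ‖w‖ - inner ℝ z w) := by
    rw [div_mul_eq_mul_div, div_le_iff₀ h₂]
    calc s₁ * ‖(Submodule.span ℝ {w})ᗮ.orthogonalProjectionOnto z‖ ^ 2
        ≤ ‖w‖ * ‖(Submodule.span ℝ {w})ᗮ.orthogonalProjectionOnto z‖ ^ 2 := by gcongr; exact hw.1
      _ ≤ 2 * ‖z‖ * (‖z‖ * ‖w‖ - inner ℝ z w) :=
          norm_mul_norm_sq_orthogonalProjectionOnto_le z w
      _ ≤ 2 * s₂ * (‖z‖ * ‖w‖ - inner ℝ z w) := by gcongr; exact hz.2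
      _ = 2 * (‖z‖ * ‖w‖ - inner ℝ z w) * s₂ := by ring
  have hangular : m * m ≤ ‖z‖ ^ (a - 2) * ‖w‖ ^ (a - 2) :=
    mul_le_mul (hle _ hz) (hle _ hw) hm.le (by positivity)
  calc (a * (2 * Real.pi) ^ a * m * √(s₁ / s₂) *
        ‖(Submodule.span ℝ {w})ᗮ.orthogonalProjectionOnto z‖) ^ 2
      = (a * (2 * Real.pi) ^ a) ^ 2 * (m * m) *
          (s₁ / s₂ * ‖(Submodule.span ℝ {w})ᗮ.orthogonalProjectionOnto z‖ ^ 2) := by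
        rw [mul_pow, mul_pow, Real.sq_sqrt (by positivity)]
        ring
    _ ≤ (a * (2 * Real.pi) ^ a) ^ 2 * (‖z‖ ^ (a - 2) * ‖w‖ ^ (a - 2)) *
          (2 * (‖z‖ * ‖w‖ - inner ℝ z w)) := by gcongr
    _ = 2 * ((a * (2 * Real.pi) ^ a) ^ 2 * (‖z‖ ^ (a - 2) * ‖w‖ ^ (a - 2))) *
          (‖z‖ * ‖w‖ - inner ℝ z w) := by ring
    _ ≤ ‖phaseGradient a z - phaseGradient a w‖ ^ 2 := by
        rw [norm_phaseGradient_sub_sq a (norm_pos_iff.1 (h₁.trans_le hz.1))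
          (norm_pos_iff.1 (h₁.trans_le hw.1))]
        exact le_add_of_nonneg_left (sq_nonneg _)

end PowerPhase

section NormIntegrals

variable {W : Type*} [NormedAddCommGroup W] [MeasurableSpace W] [BorelSpace W]

lemma integrable_inv_one_add_norm_pow [NormedSpace ℝ W] [FiniteDimensional ℝ W] (μ : Measure W)
    [μ.IsAddHaarMeasure] {N : ℕ} (hN : Module.finrank ℝ W < N) :
    Integrable (fun x : W => ((1 + ‖x‖) ^ N)⁻¹) μ := by
  simpa [Real.rpow_neg, add_nonneg] using
    integrable_one_add_norm (μ := μ) (E := W) (r := N) (mod_cast hN)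

lemma integrable_inv_one_add_mul_norm_pow [NormedSpace ℝ W] [FiniteDimensional ℝ W]
    (μ : Measure W) [μ.IsAddHaarMeasure] {N : ℕ} (hN : Module.finrank ℝ W < N) {l : ℝ}
    (hl : 0 < l) : Integrable (fun x : W => ((1 + l * ‖x‖) ^ N)⁻¹) μ := by
  simpa [norm_smul, abs_of_pos hl] using
    (integrable_inv_one_add_norm_pow μ hN).comp_smul hl.ne'

lemma integral_inv_one_add_mul_norm_pow [NormedSpace ℝ W] [FiniteDimensional ℝ W]
    (μ : Measure W) [μ.IsAddHaarMeasure] (N : ℕ) {l : ℝ} (hl : 0 < l) :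
    ∫ x, ((1 + l * ‖x‖) ^ N)⁻¹ ∂μ =
      (l ^ Module.finrank ℝ W)⁻¹ * ∫ x, ((1 + ‖x‖) ^ N)⁻¹ ∂μ := by
  have hscale := Measure.integral_comp_smul μ (fun x : W => ((1 + ‖x‖) ^ N)⁻¹) l
  rw [abs_of_pos (by positivity)] at hscale
  simpa [norm_smul, abs_of_pos hl] using hscale

lemma integral_comp_norm_eq_of_finrank_eq [InnerProductSpace ℝ W] [FiniteDimensional ℝ W]
    {d : ℕ} (hd : Module.finrank ℝ W = d) (f : ℝ → ℝ) : ∫ x : W, f ‖x‖ = ∫ x : E d, f ‖x‖ := by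
  let b := (stdOrthonormalBasis ℝ W).reindex (finCongr hd)
  rw [← b.measurePreserving_repr.integral_comp b.repr.toHomeomorph.measurableEmbedding]
  simp only [LinearIsometryEquiv.norm_map]

lemma volume_closedBall_of_finrank_eq_one [InnerProductSpace ℝ W] [FiniteDimensional ℝ W]
    (h : Module.finrank ℝ W = 1) (R : ℝ) :
    volume (Metric.closedBall (0 : W) R) = volume (Metric.closedBall (0 : ℝ) R) := by
  have : Nontrivial W := Module.nontrivial_of_finrank_pos (h ▸ one_pos)
  rw [InnerProductSpace.volume_closedBall, InnerProductSpace.volume_closedBall, h,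
    Module.finrank_self]

end NormIntegrals

section GradientIntegrals

variable {V : Type*} [NormedAddCommGroup V] [InnerProductSpace ℝ V] [FiniteDimensional ℝ V]
  [MeasurableSpace V] [BorelSpace V] {a s₁ s₂ : ℝ}

lemma measurePreserving_orthogonalProjectionOnto_prod (K : Submodule ℝ V) :
    MeasurePreserving (fun z : V => (K.orthogonalProjectionOnto z, Kᗮ.orthogonalProjectionOnto z))
      volume (volume.prod volume) := by
  convert! (WithLp.volume_preserving_ofLp _ _).comp K.orthogonalDecomposition.measurePreserving
  simp

lemma integral_closedBall_inv_one_add_mul_norm_orthogonalProjectionOnto_le {d N : ℕ}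
    (hd : d + 1 = Module.finrank ℝ V) (hN : d < N) (R : ℝ) {w : V} (hw : w ≠ 0) {l : ℝ}
    (hl : 0 < l) :
    ∫ z in Metric.closedBall (0 : V) R,
        ((1 + l * ‖(Submodule.span ℝ {w})ᗮ.orthogonalProjectionOnto z‖) ^ N)⁻¹ ≤
      (volume.real (Metric.closedBall (0 : ℝ) R) * ∫ x : E d, ((1 + ‖x‖) ^ N)⁻¹) * (l ^ d)⁻¹ := by
  set K := Submodule.span ℝ {w}
  have : Fact (Module.finrank ℝ V = d + 1) := ⟨hd.symm⟩
  have hfin : Module.finrank ℝ Kᗮ = d := Submodule.finrank_orthogonal_span_singleton hw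
  let F : K × Kᗮ → ℝ := fun p =>
    (Metric.closedBall (0 : K) R).indicator 1 p.1 * ((1 + l * ‖p.2‖) ^ N)⁻¹
  have hF0 (p) : 0 ≤ F p :=
    mul_nonneg (Set.indicator_nonneg (fun _ _ => zero_le_one) _) (by positivity)
  have hFint : Integrable F (volume.prod volume) :=
    ((integrable_indicator_iff Metric.isClosed_closedBall.measurableSet).2
      (integrableOn_const (isCompact_closedBall (0 : K) R).measure_lt_top.ne)).mul_prod
      (integrable_inv_one_add_mul_norm_pow volume (hfin.trans_lt hN) hl)
  have hproj := measurePreserving_orthogonalProjectionOnto_prod K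
  have hFproj : Integrable
      (fun z : V => F (K.orthogonalProjectionOnto z, Kᗮ.orthogonalProjectionOnto z)) :=
    hproj.integrable_comp_of_integrable hFint
  calc ∫ z in Metric.closedBall (0 : V) R, ((1 + l * ‖Kᗮ.orthogonalProjectionOnto z‖) ^ N)⁻¹
      = ∫ z in Metric.closedBall (0 : V) R,
          F (K.orthogonalProjectionOnto z, Kᗮ.orthogonalProjectionOnto z) := by
        refine setIntegral_congr_fun Metric.isClosed_closedBall.measurableSet fun z hz => ?_
        have hzK : K.orthogonalProjectionOnto z ∈ Metric.closedBall (0 : K) R :=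
          mem_closedBall_zero_iff.2 <| (K.norm_orthogonalProjectionOnto_apply_le z).trans
            (mem_closedBall_zero_iff.1 hz)
        simp only [F, Set.indicator_of_mem hzK, Pi.one_apply, one_mul]
    _ ≤ ∫ z, F (K.orthogonalProjectionOnto z, Kᗮ.orthogonalProjectionOnto z) :=
        setIntegral_le_integral hFproj (Eventually.of_forall fun _ => hF0 _)
    _ = ∫ p, F p ∂(volume.prod volume) := by
        rw [← hproj.map_eq, integral_map hproj.measurable.aemeasurable
          (hproj.map_eq ▸ hFint.aestronglyMeasurable)]
    _ = (∫ u, (Metric.closedBall (0 : K) R).indicator 1 u) *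
          ∫ v : Kᗮ, ((1 + l * ‖v‖) ^ N)⁻¹ :=
        integral_prod_mul ((Metric.closedBall (0 : K) R).indicator 1)
          fun v : Kᗮ => ((1 + l * ‖v‖) ^ N)⁻¹
    _ = _ := by
        rw [integral_indicator_one Metric.isClosed_closedBall.measurableSet, Measure.real,
          volume_closedBall_of_finrank_eq_one (finrank_span_singleton hw), ← Measure.real,
          integral_inv_one_add_mul_norm_pow _ _ hl, hfin,
          integral_comp_norm_eq_of_finrank_eq hfin fun s => ((1 + s) ^ N)⁻¹]
        ring

lemma mul_norm_sub_le_of_isMinOn {V : Type*} [SeminormedAddCommGroup V] [NormedSpace ℝ V]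
    {G : V → V} {A : Set V} {x w z : V} {σ : ℝ} (hσ : 0 ≤ σ)
    (hw : IsMinOn (fun z => ‖x + σ • G z‖) A w) (hz : z ∈ A) :
    σ / 2 * ‖G z - G w‖ ≤ ‖x + σ • G z‖ := by
  have hmin : ‖x + σ • G w‖ ≤ ‖x + σ • G z‖ := hw hz
  have htri : σ * ‖G z - G w‖ ≤ ‖x + σ • G z‖ + ‖x + σ • G w‖ := by
    rw [← Real.norm_of_nonneg hσ, ← norm_smul, Real.norm_of_nonneg hσ, smul_sub,
      ← add_sub_add_left_eq_sub _ _ x]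
    exact norm_sub_le _ _
  linarith

/-- The integrand is compared with its value relative to the minimum point `w` of
`z ↦ ‖x + σ • G z‖` on `A`; `q` measures how `G` separates points. -/
lemma setIntegral_inv_one_add_norm_pow_le {G : V → V} {A : Set V} (hA : IsCompact A)
    (hG : ContinuousOn G A) {q : V → V → ℝ} (hq0 : ∀ z w, 0 ≤ q z w)
    (hqc : ∀ w, Continuous fun z => q z w) {c : ℝ} (hc : 0 < c)
    (hq : ∀ z ∈ A, ∀ w ∈ A, c * q z w ≤ ‖G z - G w‖) {N d : ℕ} {C : ℝ} (hC : 0 ≤ C)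
    (hint : ∀ w ∈ A, ∀ l : ℝ, 0 < l → ∫ z in A, ((1 + l * q z w) ^ N)⁻¹ ≤ C * (l ^ d)⁻¹)
    {ε σ : ℝ} (hε : 0 < ε) (hσ : 0 < σ) (x : V) :
    ∫ z in A, ((1 + ‖ε • (x + σ • G z)‖) ^ N)⁻¹ ≤ C * ((c / 2) ^ d)⁻¹ * ((ε * σ) ^ d)⁻¹ := by
  rcases A.eq_empty_or_nonempty with rfl | hne
  · simp only [Measure.restrict_empty, integral_zero_measure]
    positivity
  obtain ⟨w, hwA, hw⟩ := hA.exists_isMinOn hne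
    (continuousOn_const.add (hG.const_smul σ)).norm
  have hl : 0 < ε * σ * (c / 2) := by positivity
  have hone_add (z : V) : 0 < 1 + ε * σ * (c / 2) * q z w :=
    add_pos_of_pos_of_nonneg one_pos (mul_nonneg hl.le (hq0 z w))
  have hqint : IntegrableOn (fun z => ((1 + ε * σ * (c / 2) * q z w) ^ N)⁻¹) A := by
    refine ContinuousOn.integrableOn_compact hA (Continuous.continuousOn ?_)
    refine ((continuous_const.add (continuous_const.mul (hqc w))).pow N).inv₀ fun z => ?_
    exact (pow_pos (hone_add z) N).ne'
  calc ∫ z in A, ((1 + ‖ε • (x + σ • G z)‖) ^ N)⁻¹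
      ≤ ∫ z in A, ((1 + ε * σ * (c / 2) * q z w) ^ N)⁻¹ := by
        refine integral_mono_of_nonneg (Eventually.of_forall fun z => by positivity) hqint
          ((ae_restrict_iff' hA.measurableSet).2 (Eventually.of_forall fun z hz => ?_))
        have := hone_add z
        dsimp only
        gcongr
        rw [norm_smul, Real.norm_of_nonneg hε.le]
        calc ε * σ * (c / 2) * q z w = ε * (σ / 2 * (c * q z w)) := by ring
          _ ≤ ε * (σ / 2 * ‖G z - G w‖) := by gcongr; exact hq z hz w hwA
          _ ≤ ε * ‖x + σ • G z‖ := by gcongr; exact mul_norm_sub_le_of_isMinOn hσ.le hw hz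
    _ ≤ C * ((ε * σ * (c / 2)) ^ d)⁻¹ := hint w hwA _ hl
    _ = C * ((c / 2) ^ d)⁻¹ * ((ε * σ) ^ d)⁻¹ := by rw [mul_pow, mul_inv]; ring

lemma exists_integral_phaseGradient_le (ha : 0 < a) (ha1 : a ≠ 1) (h₁ : 0 < s₁) {N : ℕ}
    (hN : Module.finrank ℝ V < N) : ∃ C : ℝ, 0 ≤ C ∧ ∀ ε σ : ℝ, 0 < ε → 0 < σ → ∀ x : V,
      ∫ z in annulus V s₁ s₂, ((1 + ‖ε • (x + σ • phaseGradient a z)‖) ^ N)⁻¹ ≤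
        C * ((ε * σ) ^ Module.finrank ℝ V)⁻¹ := by
  obtain ⟨c, hc, hsep⟩ := exists_pos_mul_norm_sub_le_norm_phaseGradient_sub (V := V) ha ha1
    (s₂ := s₂) h₁
  have hI : 0 ≤ ∫ x : V, ((1 + ‖x‖) ^ N)⁻¹ := integral_nonneg fun x => by positivity
  refine ⟨_, by positivity, fun ε σ hε hσ x => setIntegral_inv_one_add_norm_pow_le
    (isCompact_annulus s₁ s₂) (continuousOn_phaseGradient a h₁) (fun z w => norm_nonneg (z - w))
    (fun w => by fun_prop) hc hsep hI (fun w _ l hl => ?_) hε hσ x⟩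
  rw [mul_comm, ← integral_inv_one_add_mul_norm_pow _ _ hl,
    ← integral_sub_right_eq_self (fun z : V => ((1 + l * ‖z‖) ^ N)⁻¹) w]
  exact setIntegral_le_integral
    ((integrable_inv_one_add_mul_norm_pow volume hN hl).comp_sub_right w)
    (Eventually.of_forall fun z => inv_nonneg.2 (by positivity))

lemma exists_integral_phaseGradient_cone_le (ha : 0 < a) (h₁ : 0 < s₁) (h₁₂ : s₁ ≤ s₂) {d N : ℕ}
    (hd : d + 1 = Module.finrank ℝ V) (hN : d < N) :
    ∃ C : ℝ, 0 ≤ C ∧ ∀ ε σ : ℝ, 0 < ε → 0 < σ → ∀ x : V,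
      ∫ z in annulus V s₁ s₂, ((1 + ‖ε • (x + σ • phaseGradient a z)‖) ^ N)⁻¹ ≤
        C * ((ε * σ) ^ d)⁻¹ := by
  obtain ⟨c, hc, hsep⟩ :=
    exists_pos_mul_norm_orthogonalProjectionOnto_le_norm_phaseGradient_sub (V := V) ha h₁ h₁₂
  have hI : 0 ≤ volume.real (Metric.closedBall (0 : ℝ) s₂) * ∫ x : E d, ((1 + ‖x‖) ^ N)⁻¹ :=
    mul_nonneg measureReal_nonneg (integral_nonneg fun x => by positivity)
  refine ⟨_, by positivity, fun ε σ hε hσ x => setIntegral_inv_one_add_norm_pow_le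
    (isCompact_annulus s₁ s₂) (continuousOn_phaseGradient a h₁) (fun _ _ => norm_nonneg _)
    (fun w => by fun_prop) hc hsep hI (fun w hw l hl => ?_) hε hσ x⟩
  refine le_trans (setIntegral_mono_set ?_ (Eventually.of_forall fun z => by positivity)
    (Eventually.of_forall fun z hz => mem_closedBall_zero_iff.2 hz.2))
    (integral_closedBall_inv_one_add_mul_norm_orthogonalProjectionOnto_le hd hN s₂
      (norm_pos_iff.1 (h₁.trans_le hw.1)) hl)
  exact ContinuousOn.integrableOn_compact (isCompact_closedBall 0 s₂)
    (Continuous.continuousOn (Continuous.inv₀ (by fun_prop) fun z => by positivity))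

end GradientIntegrals

section Propagator

variable {V : Type*} [NormedAddCommGroup V]

/-- The multiplier of `e^{it(-Δ)^{a/2}}` in the normalization `e^{-2πix·ξ}` of the Fourier
transform. -/
def propagator (a t : ℝ) (ξ : V) : ℂ :=
  Complex.exp (Complex.I * ((t * (2 * Real.pi * ‖ξ‖) ^ a : ℝ) : ℂ))

lemma norm_propagator (a t : ℝ) (ξ : V) : ‖propagator a t ξ‖ = 1 := by
  rw [propagator, mul_comm, Complex.norm_exp_ofReal_mul_I]

lemma continuous_propagator {a : ℝ} (ha : 0 < a) (t : ℝ) :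
    Continuous (propagator a t : V → ℂ) := by
  have hpow : Continuous fun ξ : V => (2 * Real.pi * ‖ξ‖) ^ a :=
    (continuous_const.mul continuous_norm).rpow_const fun _ => Or.inr ha.le
  unfold propagator
  fun_prop

lemma propagator_smul [NormedSpace ℝ V] (a t : ℝ) {l : ℝ} (hl : 0 < l) (ξ : V) :
    propagator a t (l • ξ) = propagator a (t * l ^ a) ξ := by
  rw [propagator, propagator, norm_smul, Real.norm_of_nonneg hl.le, mul_left_comm,
    Real.mul_rpow hl.le (by positivity), ← mul_assoc t]

end Propagator

section OscillatoryKernel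

variable {V : Type*} [NormedAddCommGroup V] {a c₁ c₂ : ℝ} {b : V → ℂ}

lemma add_mem_annulus {δ : ℝ} {z w : V} (hw : ‖w‖ ≤ δ) (hzw : z + w ∈ annulus V c₁ c₂) :
    z ∈ annulus V (c₁ - δ) (c₂ + δ) := by
  have hle : ‖z + w‖ ≤ ‖z‖ + ‖w‖ := norm_add_le z w
  have hge : ‖z‖ ≤ ‖z + w‖ + ‖w‖ := by simpa using norm_sub_le (z + w) w
  exact ⟨by linarith [hzw.1], by linarith [hzw.2]⟩

lemma one_le_sqrt_one_add {τ : ℝ} (hτ : 0 ≤ τ) : 1 ≤ √(1 + τ) :=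
  Real.one_le_sqrt.2 (le_add_of_nonneg_right hτ)

variable [InnerProductSpace ℝ V]

lemma half_norm_le_norm_add_smul {g x : V} {M τ : ℝ} (hτ : 0 ≤ τ) (hg : ‖g‖ ≤ M)
    (hx : (M + 1) * (1 + τ) ≤ ‖x‖) : ‖x‖ / 2 ≤ ‖x + (τ / (2 * Real.pi)) • g‖ := by
  have hM : 0 ≤ M := (norm_nonneg g).trans hg
  have hsmall : ‖(τ / (2 * Real.pi)) • g‖ ≤ ‖x‖ / 2 := by
    rw [norm_smul, Real.norm_of_nonneg (by positivity)]
    calc τ / (2 * Real.pi) * ‖g‖ ≤ τ / 2 * M := by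
          gcongr
          linarith [Real.pi_gt_three]
      _ ≤ ‖x‖ / 2 := by nlinarith
  have htri := norm_sub_le (x + (τ / (2 * Real.pi)) • g) ((τ / (2 * Real.pi)) • g)
  rw [add_sub_cancel_right] at htri
  linarith

variable [FiniteDimensional ℝ V]

/-- The convolution kernel of the Fourier multiplier `propagator a τ * b`. -/
def oscKernel [MeasurableSpace V] [BorelSpace V] (a τ : ℝ) (b : V → ℂ) : V → ℂ :=
  𝓕⁻ (fun ξ : V => propagator a τ ξ * b ξ)

lemma exists_contDiff_eq_phase (a : ℝ) (h₁ : 0 < c₁) (h₂ : c₁ ≤ c₂) :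
    ∃ P : V → ℝ, ContDiff ℝ ∞ P ∧ HasCompactSupport P ∧
      ∀ z : V, c₁ / 4 < ‖z‖ → ‖z‖ < c₂ + c₁ → P z = (2 * Real.pi * ‖z‖) ^ a := by
  let φ : ContDiffBump (0 : V) := ⟨c₂ + c₁, c₂ + c₁ + 1, by linarith, by linarith⟩
  let ψ : ContDiffBump (0 : V) := ⟨c₁ / 8, c₁ / 4, by linarith, by linarith⟩
  refine ⟨fun z => (φ z - ψ z) * (2 * Real.pi * ‖z‖) ^ a, ?_,
    (φ.hasCompactSupport.sub ψ.hasCompactSupport).mul_right, fun z hz1 hz2 => ?_⟩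
  · rw [contDiff_iff_contDiffAt]
    intro z
    rcases eq_or_ne z 0 with rfl | hz
    · refine ContDiffAt.congr_of_eventuallyEq (f := fun _ => (0 : ℝ)) contDiffAt_const ?_
      filter_upwards [φ.eventuallyEq_one, ψ.eventuallyEq_one] with w hφ hψ
      rw [hφ, hψ, sub_self, zero_mul]
    · exact (φ.contDiffAt.sub ψ.contDiffAt).mul
        ((contDiffAt_const.mul (contDiffAt_norm ℝ hz)).rpow_const_of_ne
          (mul_ne_zero (by positivity) (norm_ne_zero_iff.2 hz)))
  · have hφ : φ z = 1 := φ.one_of_mem_closedBall (by simpa using hz2.le)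
    have hψ : ψ z = 0 := ψ.zero_of_le_dist (by simpa using hz1.le)
    simp only [hφ, hψ, sub_zero, one_mul]

lemma exists_contDiff_gradient_eq_phaseGradient (a : ℝ) (h₁ : 0 < c₁) (h₂ : c₁ ≤ c₂) :
    ∃ P : V → ℝ, ContDiff ℝ ∞ P ∧ HasCompactSupport P ∧
      ∀ z ∈ annulus V (c₁ / 2) (c₂ + c₁ / 2),
        P z = (2 * Real.pi * ‖z‖) ^ a ∧ gradient P z = phaseGradient a z := by
  obtain ⟨P, hP, hPc, hPe⟩ := exists_contDiff_eq_phase (V := V) a h₁ h₂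
  refine ⟨P, hP, hPc, fun z hz => ?_⟩
  have hz1 : c₁ / 4 < ‖z‖ := lt_of_lt_of_le (by linarith) hz.1
  have hz2 : ‖z‖ < c₂ + c₁ := lt_of_le_of_lt hz.2 (by linarith)
  refine ⟨hPe z hz1 hz2, ((hasGradientAt_phase a
    (norm_pos_iff.1 (lt_trans (by linarith) hz1))).congr_of_eventuallyEq ?_).gradient⟩
  filter_upwards [continuous_norm.continuousAt.eventually (lt_mem_nhds hz1),
    continuous_norm.continuousAt.eventually (gt_mem_nhds hz2)] with y hy1 hy2 using hPe y hy1 hy2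

variable [MeasurableSpace V] [BorelSpace V]

/-- The wave packets have width `(1 + τ)^{-1/2}` in frequency, the largest scale at which the
phase `τ (2π‖ξ‖)^a` is affine up to `O(1)`. -/
lemma exists_norm_oscKernel_le_integral (a : ℝ) (h₁ : 0 < c₁) (h₂ : c₁ ≤ c₂) {N : ℕ}
    (hb : ContDiff ℝ N b) (hbs : Function.support b ⊆ annulus V c₁ c₂) :
    ∃ C : ℝ, 0 ≤ C ∧ ∀ τ : ℝ, 0 ≤ τ → ∀ x : V, ‖oscKernel a τ b x‖ ≤
      C * ∫ z in annulus V (c₁ / 2) (c₂ + c₁ / 2),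
        ((1 + ‖(√(1 + τ))⁻¹ • (x + (τ / (2 * Real.pi)) • phaseGradient a z)‖) ^ N)⁻¹ := by
  obtain ⟨P, hP, hPc, hPe⟩ := exists_contDiff_gradient_eq_phaseGradient (V := V) a h₁ h₂
  have hbc : HasCompactSupport b :=
    HasCompactSupport.of_support_subset_isCompact (isCompact_annulus c₁ c₂) hbs
  obtain ⟨C, hC0, hC⟩ := exists_norm_fourierInv_osc_le N
    (contDiff_infty.1 hP (N + 2)) hPc hb hbc (half_pos h₁)
    (isCompact_annulus (V := V) (c₁ / 2) (c₂ + c₁ / 2))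
    (fun z w hw hzw => by simpa only [sub_half] using add_mem_annulus hw (hbs hzw))
  refine ⟨C, hC0, fun τ hτ x => ?_⟩
  have hs := one_le_sqrt_one_add hτ
  have hscale : τ * (√(1 + τ))⁻¹ ^ 2 ≤ 1 := by
    rw [inv_pow, Real.sq_sqrt (by linarith), ← div_eq_mul_inv, div_le_one (by linarith)]
    linarith
  have hkernel :
      oscKernel a τ b = 𝓕⁻ (fun ξ => Complex.exp (Complex.I * (τ * P ξ : ℝ)) * b ξ) := by
    unfold oscKernel propagator
    congr 1
    ext ξ
    by_cases hξ : b ξ = 0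
    · rw [hξ, mul_zero, mul_zero]
    · have hmem := hbs hξ
      rw [(hPe ξ ⟨by linarith [hmem.1], by linarith [hmem.2]⟩).1]
  rw [hkernel]
  refine (hC τ _ hτ (by positivity) (inv_le_one_of_one_le₀ hs) hscale x).trans_eq ?_
  congr 1
  exact setIntegral_congr_fun (isCompact_annulus _ _).measurableSet
    fun z hz => by simp only [(hPe z hz).2]

/-- The dispersive estimate: the Hessian of `‖ξ‖^a` is nondegenerate if `a ≠ 1`, and has rank
`n - 1` if `a = 1`. -/
lemma exists_norm_oscKernel_le_inv_sqrt_pow {d : ℕ} (ha : 0 < a)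
    (hd : (a ≠ 1 ∧ d = Module.finrank ℝ V) ∨ d + 1 = Module.finrank ℝ V) (h₁ : 0 < c₁)
    (h₂ : c₁ ≤ c₂) (hb : ContDiff ℝ (d + 1 : ℕ) b) (hbs : Function.support b ⊆ annulus V c₁ c₂) :
    ∃ C : ℝ, 0 ≤ C ∧ ∀ τ : ℝ, 0 ≤ τ → ∀ x : V,
      ‖oscKernel a τ b x‖ ≤ C * (√(1 + τ) ^ d)⁻¹ := by
  obtain ⟨C, hC0, hC⟩ := exists_norm_oscKernel_le_integral a h₁ h₂ hb hbs
  set A := annulus V (c₁ / 2) (c₂ + c₁ / 2)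
  obtain ⟨T, hT0, hT⟩ : ∃ T : ℝ, 0 ≤ T ∧ ∀ ε σ : ℝ, 0 < ε → 0 < σ → ∀ x : V,
      ∫ z in A, ((1 + ‖ε • (x + σ • phaseGradient a z)‖) ^ (d + 1))⁻¹ ≤ T * ((ε * σ) ^ d)⁻¹ := by
    rcases hd with ⟨ha1, rfl⟩ | hd
    · exact exists_integral_phaseGradient_le ha ha1 (half_pos h₁) (Nat.lt_succ_self _)
    · exact exists_integral_phaseGradient_cone_le ha (half_pos h₁) (by linarith) hd
        (Nat.lt_succ_self d)
  refine ⟨C * max (volume.real A * 2 ^ d) (T * (4 * Real.pi) ^ d), by positivity, fun τ hτ x => ?_⟩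
  refine (hC τ hτ x).trans ?_
  have hs := one_le_sqrt_one_add hτ
  have hs0 : 0 < √(1 + τ) := one_pos.trans_le hs
  have hss : √(1 + τ) * √(1 + τ) = 1 + τ := Real.mul_self_sqrt (by linarith)
  rw [mul_assoc]
  gcongr
  rcases lt_or_ge τ 1 with h | h
  · have htrivial : ∫ z in A, ((1 + ‖(√(1 + τ))⁻¹ • (x + (τ / (2 * Real.pi)) •
        phaseGradient a z)‖) ^ (d + 1))⁻¹ ≤ volume.real A * 1 :=
      (Real.le_norm_self _).trans <| (norm_setIntegral_le_of_norm_le_const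
        (isCompact_annulus _ _).measure_lt_top fun z _ => by
          rw [Real.norm_of_nonneg (by positivity)]
          exact inv_le_one_of_one_le₀
            (one_le_pow₀ (le_add_of_nonneg_right (norm_nonneg _)))).trans_eq (mul_comm _ _)
    calc _ ≤ volume.real A * 1 := htrivial
      _ ≤ volume.real A * (2 / √(1 + τ)) ^ d := by
          gcongr
          exact one_le_pow₀ ((one_le_div hs0).2 (by nlinarith))
      _ = volume.real A * 2 ^ d * (√(1 + τ) ^ d)⁻¹ := by rw [div_pow, mul_div, div_eq_mul_inv]
      _ ≤ _ := by gcongr; exact le_max_left _ _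
  · have hlow : √(1 + τ) / (4 * Real.pi) ≤ (√(1 + τ))⁻¹ * (τ / (2 * Real.pi)) := by
      rw [inv_mul_eq_div, div_div, div_le_div_iff₀ (by positivity) (by positivity)]
      nlinarith [Real.pi_pos]
    calc _ ≤ T * (((√(1 + τ))⁻¹ * (τ / (2 * Real.pi))) ^ d)⁻¹ :=
          hT _ _ (by positivity) (by positivity) x
      _ ≤ T * ((√(1 + τ) / (4 * Real.pi)) ^ d)⁻¹ := by gcongr
      _ = T * (4 * Real.pi) ^ d * (√(1 + τ) ^ d)⁻¹ := by
          rw [div_pow, inv_div, mul_div, div_eq_mul_inv]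
      _ ≤ _ := by gcongr; exact le_max_right _ _

/-- The packets travel with speed at most `sup ‖∇ phase‖`, so nothing reaches `‖x‖ ≫ 1 + τ`. -/
lemma exists_norm_oscKernel_le_of_le_norm (a : ℝ) (h₁ : 0 < c₁) (h₂ : c₁ ≤ c₂) {N : ℕ}
    (hb : ContDiff ℝ N b) (hbs : Function.support b ⊆ annulus V c₁ c₂) :
    ∃ C C₀ : ℝ, 0 ≤ C ∧ 0 < C₀ ∧ ∀ τ : ℝ, 0 ≤ τ → ∀ x : V, C₀ * (1 + τ) ≤ ‖x‖ →
      ‖oscKernel a τ b x‖ ≤ C * (√(1 + τ) / ‖x‖) ^ N := by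
  obtain ⟨C, hC0, hC⟩ := exists_norm_oscKernel_le_integral a h₁ h₂ hb hbs
  set A := annulus V (c₁ / 2) (c₂ + c₁ / 2)
  have hAc : IsCompact A := isCompact_annulus _ _
  obtain ⟨M, hM⟩ := hAc.exists_bound_of_continuousOn
    (continuousOn_phaseGradient a (half_pos h₁))
  refine ⟨C * (volume.real A * 2 ^ N), |M| + 1, by positivity, by positivity, fun τ hτ x hx => ?_⟩
  have hs : 0 < √(1 + τ) := one_pos.trans_le (one_le_sqrt_one_add hτ)
  have hx0 : 0 < ‖x‖ := lt_of_lt_of_le (by positivity) hx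
  refine (hC τ hτ x).trans ?_
  rw [mul_assoc C, mul_assoc (volume.real A), ← mul_pow, mul_comm (volume.real A)]
  gcongr
  refine (Real.le_norm_self _).trans (norm_setIntegral_le_of_norm_le_const hAc.measure_lt_top
    fun z hz => ?_)
  rw [Real.norm_of_nonneg (by positivity), ← inv_pow]
  gcongr
  rw [norm_smul, Real.norm_of_nonneg (by positivity)]
  have hfar := half_norm_le_norm_add_smul hτ ((hM z hz).trans (le_abs_self M)) hx
  calc (1 + (√(1 + τ))⁻¹ * ‖x + (τ / (2 * Real.pi)) • phaseGradient a z‖)⁻¹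
      ≤ ((√(1 + τ))⁻¹ * (‖x‖ / 2))⁻¹ := by
        gcongr
        exact (mul_le_mul_of_nonneg_left hfar (by positivity)).trans
          (le_add_of_nonneg_left zero_le_one)
    _ = 2 * (√(1 + τ) / ‖x‖) := by field_simp

end OscillatoryKernel

section Plancherel

variable {V : Type*} [NormedAddCommGroup V] [InnerProductSpace ℝ V] [FiniteDimensional ℝ V]
  [MeasurableSpace V] [BorelSpace V] {F : V → ℂ}

lemma continuous_fourier_of_integrable (hF : Integrable F) : Continuous (𝓕 F) :=
  VectorFourier.fourierIntegral_continuous Real.continuous_fourierChar continuous_inner hF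

lemma fourierInv_eq_fourier_comp_neg (F : V → ℂ) : 𝓕⁻ F = 𝓕 F ∘ Neg.neg :=
  funext fun x => Real.fourierInv_eq_fourier_neg F x

lemma continuous_fourierInv_of_integrable (hF : Integrable F) : Continuous (𝓕⁻ F) :=
  fourierInv_eq_fourier_comp_neg F ▸ (continuous_fourier_of_integrable hF).comp continuous_neg

lemma fourier_toLp_ae_eq (hF : Integrable F) (hF2 : MemLp F 2) :
    (𝓕 (hF2.toLp F) : Lp ℂ 2 (volume : Measure V)) =ᵐ[volume] 𝓕 F := by
  refine ae_eq_of_integral_contDiff_smul_eq ((Lp.memLp _).locallyIntegrable (by norm_num))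
    (continuous_fourier_of_integrable hF).locallyIntegrable fun g hg hgc => ?_
  let φ : 𝓢(V, ℂ) := (hgc.comp_left Complex.ofReal_zero).toSchwartzMap
    (Complex.ofRealCLM.contDiff.comp hg)
  have htest := congrArg (fun T : 𝓢'(V, ℂ) => T φ)
    (Lp.fourier_toTemperedDistribution_eq (hF2.toLp F))
  simp only [TemperedDistribution.fourier_apply, Lp.toTemperedDistribution_apply] at htest
  have hflip : ∫ x, 𝓕 (φ : V → ℂ) x * F x = ∫ x, φ x * 𝓕 F x := by
    have := VectorFourier.integral_fourierIntegral_smul_eq_flip (L := innerₗ V) (μ := volume)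
      (ν := volume) Real.continuous_fourierChar continuous_inner φ.integrable hF
    rwa [flip_innerₗ] at this
  calc _ = ∫ x, (𝓕 φ) x • hF2.toLp F x := htest.symm
    _ = ∫ x, 𝓕 (φ : V → ℂ) x * F x := by
        refine integral_congr_ae ?_
        filter_upwards [hF2.coeFn_toLp] with x hx
        rw [hx, smul_eq_mul, SchwartzMap.fourier_coe]
    _ = _ := hflip

lemma eLpNorm_fourier_eq (hF : Integrable F) (hF2 : MemLp F 2) :
    eLpNorm (𝓕 F) 2 = eLpNorm F 2 := by
  have hnorm := Lp.norm_fourier_eq (hF2.toLp F)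
  rw [Lp.norm_def, Lp.norm_def,
    ENNReal.toReal_eq_toReal_iff' (Lp.eLpNorm_ne_top _) (Lp.eLpNorm_ne_top _)] at hnorm
  rw [← eLpNorm_congr_ae (fourier_toLp_ae_eq hF hF2), hnorm, eLpNorm_congr_ae hF2.coeFn_toLp]

lemma eLpNorm_fourierInv_eq (hF : Integrable F) (hF2 : MemLp F 2) :
    eLpNorm (𝓕⁻ F) 2 = eLpNorm F 2 := by
  rw [fourierInv_eq_fourier_comp_neg, eLpNorm_comp_measurePreserving
    (continuous_fourier_of_integrable hF).aestronglyMeasurable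
    (Measure.measurePreserving_neg volume), eLpNorm_fourier_eq hF hF2]

end Plancherel

section BilinearForms

variable {V : Type*} [NormedAddCommGroup V] [InnerProductSpace ℝ V] [FiniteDimensional ℝ V]
  [MeasurableSpace V] [BorelSpace V] {m F G : V → ℂ}

/-- The bilinear form of the Fourier multiplier `m`, that is, the bilinear pairing of `G` with the
function whose Fourier transform is `m * 𝓕 F`. -/
def multiplierForm (m F G : V → ℂ) : ℂ := ∫ ξ, m ξ * (𝓕 F ξ * 𝓕⁻ G ξ)

/-- The bilinear form of convolution with the kernel `K`. -/
def kernelForm (K F G : V → ℂ) : ℂ := ∫ p : V × V, K (p.1 - p.2) * (F p.2 * G p.1)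

lemma lintegral_enorm_mul_enorm_le_eLpNorm_two {X : Type*} [MeasurableSpace X] {μ : Measure X}
    {f g : X → ℂ} (hf : AEStronglyMeasurable f μ) (hg : AEStronglyMeasurable g μ) :
    ∫⁻ x, ‖f x‖ₑ * ‖g x‖ₑ ∂μ ≤ eLpNorm f 2 μ * eLpNorm g 2 μ := by
  simpa [eLpNorm_eq_lintegral_rpow_enorm_toReal] using
    ENNReal.lintegral_mul_le_Lp_mul_Lq μ Real.HolderConjugate.two_two hf.enorm hg.enorm

lemma enorm_multiplierForm_le {M : ℝ≥0} (hM : ∀ ξ, ‖m ξ‖₊ ≤ M) (hF : Integrable F)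
    (hG : Integrable G) (hF2 : MemLp F 2) (hG2 : MemLp G 2) :
    ‖multiplierForm m F G‖ₑ ≤ M * (eLpNorm F 2 * eLpNorm G 2) :=
  calc ‖multiplierForm m F G‖ₑ ≤ ∫⁻ ξ, ‖m ξ * (𝓕 F ξ * 𝓕⁻ G ξ)‖ₑ :=
        enorm_integral_le_lintegral_enorm _
    _ ≤ ∫⁻ ξ, M * (‖𝓕 F ξ‖ₑ * ‖𝓕⁻ G ξ‖ₑ) := by
        refine lintegral_mono fun ξ => ?_
        rw [enorm_mul, enorm_mul]
        gcongr
        exact enorm_le_coe.2 (hM ξ)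
    _ = M * ∫⁻ ξ, ‖𝓕 F ξ‖ₑ * ‖𝓕⁻ G ξ‖ₑ := lintegral_const_mul' _ _ ENNReal.coe_ne_top
    _ ≤ M * (eLpNorm (𝓕 F) 2 * eLpNorm (𝓕⁻ G) 2) := by
        gcongr
        exact lintegral_enorm_mul_enorm_le_eLpNorm_two
          (continuous_fourier_of_integrable hF).aestronglyMeasurable
          (continuous_fourierInv_of_integrable hG).aestronglyMeasurable
    _ = _ := by rw [eLpNorm_fourier_eq hF hF2, eLpNorm_fourierInv_eq hG hG2]

lemma fourier_mul_fourierInv_eq_integral (F G : V → ℂ) (ξ : V) :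
    𝓕 F ξ * 𝓕⁻ G ξ = ∫ p : V × V,
      Complex.exp (↑(2 * Real.pi * inner ℝ ξ (p.1 - p.2)) * Complex.I) * (F p.2 * G p.1) := by
  rw [Real.fourier_eq', Real.fourierInv_eq', mul_comm, ← integral_prod_mul]
  congr 1
  ext p
  have hexp : Complex.exp (↑(2 * Real.pi * inner ℝ ξ (p.1 - p.2)) * Complex.I) =
      Complex.exp (↑(2 * Real.pi * inner ℝ p.1 ξ) * Complex.I) *
        Complex.exp (↑(-2 * Real.pi * inner ℝ p.2 ξ) * Complex.I) := by
    rw [← Complex.exp_add, inner_sub_right, real_inner_comm, real_inner_comm ξ p.2]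
    congr 1
    push_cast
    ring
  rw [hexp, smul_eq_mul, smul_eq_mul]
  ring

lemma integrable_mul_snd_fst (hF : Integrable F) (hG : Integrable G) :
    Integrable fun p : V × V => F p.2 * G p.1 := by
  simp only [mul_comm (F _)]
  exact hG.mul_prod hF

lemma multiplierForm_eq_kernelForm (hm : Integrable m) (hF : Integrable F) (hG : Integrable G) :
    multiplierForm m F G = kernelForm (𝓕⁻ m) F G := by
  have hint : Integrable (Function.uncurry fun (ξ : V) (p : V × V) =>
      m ξ * (Complex.exp (↑(2 * Real.pi * inner ℝ ξ (p.1 - p.2)) * Complex.I) *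
        (F p.2 * G p.1))) (volume.prod volume) := by
    refine ((hm.mul_prod (integrable_mul_snd_fst hF hG)).bdd_mul (c := 1)
      (f := fun q : V × (V × V) =>
        Complex.exp (↑(2 * Real.pi * inner ℝ q.1 (q.2.1 - q.2.2)) * Complex.I))
      (Continuous.aestronglyMeasurable (by fun_prop))
      (Eventually.of_forall fun q => (Complex.norm_exp_ofReal_mul_I _).le)).congr
      (Eventually.of_forall fun q => mul_left_comm _ _ _)
  unfold multiplierForm kernelForm
  simp only [fourier_mul_fourierInv_eq_integral, ← integral_const_mul]
  rw [integral_integral_swap hint]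
  congr 1
  ext p
  rw [Real.fourierInv_eq', ← integral_mul_const]
  congr 1
  ext ξ
  rw [smul_eq_mul, mul_left_comm, ← mul_assoc (Complex.exp _)]

lemma norm_kernelForm_le {K : V → ℂ} {B : ℝ}
    (hB : ∀ x y, F y ≠ 0 → G x ≠ 0 → ‖K (x - y)‖ ≤ B) (hF : Integrable F) (hG : Integrable G) :
    ‖kernelForm K F G‖ ≤ B * ((∫ x, ‖F x‖) * ∫ x, ‖G x‖) := by
  calc _ ≤ ∫ p : V × V, B * ‖F p.2 * G p.1‖ := by
        refine norm_integral_le_of_norm_le ((integrable_mul_snd_fst hF hG).norm.const_mul B)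
          (Eventually.of_forall fun p => ?_)
        rw [norm_mul]
        by_cases hp : F p.2 * G p.1 = 0
        · simp [hp]
        · gcongr
          exact hB _ _ (left_ne_zero_of_mul hp) (right_ne_zero_of_mul hp)
    _ = _ := by
        rw [integral_const_mul, mul_comm (∫ x, ‖F x‖), ← integral_prod_mul]
        simp only [norm_mul, mul_comm]
        rfl

end BilinearForms

section AnalyticFamily

lemma rpow_le_rpow_add_rpow {u a s b : ℝ} (hu : 0 ≤ u) (ha : 0 ≤ a) (has : a ≤ s) (hsb : s ≤ b) :
    u ^ s ≤ u ^ a + u ^ b := by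
  rcases le_total u 1 with hu1 | hu1
  · exact (Real.rpow_le_rpow_of_exponent_ge' hu hu1 ha has).trans
      (le_add_of_nonneg_right (Real.rpow_nonneg hu b))
  · exact (Real.rpow_le_rpow_of_exponent_le hu1 hsb).trans
      (le_add_of_nonneg_left (Real.rpow_nonneg hu a))

lemma rpow_mul_abs_log_le {u ε : ℝ} (hu : 0 < u) (hε : 0 < ε) (s : ℝ) :
    u ^ s * |Real.log u| ≤ (u ^ (s - ε) + u ^ (s + ε)) / ε := by
  have hlog : |Real.log u| ≤ (u ^ (-ε) + u ^ ε) / ε := by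
    have hpos := Real.rpow_pos_of_pos hu
    refine abs_le'.2 ⟨(Real.log_le_rpow_div hu.le hε).trans ?_, ?_⟩
    · gcongr
      exact le_add_of_nonneg_left (hpos _).le
    · rw [← Real.log_inv]
      refine (Real.log_le_rpow_div (inv_nonneg.2 hu.le) hε).trans ?_
      rw [Real.inv_rpow hu.le, ← Real.rpow_neg hu.le]
      gcongr
      exact le_add_of_nonneg_right (hpos _).le
  calc u ^ s * |Real.log u| ≤ u ^ s * ((u ^ (-ε) + u ^ ε) / ε) := by gcongr
    _ = _ := by rw [sub_eq_add_neg, Real.rpow_add hu, Real.rpow_add hu, mul_div_assoc', mul_add]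

lemma norm_cpow_mul_log_le {u σ : ℝ} (hu : 0 ≤ u) (hσ : 0 < σ) {w : ℂ} (hw₁ : σ / 2 ≤ w.re)
    (hw₂ : w.re ≤ 2 * σ) :
    ‖(u : ℂ) ^ w * Complex.log u‖ ≤ 8 / σ * (u ^ (σ / 4) + u ^ (3 * σ)) := by
  rcases hu.eq_or_lt with rfl | hpos
  · simp only [Complex.ofReal_zero, Complex.log_zero, mul_zero, norm_zero]
    positivity
  rw [norm_mul, Complex.norm_cpow_eq_rpow_re_of_pos hpos, ← Complex.ofReal_log hu,
    Complex.norm_real, Real.norm_eq_abs]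
  calc u ^ w.re * |Real.log u| ≤ (u ^ (w.re - σ / 4) + u ^ (w.re + σ / 4)) / (σ / 4) :=
        rpow_mul_abs_log_le hpos (by positivity) _
    _ ≤ ((u ^ (σ / 4) + u ^ (3 * σ)) + (u ^ (σ / 4) + u ^ (3 * σ))) / (σ / 4) := by
        gcongr <;> apply rpow_le_rpow_add_rpow hu <;> linarith
    _ = _ := by field_simp; ring

lemma differentiableOn_integral_mul_cpow {X : Type*} [MeasurableSpace X] {μ : Measure X}
    {h : X → ℂ} {u : X → ℝ} {B : ℝ} (hh : AEStronglyMeasurable h μ) (hB : ∀ x, ‖h x‖ ≤ B)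
    (hu0 : ∀ x, 0 ≤ u x) (hu : ∀ s : ℝ, 0 < s → Integrable (fun x => u x ^ s) μ) :
    DifferentiableOn ℂ (fun w : ℂ => ∫ x, h x * (u x : ℂ) ^ w ∂μ) {w | 0 < w.re} := by
  intro w₀ (hw₀ : 0 < w₀.re)
  have hum : AEMeasurable u μ := by simpa using (hu 1 one_pos).aemeasurable
  have hopen : IsOpen {w : ℂ | w.re ∈ Set.Ioo (w₀.re / 2) (2 * w₀.re)} :=
    isOpen_Ioo.preimage Complex.continuous_re
  have hpow (w : ℂ) : AEStronglyMeasurable (fun x => (u x : ℂ) ^ w) μ :=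
    ((Complex.measurable_ofReal.comp_aemeasurable hum).pow_const w).aestronglyMeasurable
  have hlog : AEStronglyMeasurable (fun x => Complex.log (u x : ℂ)) μ :=
    (Complex.measurable_log.comp_aemeasurable
      (Complex.measurable_ofReal.comp_aemeasurable hum)).aestronglyMeasurable
  refine ((hasDerivAt_integral_of_dominated_loc_of_deriv_le
    (F' := fun w x => h x * ((u x : ℂ) ^ w * Complex.log (u x)))
    (bound := fun x => B * (8 / w₀.re * (u x ^ (w₀.re / 4) + u x ^ (3 * w₀.re))))
    (hopen.mem_nhds ⟨by linarith, by linarith⟩) (Eventually.of_forall fun w => hh.mul (hpow w))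
    ?_ (hh.mul ((hpow w₀).mul hlog)) (Eventually.of_forall fun x w hw => ?_) ?_
    (Eventually.of_forall fun x w hw => ?_)).2.differentiableAt).differentiableWithinAt
  · refine ((hu _ hw₀).const_mul B).mono' (hh.mul (hpow w₀)) (Eventually.of_forall fun x => ?_)
    rw [Pi.mul_apply, norm_mul, Complex.norm_cpow_eq_rpow_re_of_nonneg (hu0 x) hw₀.ne']
    have := hu0 x
    gcongr
    exact hB x
  · rw [norm_mul]
    exact mul_le_mul (hB x) (norm_cpow_mul_log_le (hu0 x) hw₀ hw.1.le hw.2.le) (norm_nonneg _)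
      ((norm_nonneg _).trans (hB x))
  · exact (((hu _ (by positivity)).add (hu _ (by positivity))).const_mul _).const_mul B
  · have hw0 : w ≠ 0 := by
      rintro rfl
      exact absurd hw.1 (by simpa using (half_pos hw₀).le)
    simpa using ((hasDerivAt_id w).const_cpow (Or.inr hw0)).const_mul (h x)

/-- The complex power of modulus `‖c‖ ^ re w` with the argument of `c`. It is the analytic family
`w ↦ twist w ∘ F` of Stein interpolation, which passes through `F` at `w = 1`. -/
def twist (w c : ℂ) : ℂ := c / (‖c‖ : ℂ) * (‖c‖ : ℂ) ^ w

lemma norm_div_norm_le_one (c : ℂ) : ‖c / (‖c‖ : ℂ)‖ ≤ 1 := by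
  rw [norm_div, Complex.norm_real, norm_norm]
  exact div_self_le_one _

lemma norm_twist {w : ℂ} (hw : 0 < w.re) (c : ℂ) : ‖twist w c‖ = ‖c‖ ^ w.re := by
  rw [twist, norm_mul, Complex.norm_cpow_eq_rpow_re_of_nonneg (norm_nonneg _) hw.ne', norm_div,
    Complex.norm_real, norm_norm]
  rcases eq_or_ne c 0 with rfl | hc
  · simp [Real.zero_rpow hw.ne']
  · rw [div_self (norm_ne_zero_iff.2 hc), one_mul]

lemma twist_one (c : ℂ) : twist 1 c = c := by
  rcases eq_or_ne c 0 with rfl | hc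
  · simp [twist]
  · rw [twist, Complex.cpow_one, div_mul_cancel₀ _ (mod_cast norm_ne_zero_iff.2 hc)]

lemma twist_mul_twist (w c d : ℂ) :
    twist w c * twist w d =
      c / (‖c‖ : ℂ) * (d / (‖d‖ : ℂ)) * ((‖c‖ * ‖d‖ : ℝ) : ℂ) ^ w := by
  rw [Complex.ofReal_mul, Complex.mul_cpow_ofReal_nonneg (norm_nonneg c) (norm_nonneg d), twist,
    twist, mul_mul_mul_comm]

lemma measurable_div_norm : Measurable fun c : ℂ => c / (‖c‖ : ℂ) :=
  measurable_id.div (Complex.measurable_ofReal.comp measurable_norm)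

lemma measurable_twist (w : ℂ) : Measurable (twist w) :=
  measurable_div_norm.mul ((Complex.measurable_ofReal.comp measurable_norm).pow_const w)

lemma memLp_norm_rpow {X : Type*} [MeasurableSpace X] {μ : Measure X} {F : X → ℂ}
    (hF : ∀ p, MemLp F p μ) {s : ℝ} (hs : 0 < s) (p : ℝ≥0∞) :
    MemLp (fun x => ‖F x‖ ^ s) p μ := by
  have h := (hF (p * ENNReal.ofReal s)).norm_rpow_div (ENNReal.ofReal s)
  rwa [ENNReal.mul_div_cancel_right (by simpa using hs) ENNReal.ofReal_ne_top,
    ENNReal.toReal_ofReal hs.le] at h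

lemma memLp_twist {X : Type*} [MeasurableSpace X] {μ : Measure X} {F : X → ℂ}
    (hF : ∀ p, MemLp F p μ) {w : ℂ} (hw : 0 < w.re) (p : ℝ≥0∞) :
    MemLp (twist w ∘ F) p μ :=
  (memLp_norm_rpow hF hw p).mono
    ((measurable_twist w).comp_aemeasurable (hF 1).1.aemeasurable).aestronglyMeasurable
    (Eventually.of_forall fun x => by
      rw [Function.comp_apply, norm_twist hw, Real.norm_of_nonneg (by positivity)])

lemma integrable_norm_rpow {X : Type*} [MeasurableSpace X] {μ : Measure X} {F : X → ℂ}
    (hF : ∀ p, MemLp F p μ) {s : ℝ} (hs : 0 < s) : Integrable (fun x => ‖F x‖ ^ s) μ :=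
  memLp_one_iff_integrable.1 (memLp_norm_rpow hF hs 1)

lemma integral_norm_rpow_le_add {X : Type*} [MeasurableSpace X] {μ : Measure X} {F : X → ℂ}
    (hF : ∀ p, MemLp F p μ) {a s b : ℝ} (ha : 0 < a) (has : a ≤ s) (hsb : s ≤ b) :
    ∫ x, ‖F x‖ ^ s ∂μ ≤ (∫ x, ‖F x‖ ^ a ∂μ) + ∫ x, ‖F x‖ ^ b ∂μ := by
  have hint {t : ℝ} (ht : a ≤ t) := integrable_norm_rpow hF (ha.trans_le ht)
  rw [← integral_add (hint le_rfl) (hint (has.trans hsb))]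
  exact integral_mono (hint has) ((hint le_rfl).add (hint (has.trans hsb)))
    fun x => rpow_le_rpow_add_rpow (norm_nonneg _) ha.le has hsb

end AnalyticFamily

section Interpolation

variable {V : Type*} [NormedAddCommGroup V] [InnerProductSpace ℝ V] [FiniteDimensional ℝ V]
  [MeasurableSpace V] [BorelSpace V] {K m F G : V → ℂ} {B : ℝ} {M : ℝ≥0}

lemma differentiableOn_kernelForm_twist (hK : Continuous K) (hB : ∀ x, ‖K x‖ ≤ B)
    (hF : ∀ p, MemLp F p) (hG : ∀ p, MemLp G p) :
    DifferentiableOn ℂ (fun w => kernelForm K (twist w ∘ F) (twist w ∘ G)) {w | 0 < w.re} := by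
  have hkernel (w : ℂ) : kernelForm K (twist w ∘ F) (twist w ∘ G) = ∫ p : V × V,
      K (p.1 - p.2) * (F p.2 / (‖F p.2‖ : ℂ) * (G p.1 / (‖G p.1‖ : ℂ))) *
        ((‖F p.2‖ * ‖G p.1‖ : ℝ) : ℂ) ^ w := by
    simp only [kernelForm, Function.comp_apply, twist_mul_twist, mul_assoc]
  simp only [hkernel]
  refine differentiableOn_integral_mul_cpow (B := B) ?_ (fun p => ?_) (fun p => by positivity)
    fun s hs => ?_
  · have hphase {H : V → ℂ} (hH : MemLp H 1) :
        AEStronglyMeasurable (fun x => H x / (‖H x‖ : ℂ)) volume :=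
      AEMeasurable.aestronglyMeasurable (measurable_div_norm.comp_aemeasurable hH.1.aemeasurable)
    exact (hK.comp (continuous_fst.sub continuous_snd)).aestronglyMeasurable.mul
      ((hphase (hF 1)).comp_snd.mul (hphase (hG 1)).comp_fst)
  · rw [norm_mul, norm_mul]
    exact (mul_le_of_le_one_right (norm_nonneg _) (mul_le_one₀ (norm_div_norm_le_one _)
      (norm_nonneg _) (norm_div_norm_le_one _))).trans (hB _)
  · simp only [Real.mul_rpow (norm_nonneg _) (norm_nonneg _), mul_comm (‖F _‖ ^ s)]
    exact (integrable_norm_rpow hG hs).mul_prod (integrable_norm_rpow hF hs)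

lemma norm_kernelForm_twist_le (hB : ∀ x, ‖K x‖ ≤ B) (hF : ∀ p, MemLp F p) (hG : ∀ p, MemLp G p)
    {w : ℂ} (hw : 0 < w.re) :
    ‖kernelForm K (twist w ∘ F) (twist w ∘ G)‖ ≤
      B * ((∫ x, ‖F x‖ ^ w.re) * ∫ x, ‖G x‖ ^ w.re) := by
  simpa only [Function.comp_apply, norm_twist hw] using
    norm_kernelForm_le (fun x y _ _ => hB (x - y))
      (memLp_one_iff_integrable.1 (memLp_twist hF hw 1))
      (memLp_one_iff_integrable.1 (memLp_twist hG hw 1))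

lemma eLpNorm_two_twist (hF : ∀ p, MemLp F p) {w : ℂ} (hw : 0 < w.re) :
    eLpNorm (twist w ∘ F) 2 = ENNReal.ofReal ((∫ x, ‖F x‖ ^ (w.re * 2)) ^ (1 / 2 : ℝ)) := by
  rw [(memLp_twist hF hw 2).eLpNorm_eq_integral_rpow_norm two_ne_zero ENNReal.ofNat_ne_top]
  simp only [Function.comp_apply, norm_twist hw, ENNReal.toReal_ofNat, one_div,
    Real.rpow_mul (norm_nonneg _)]

lemma norm_kernelForm_fourierInv_twist_le (hm : Integrable m) (hM : ∀ ξ, ‖m ξ‖₊ ≤ M)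
    (hF : ∀ p, MemLp F p) (hG : ∀ p, MemLp G p) {w : ℂ} (hw : 0 < w.re) :
    ‖kernelForm (𝓕⁻ m) (twist w ∘ F) (twist w ∘ G)‖ ≤
      M * ((∫ x, ‖F x‖ ^ (w.re * 2)) * ∫ x, ‖G x‖ ^ (w.re * 2)) ^ (1 / 2 : ℝ) := by
  have hF1 := memLp_one_iff_integrable.1 (memLp_twist hF hw 1)
  have hG1 := memLp_one_iff_integrable.1 (memLp_twist hG hw 1)
  have h := enorm_multiplierForm_le hM hF1 hG1 (memLp_twist hF hw 2) (memLp_twist hG hw 2)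
  rw [multiplierForm_eq_kernelForm hm hF1 hG1, eLpNorm_two_twist hF hw, eLpNorm_two_twist hG hw,
    ← ENNReal.ofReal_mul (by positivity), ← Real.mul_rpow (by positivity) (by positivity),
    ← ENNReal.ofReal_coe_nnreal, ← ENNReal.ofReal_mul M.coe_nonneg, ← ofReal_norm] at h
  exact (ENNReal.ofReal_le_ofReal_iff (by positivity)).1 h

lemma norm_kernelForm_le_interp (hm : Integrable m) (hM : ∀ ξ, ‖m ξ‖₊ ≤ M)
    (hB : ∀ x, ‖𝓕⁻ m x‖ ≤ B) (hF : ∀ p, MemLp F p) (hG : ∀ p, MemLp G p) {r : ℝ} (hr1 : 1 ≤ r)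
    (hr2 : r ≤ 2) :
    ‖kernelForm (𝓕⁻ m) F G‖ ≤ B ^ (2 / r - 1) * (M : ℝ) ^ (2 - 2 / r) *
      ((∫ x, ‖F x‖ ^ r) * ∫ x, ‖G x‖ ^ r) ^ (1 / r) := by
  have hr0 : 0 < r := one_pos.trans_le hr1
  have hB0 : 0 ≤ B := (norm_nonneg _).trans (hB 0)
  set A : ℝ := (∫ x, ‖F x‖ ^ r) * ∫ x, ‖G x‖ ^ r
  have hA0 : 0 ≤ A := by positivity
  have hclosed : IsClosed (Complex.HadamardThreeLines.verticalClosedStrip (r / 2) r) :=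
    isClosed_Icc.preimage Complex.continuous_re
  have hre {w : ℂ} (hw : w ∈ Complex.HadamardThreeLines.verticalClosedStrip (r / 2) r) :
      0 < w.re := (half_pos hr0).trans_le hw.1
  have hinterp := Complex.HadamardThreeLines.norm_le_interp_of_mem_verticalClosedStrip'
    (f := fun w => kernelForm (𝓕⁻ m) (twist w ∘ F) (twist w ∘ G)) (z := 1)
    (a := M * A ^ (1 / 2 : ℝ)) (b := B * A) (half_lt_self hr0)
    ⟨by rw [Complex.one_re]; linarith, by rwa [Complex.one_re]⟩
    ((differentiableOn_kernelForm_twist (continuous_fourierInv_of_integrable hm) hB hF hG).mono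
      ((closure_minimal (Set.preimage_mono Set.Ioo_subset_Icc_self) hclosed).trans
        fun w hw => hre hw)).diffContOnCl
    ⟨B * (((∫ x, ‖F x‖ ^ (r / 2)) + ∫ x, ‖F x‖ ^ r) * ((∫ x, ‖G x‖ ^ (r / 2)) + ∫ x, ‖G x‖ ^ r)), by
      rintro _ ⟨w, hw, rfl⟩
      refine (norm_kernelForm_twist_le hB hF hG (hre hw)).trans ?_
      gcongr
      · exact integral_norm_rpow_le_add hF (half_pos hr0) hw.1 hw.2
      · exact integral_norm_rpow_le_add hG (half_pos hr0) hw.1 hw.2⟩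
    (fun w (hw : w.re = r / 2) => by
      have h := norm_kernelForm_fourierInv_twist_le hm hM hF hG (hw ▸ half_pos hr0)
      rwa [hw, div_mul_cancel₀ r two_ne_zero] at h)
    (fun w (hw : w.re = r) => by
      have h := norm_kernelForm_twist_le hB hF hG (hw ▸ hr0)
      rwa [hw] at h)
  have hθ : (1 - r / 2) / (r - r / 2) = 2 / r - 1 := by field_simp; ring
  have hθ0 : 0 ≤ 2 / r - 1 := by rw [sub_nonneg, one_le_div hr0]; exact hr2
  have hθ1 : 2 / r ≤ 2 := by rw [div_le_iff₀ hr0]; linarith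
  simp only [Function.comp_def, twist_one, Complex.one_re, hθ] at hinterp
  refine hinterp.trans_eq ?_
  rw [Real.mul_rpow M.coe_nonneg (by positivity), Real.mul_rpow hB0 hA0, ← Real.rpow_mul hA0,
    show 1 / r = 1 / 2 * (1 - (2 / r - 1)) + (2 / r - 1) by ring,
    Real.rpow_add_of_nonneg hA0 (by linarith) hθ0]
  ring_nf

lemma enorm_kernelForm_le_interp (hm : Integrable m) (hM : ∀ ξ, ‖m ξ‖₊ ≤ M)
    (hB : ∀ x, ‖𝓕⁻ m x‖ ≤ B) (hF : ∀ p, MemLp F p) (hG : ∀ p, MemLp G p) {r : ℝ} (hr1 : 1 ≤ r)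
    (hr2 : r ≤ 2) :
    ‖kernelForm (𝓕⁻ m) F G‖ₑ ≤ ENNReal.ofReal (B ^ (2 / r - 1) * (M : ℝ) ^ (2 - 2 / r)) *
      (eLpNorm F (ENNReal.ofReal r) * eLpNorm G (ENNReal.ofReal r)) := by
  have hr0 : 0 < r := one_pos.trans_le hr1
  have hB0 : 0 ≤ B := (norm_nonneg _).trans (hB 0)
  have hnorm {H : V → ℂ} (hH : ∀ p, MemLp H p) :
      eLpNorm H (ENNReal.ofReal r) = ENNReal.ofReal ((∫ x, ‖H x‖ ^ r) ^ (1 / r)) := by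
    rw [(hH _).eLpNorm_eq_integral_rpow_norm (by simpa using hr0) ENNReal.ofReal_ne_top,
      ENNReal.toReal_ofReal hr0.le, one_div]
  rw [hnorm hF, hnorm hG, ← ENNReal.ofReal_mul (by positivity),
    ← Real.mul_rpow (by positivity) (by positivity), ← ENNReal.ofReal_mul (by positivity),
    ← ofReal_norm]
  exact ENNReal.ofReal_le_ofReal (norm_kernelForm_le_interp hm hM hB hF hG hr1 hr2)

end Interpolation

section Cubes

variable {n : ℕ}

lemma cubeSet_eq_preimage (c : E n) (l : ℝ) :
    cubeSet c l = WithLp.ofLp ⁻¹' (Set.univ.pi fun i => Set.Ico (c i - l / 2) (c i + l / 2)) := by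
  ext x
  simp [cubeSet, Set.mem_pi]

lemma measurableSet_cubeSet (c : E n) (l : ℝ) : MeasurableSet (cubeSet c l) := by
  rw [cubeSet_eq_preimage]
  exact (PiLp.volume_preserving_ofLp (Fin n)).measurable
    (MeasurableSet.univ_pi fun _ => measurableSet_Ico)

lemma volume_cubeSet (c : E n) {l : ℝ} (hl : 0 ≤ l) :
    volume (cubeSet c l) = ENNReal.ofReal (l ^ n) := by
  rw [cubeSet_eq_preimage, (PiLp.volume_preserving_ofLp (Fin n)).measure_preimage
    (MeasurableSet.univ_pi fun _ => measurableSet_Ico).nullMeasurableSet, Real.volume_pi_Ico]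
  have length (i : Fin n) : c i + l / 2 - (c i - l / 2) = l := by ring
  simp [length, ENNReal.ofReal_pow hl]

namespace Cube

lemma measurableSet (Q : Cube n) : MeasurableSet Q.toSet := measurableSet_cubeSet _ _

lemma volume_eq (Q : Cube n) : volume Q.toSet = ENNReal.ofReal (Q.side ^ n) :=
  volume_cubeSet _ Q.side_pos.le

lemma volume_ne_zero (Q : Cube n) : volume Q.toSet ≠ 0 := by
  rw [Q.volume_eq]
  simpa using pow_pos Q.side_pos n

lemma volume_ne_top (Q : Cube n) : volume Q.toSet ≠ ⊤ := by
  rw [Q.volume_eq]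
  exact ENNReal.ofReal_ne_top

end Cube

lemma avg_le_avg {p q : ℝ} (hp : 0 < p) (hpq : p ≤ q) (Q : Cube n) {F : E n → ℂ}
    (hF : AEStronglyMeasurable F volume) : avg p Q F ≤ avg q Q F := by
  have holder := eLpNorm_le_eLpNorm_mul_rpow_measure_univ (ENNReal.ofReal_le_ofReal hpq)
    (hF.restrict (s := Q.toSet))
  rw [Measure.restrict_apply_univ, ENNReal.toReal_ofReal hp.le,
    ENNReal.toReal_ofReal (hp.trans_le hpq).le] at holder
  set N := eLpNorm F (ENNReal.ofReal q) (volume.restrict Q.toSet)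
  calc avg p Q F
      ≤ volume Q.toSet ^ (-(1 / p)) * (N * volume Q.toSet ^ (1 / p - 1 / q)) := by
        unfold avg; gcongr
    _ = (volume Q.toSet ^ (-(1 / p)) * volume Q.toSet ^ (1 / p - 1 / q)) * N := by ring
    _ = avg q Q F := by
        rw [← ENNReal.rpow_add _ _ Q.volume_ne_zero Q.volume_ne_top]
        congr 2
        ring

lemma volume_mul_avg_rpow_self {p : ℝ} (hp : 0 < p) (Q : Cube n) (F : E n → ℂ) :
    volume Q.toSet * avg p Q F ^ p = ∫⁻ x in Q.toSet, ‖F x‖ₑ ^ p := by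
  rw [avg, ENNReal.mul_rpow_of_nonneg _ _ hp.le, ← ENNReal.rpow_mul, neg_mul,
    one_div_mul_cancel hp.ne', ENNReal.rpow_neg_one, ← mul_assoc,
    ENNReal.mul_inv_cancel Q.volume_ne_zero Q.volume_ne_top, one_mul,
    eLpNorm_eq_lintegral_rpow_enorm_toReal (by simpa using hp) ENNReal.ofReal_ne_top,
    ENNReal.toReal_ofReal hp.le, ← ENNReal.rpow_mul, one_div_mul_cancel hp.ne', ENNReal.rpow_one]

lemma tsum_volume_mul_avg_rpow_le {p q : ℝ} (hp : 0 < p) (hpq : p ≤ q) {S : Set (Cube n)}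
    (hS : S.PairwiseDisjoint Cube.toSet) {F : E n → ℂ} (hF : AEStronglyMeasurable F volume) :
    ∑' Q : S, volume (Q : Cube n).toSet * avg p (Q : Cube n) F ^ q ≤ ∫⁻ x, ‖F x‖ₑ ^ q := by
  have hq : 0 < q := hp.trans_le hpq
  refine ENNReal.summable.tsum_le_of_sum_le fun s => ?_
  calc ∑ Q ∈ s, volume (Q : Cube n).toSet * avg p (Q : Cube n) F ^ q
      ≤ ∑ Q ∈ s, ∫⁻ x in (Q : Cube n).toSet, ‖F x‖ₑ ^ q := Finset.sum_le_sum fun Q _ => by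
        rw [← volume_mul_avg_rpow_self hq]
        gcongr
        exact avg_le_avg hp hpq _ hF
    _ = ∫⁻ x in ⋃ Q ∈ s, (Q : Cube n).toSet, ‖F x‖ₑ ^ q :=
        (lintegral_biUnion_finset (fun Q _ Q' _ hne => hS (Subtype.prop Q) (Subtype.prop Q')
          (Subtype.coe_ne_coe.2 hne)) (fun Q _ => Cube.measurableSet _) _).symm
    _ ≤ ∫⁻ x, ‖F x‖ₑ ^ q := setLIntegral_le_lintegral _ _

lemma isSparse_of_pairwiseDisjoint {η : ℝ} (hη : η < 1) {S : Set (Cube n)}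
    (hS : S.PairwiseDisjoint Cube.toSet) : IsSparse η S := by
  refine ⟨Cube.toSet, fun Q _ => ⟨Q.measurableSet, subset_rfl, ?_⟩, hS⟩
  calc ENNReal.ofReal η * volume Q.toSet < 1 * volume Q.toSet :=
        (ENNReal.mul_lt_mul_iff_left Q.volume_ne_zero Q.volume_ne_top).2
          (ENNReal.ofReal_lt_one.2 hη)
    _ = volume Q.toSet := one_mul _

end Cubes

section DisjointSup

variable {n : ℕ} {α r : ℝ} {F g : E n → ℂ}

/-- The supremum of the sparse forms over all families of pairwise disjoint cubes. -/
def disjointSup (α r : ℝ) (F g : E n → ℂ) : ℝ≥0∞ :=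
  ⨆ S : {S : Set (Cube n) // S.PairwiseDisjoint Cube.toSet}, sparseForm α S.1 r r F g

lemma sparseForm_le_disjointSup (α r : ℝ) (F g : E n → ℂ) {S : Set (Cube n)}
    (hS : S.PairwiseDisjoint Cube.toSet) : sparseForm α S r r F g ≤ disjointSup α r F g :=
  le_iSup (fun S : {S : Set (Cube n) // S.PairwiseDisjoint Cube.toSet} =>
    sparseForm α S.1 r r F g) ⟨S, hS⟩

lemma mul_le_sq_add_sq_of_ennreal (x y : ℝ≥0∞) : x * y ≤ x ^ 2 + y ^ 2 := by
  rcases le_total x y with h | h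
  · calc x * y ≤ y * y := by gcongr
      _ ≤ x ^ 2 + y ^ 2 := by rw [← sq]; exact le_add_self
  · calc x * y ≤ x * x := by gcongr
      _ ≤ x ^ 2 + y ^ 2 := by rw [← sq]; exact le_self_add

lemma disjointSup_le (hr : 0 < r) (hα : r ≤ 2 * α) (hF : AEStronglyMeasurable F volume)
    (hg : AEStronglyMeasurable g volume) :
    disjointSup α r F g ≤
      ((∫⁻ x, ‖F x‖ₑ ^ (2 * α)) + ∫⁻ x, ‖g x‖ₑ ^ (2 * α)) ^ (1 / α) := by
  have hα₀ : 0 < α := by linarith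
  have rpow_sq (x : ℝ≥0∞) : (x ^ α) ^ 2 = x ^ (2 * α) := by
    rw [← ENNReal.rpow_mul_natCast, Nat.cast_ofNat, mul_comm]
  refine iSup_le fun ⟨S, hS⟩ => ?_
  unfold sparseForm
  gcongr
  calc ∑' Q : S, volume (Q : Cube n).toSet * avg r (Q : Cube n) F ^ α * avg r (Q : Cube n) g ^ α
      ≤ ∑' Q : S, (volume (Q : Cube n).toSet * avg r (Q : Cube n) F ^ (2 * α) +
          volume (Q : Cube n).toSet * avg r (Q : Cube n) g ^ (2 * α)) := by
        refine ENNReal.tsum_le_tsum fun Q => ?_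
        rw [mul_assoc, ← mul_add, ← rpow_sq, ← rpow_sq]
        gcongr
        exact mul_le_sq_add_sq_of_ennreal _ _
    _ = _ := ENNReal.tsum_add
    _ ≤ _ := add_le_add (tsum_volume_mul_avg_rpow_le hr hα hS hF)
        (tsum_volume_mul_avg_rpow_le hr hα hS hg)

lemma disjointSup_lt_top (hr : 0 < r) (hα : r ≤ 2 * α)
    (hF : MemLp F (ENNReal.ofReal (2 * α))) (hg : MemLp g (ENNReal.ofReal (2 * α))) :
    disjointSup α r F g < ⊤ := by
  have hα₀ : 0 < 2 * α := by linarith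
  have lintegral_ne_top {H : E n → ℂ} (hH : MemLp H (ENNReal.ofReal (2 * α))) :
      ∫⁻ x, ‖H x‖ₑ ^ (2 * α) ≠ ⊤ := by
    simpa only [ENNReal.toReal_ofReal hα₀.le] using (lintegral_rpow_enorm_lt_top_of_eLpNorm_lt_top
      (by simpa using hα₀) ENNReal.ofReal_ne_top hH.2).ne
  exact (disjointSup_le hr hα hF.1 hg.1).trans_lt <| ENNReal.rpow_lt_top_of_nonneg
    (one_div_nonneg.2 (by linarith))
    (ENNReal.add_ne_top.2 ⟨lintegral_ne_top hF, lintegral_ne_top hg⟩)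

lemma exists_pairwiseDisjoint_disjointSup_le (hr : 0 < r) (hα : r ≤ 2 * α)
    (hF : MemLp F (ENNReal.ofReal (2 * α))) (hg : MemLp g (ENNReal.ofReal (2 * α))) :
    ∃ S : Set (Cube n), S.PairwiseDisjoint Cube.toSet ∧
      disjointSup α r F g ≤ 2 * sparseForm α S r r F g := by
  rcases eq_or_ne (disjointSup α r F g) 0 with h₀ | h₀
  · exact ⟨∅, Set.pairwiseDisjoint_empty, h₀.trans_le zero_le⟩
  · obtain ⟨⟨S, hS⟩, hlt⟩ := lt_iSup_iff.1
      (ENNReal.half_lt_self h₀ (disjointSup_lt_top hr hα hF hg).ne)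
    refine ⟨S, hS, ?_⟩
    rw [mul_comm]
    exact (ENNReal.div_le_iff (by norm_num) (by norm_num)).1 hlt.le

end DisjointSup

lemma tsum_le_rpow_tsum {ι : Type*} {α : ℝ} (hα : 0 < α) (hα₁ : α ≤ 1) (x : ι → ℝ≥0∞) :
    ∑' i, x i ≤ (∑' i, x i ^ α) ^ (1 / α) := by
  refine ENNReal.summable.tsum_le_of_sum_le fun s => ?_
  have sum_rpow_le : (∑ i ∈ s, x i) ^ α ≤ ∑ i ∈ s, x i ^ α :=
    Finset.le_sum_of_subadditive (· ^ α) (ENNReal.zero_rpow_of_pos hα).le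
      (fun a b => ENNReal.rpow_add_le_add_rpow a b hα.le hα₁) s x
  calc ∑ i ∈ s, x i = ((∑ i ∈ s, x i) ^ α) ^ (1 / α) := by
        rw [← ENNReal.rpow_mul, mul_one_div_cancel hα.ne', ENNReal.rpow_one]
    _ ≤ (∑' i, x i ^ α) ^ (1 / α) := by
        gcongr
        exact sum_rpow_le.trans (ENNReal.sum_le_tsum s)

section DisjointCubes

variable {n : ℕ} {α r : ℝ}

lemma eLpNorm_restrict_cube (r : ℝ) (Q : Cube n) (F : E n → ℂ) :
    eLpNorm F (ENNReal.ofReal r) (volume.restrict Q.toSet) =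
      volume Q.toSet ^ (1 / r) * avg r Q F := by
  unfold avg
  rw [← mul_assoc, ← ENNReal.rpow_add _ _ Q.volume_ne_zero Q.volume_ne_top]
  simp

lemma eLpNorm_mul_eLpNorm_restrict_cube_rpow (hα : 0 < α) (Q : Cube n) (F g : E n → ℂ) :
    (eLpNorm F (ENNReal.ofReal r) (volume.restrict Q.toSet) *
      eLpNorm g (ENNReal.ofReal r) (volume.restrict Q.toSet)) ^ α =
      volume Q.toSet ^ (2 * α / r - 1) * (volume Q.toSet * avg r Q F ^ α * avg r Q g ^ α) := by
  have hv₀ := Q.volume_ne_zero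
  have hv := Q.volume_ne_top
  simp only [eLpNorm_restrict_cube, ENNReal.mul_rpow_of_nonneg _ _ hα.le, ← ENNReal.rpow_mul]
  have volume_factor : volume Q.toSet ^ (2 * α / r - 1) * volume Q.toSet =
      volume Q.toSet ^ (1 / r * α) * volume Q.toSet ^ (1 / r * α) := by
    rw [← ENNReal.rpow_add _ _ hv₀ hv]
    conv_lhs => enter [2]; rw [← ENNReal.rpow_one (volume Q.toSet)]
    rw [← ENNReal.rpow_add _ _ hv₀ hv]
    congr 1
    ring
  calc _ = volume Q.toSet ^ (1 / r * α) * volume Q.toSet ^ (1 / r * α) *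
          (avg r Q F ^ α * avg r Q g ^ α) := by ring
    _ = _ := by rw [← volume_factor]; ring

lemma injective_of_pairwise_disjoint {ι : Type*} {Q : ι → Cube n}
    (hQ : Pairwise fun i j => Disjoint (Q i).toSet (Q j).toSet) : Function.Injective Q := by
  intro i j hij
  by_contra hne
  have hempty : (Q j).toSet = ∅ := by simpa [hij] using hQ hne
  exact (Q j).volume_ne_zero (by rw [hempty, measure_empty])

lemma tsum_eLpNorm_mul_le_disjointSup (hα : 0 < α) (hα₁ : α ≤ 1) {ι : Type*} {Q : ι → Cube n}
    (hQ : Pairwise fun i j => Disjoint (Q i).toSet (Q j).toSet) {v : ℝ≥0∞}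
    (hv : ∀ i, volume (Q i).toSet = v) (F g : E n → ℂ) :
    ∑' i, eLpNorm F (ENNReal.ofReal r) (volume.restrict (Q i).toSet) *
      eLpNorm g (ENNReal.ofReal r) (volume.restrict (Q i).toSet) ≤
      v ^ (2 / r - 1 / α) * disjointSup α r F g := by
  have hdisj : (Set.range Q).PairwiseDisjoint Cube.toSet := by
    rintro _ ⟨i, rfl⟩ _ ⟨j, rfl⟩ hne
    exact hQ (ne_of_apply_ne Q hne)
  calc _ ≤ (∑' i, (eLpNorm F (ENNReal.ofReal r) (volume.restrict (Q i).toSet) *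
          eLpNorm g (ENNReal.ofReal r) (volume.restrict (Q i).toSet)) ^ α) ^ (1 / α) :=
        tsum_le_rpow_tsum hα hα₁ _
    _ = (v ^ (2 * α / r - 1)) ^ (1 / α) *
          (∑' i, volume (Q i).toSet * avg r (Q i) F ^ α * avg r (Q i) g ^ α) ^ (1 / α) := by
        simp only [eLpNorm_mul_eLpNorm_restrict_cube_rpow hα, hv]
        rw [ENNReal.tsum_mul_left, ENNReal.mul_rpow_of_nonneg _ _ (by positivity)]
    _ = v ^ (2 / r - 1 / α) * sparseForm α (Set.range Q) r r F g := by
        rw [sparseForm,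
          tsum_range (fun P : Cube n => volume P.toSet * avg r P F ^ α * avg r P g ^ α)
          (injective_of_pairwise_disjoint hQ), ← ENNReal.rpow_mul]
        congr 2
        field_simp
    _ ≤ _ := by
        gcongr
        exact sparseForm_le_disjointSup _ _ _ _ hdisj

end DisjointCubes

section GridCubes

variable {n : ℕ} {ℓ : ℝ} (hℓ : 0 < ℓ)

/-- The dilation by `2s + 1` about its center of the grid cube `∏ᵢ [ℓ qᵢ, ℓ (qᵢ + 1))`. -/
def gridCube (s : ℕ) (q : Fin n → ℤ) : Cube n where
  center := WithLp.toLp 2 fun i => ℓ * (q i + 1 / 2)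
  side := ℓ * (2 * s + 1)
  side_pos := by positivity

lemma mem_gridCube {s : ℕ} {q : Fin n → ℤ} {x : E n} :
    x ∈ (gridCube hℓ s q).toSet ↔ ∀ i, ℓ * (q i - s) ≤ x i ∧ x i < ℓ * (q i + s + 1) := by
  refine forall_congr' fun i => ?_
  have lower : ℓ * ((q i : ℝ) + 1 / 2) - ℓ * (2 * s + 1) / 2 = ℓ * (q i - s) := by ring
  have upper : ℓ * ((q i : ℝ) + 1 / 2) + ℓ * (2 * s + 1) / 2 = ℓ * (q i + s + 1) := by ring
  simp only [gridCube, lower, upper]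

lemma mem_gridCube_zero {q : Fin n → ℤ} {x : E n} :
    x ∈ (gridCube hℓ 0 q).toSet ↔ q = fun i => ⌊x i / ℓ⌋ := by
  rw [mem_gridCube, funext_iff]
  refine forall_congr' fun i => ?_
  rw [eq_comm, Int.floor_eq_iff, le_div_iff₀ hℓ, div_lt_iff₀ hℓ, mul_comm ℓ, mul_comm ℓ]
  simp

lemma volume_gridCube (s : ℕ) (q : Fin n → ℤ) :
    volume (gridCube hℓ s q).toSet = ENNReal.ofReal ((ℓ * (2 * s + 1)) ^ n) := Cube.volume_eq _

lemma disjoint_gridCube {s : ℕ} (c : Fin n → ℤ) {p p' : Fin n → ℤ} (hne : p ≠ p') :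
    Disjoint (gridCube hℓ s fun i => c i + (2 * s + 1) * p i).toSet
      (gridCube hℓ s fun i => c i + (2 * s + 1) * p' i).toSet := by
  rw [Set.disjoint_left]
  intro x hx hx'
  refine hne (funext fun i => ?_)
  have le_of_mem {a b : Fin n → ℤ} (ha : x ∈ (gridCube hℓ s fun i => c i + (2 * s + 1) * a i).toSet)
      (hb : x ∈ (gridCube hℓ s fun i => c i + (2 * s + 1) * b i).toSet) : a i ≤ b i := by
    have hlt := lt_of_mul_lt_mul_left
      (((mem_gridCube hℓ).1 ha i).1.trans_lt ((mem_gridCube hℓ).1 hb i).2) hℓ.le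
    have hlt' : c i + (2 * s + 1) * a i - s < c i + (2 * s + 1) * b i + s + 1 := by
      push_cast at hlt
      exact_mod_cast hlt
    have hs : (0 : ℤ) < 2 * s + 1 := by positivity
    exact Int.lt_add_one_iff.1 (lt_of_mul_lt_mul_left (by linarith) hs.le)
  exact le_antisymm (le_of_mem hx hx') (le_of_mem hx' hx)

lemma gridCube_zero_subset {q p : Fin n → ℤ} {s : ℕ} (hp : ∀ i, (p i - q i).natAbs ≤ s) :
    (gridCube hℓ 0 p).toSet ⊆ (gridCube hℓ s q).toSet := by
  intro x hx
  rw [mem_gridCube] at hx ⊢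
  intro i
  obtain ⟨hlower, hupper⟩ := hx i
  have le_p : ((q i - s : ℤ) : ℝ) ≤ p i := by exact_mod_cast (by grind : q i - s ≤ p i)
  have p_le : (p i : ℝ) ≤ (q i + s : ℤ) := by exact_mod_cast (by grind : p i ≤ q i + s)
  push_cast at le_p p_le hlower hupper
  exact ⟨(mul_le_mul_of_nonneg_left (by linarith) hℓ.le).trans hlower,
    hupper.trans_le (mul_le_mul_of_nonneg_left (by linarith) hℓ.le)⟩

lemma tsum_eLpNorm_mul_gridCube_le {α r : ℝ} (hα : 0 < α) (hα₁ : α ≤ 1) (s : ℕ) (F g : E n → ℂ) :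
    ∑' q : Fin n → ℤ, eLpNorm F (ENNReal.ofReal r) (volume.restrict (gridCube hℓ s q).toSet) *
      eLpNorm g (ENNReal.ofReal r) (volume.restrict (gridCube hℓ s q).toSet) ≤
      (2 * s + 1 : ℕ) ^ n *
        (ENNReal.ofReal ((ℓ * (2 * s + 1)) ^ n) ^ (2 / r - 1 / α) * disjointSup α r F g) := by
  -- In each residue class modulo `2s + 1` the dilated cubes are pairwise disjoint.
  let ofResidue (cp : (Fin n → Fin (2 * s + 1)) × (Fin n → ℤ)) : Fin n → ℤ :=
    fun i => cp.1 i + (2 * s + 1) * cp.2 i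
  have surjective_ofResidue : Function.Surjective ofResidue := fun q => by
    have hs : (0 : ℤ) < 2 * s + 1 := by positivity
    refine ⟨(fun i => ⟨(q i % (2 * s + 1)).toNat, by
      have := Int.emod_lt_of_pos (q i) hs; omega⟩, fun i => q i / (2 * s + 1)), ?_⟩
    ext i
    simp only [ofResidue, Int.toNat_of_nonneg (Int.emod_nonneg (q i) hs.ne')]
    exact Int.emod_add_mul_ediv (q i) _
  refine (ENNReal.tsum_le_tsum_comp_of_surjective surjective_ofResidue _).trans ?_
  rw [ENNReal.tsum_prod', tsum_fintype]
  refine (Finset.sum_le_sum fun c _ => tsum_eLpNorm_mul_le_disjointSup hα hα₁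
    (fun p p' hne => disjoint_gridCube hℓ (fun i => (c i : ℤ)) hne)
    (fun p => volume_gridCube hℓ s _) F g).trans_eq ?_
  simp

end GridCubes

section LatticeSums

variable {n : ℕ}

/-- The supremum norm of an integer vector, as a natural number. -/
def supNatAbs (m : Fin n → ℤ) : ℕ := Finset.univ.sup fun i => (m i).natAbs

lemma natAbs_le_supNatAbs (m : Fin n → ℤ) (i : Fin n) : (m i).natAbs ≤ supNatAbs m :=
  Finset.le_sup (f := fun i => (m i).natAbs) (Finset.mem_univ i)

lemma tsum_int_inv_one_add_abs_sq_ne_top :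
    ∑' k : ℤ, ENNReal.ofReal (((1 + |(k : ℝ)|) ^ 2)⁻¹) ≠ ⊤ := by
  refine Summable.tsum_ofReal_ne_top <| .of_norm_bounded_eventually
    (Real.summable_one_div_int_pow.2 (by norm_num : 1 < 2)) ?_
  filter_upwards [(Set.finite_singleton (0 : ℤ)).compl_mem_cofinite] with k hk
  have hk₀ : 0 < |(k : ℝ)| := abs_pos.2 (by exact_mod_cast hk)
  rw [Real.norm_of_nonneg (by positivity), one_div, ← sq_abs (k : ℝ)]
  gcongr
  linarith

lemma tsum_pi_prod_eq_pow (w : ℤ → ℝ≥0∞) (n : ℕ) :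
    ∑' m : Fin n → ℤ, ∏ i, w (m i) = (∑' k, w k) ^ n := by
  induction n with
  | zero => simp [tsum_fintype]
  | succ n ih =>
    rw [← (Fin.consEquiv fun _ : Fin (n + 1) => ℤ).tsum_eq, ENNReal.tsum_prod']
    simp only [Fin.consEquiv_apply, Fin.prod_univ_succ, Fin.cons_zero, Fin.cons_succ,
      ENNReal.tsum_mul_left, ih, ENNReal.tsum_mul_right]
    rw [pow_succ, mul_comm]

lemma tsum_supNatAbs_ne_top (n : ℕ) :
    ∑' m : Fin n → ℤ, ENNReal.ofReal (((2 * (supNatAbs m : ℝ) + 1) ^ (2 * n))⁻¹) ≠ ⊤ := by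
  have le_prod (m : Fin n → ℤ) : ENNReal.ofReal (((2 * (supNatAbs m : ℝ) + 1) ^ (2 * n))⁻¹) ≤
      ∏ i, ENNReal.ofReal (((1 + |(m i : ℝ)|) ^ 2)⁻¹) := by
    rw [← ENNReal.ofReal_prod_of_nonneg (fun i _ => by positivity), Finset.prod_inv_distrib]
    gcongr
    calc ∏ i, (1 + |(m i : ℝ)|) ^ 2 ≤ ∏ _i : Fin n, (2 * (supNatAbs m : ℝ) + 1) ^ 2 := by
          refine Finset.prod_le_prod (fun i _ => by positivity) fun i _ => ?_
          have abs_le : |(m i : ℝ)| ≤ supNatAbs m := by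
            rw [← Int.cast_abs, ← Nat.cast_natAbs]
            exact_mod_cast natAbs_le_supNatAbs m i
          gcongr ?_ ^ 2
          linarith [abs_nonneg (m i : ℝ)]
      _ = _ := by rw [Finset.prod_const, Finset.card_univ, Fintype.card_fin, pow_mul]
  refine ne_top_of_le_ne_top ?_ (ENNReal.tsum_le_tsum le_prod)
  rw [tsum_pi_prod_eq_pow (fun k => ENNReal.ofReal (((1 + |(k : ℝ)|) ^ 2)⁻¹)) n]
  exact ENNReal.pow_ne_top tsum_int_inv_one_add_abs_sq_ne_top

lemma mul_le_norm_sub_of_mem_gridCube {ℓ : ℝ} (hℓ : 0 < ℓ) {m q : Fin n → ℤ}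
    (hm : 0 < supNatAbs m) {x y : E n} (hx : x ∈ (gridCube hℓ 0 q).toSet)
    (hy : y ∈ (gridCube hℓ 0 (q + m)).toSet) : (supNatAbs m - 1) * ℓ ≤ ‖x - y‖ := by
  have hne : (Finset.univ : Finset (Fin n)).Nonempty :=
    Finset.nonempty_of_ne_empty fun h => by simp [supNatAbs, h] at hm
  obtain ⟨i, -, hi⟩ := Finset.exists_mem_eq_sup Finset.univ hne fun i => (m i).natAbs
  have supNatAbs_eq : (supNatAbs m : ℝ) = |(m i : ℝ)| := by
    rw [← Int.cast_abs, ← Nat.cast_natAbs]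
    exact_mod_cast hi
  obtain ⟨hx₁, hx₂⟩ := (mem_gridCube hℓ).1 hx i
  obtain ⟨hy₁, hy₂⟩ := (mem_gridCube hℓ).1 hy i
  simp only [Pi.add_apply, Int.cast_add, Nat.cast_zero, sub_zero, add_zero] at hx₁ hx₂ hy₁ hy₂
  refine le_trans ?_ (PiLp.norm_apply_le (x - y) i)
  rw [PiLp.sub_apply, Real.norm_eq_abs, supNatAbs_eq]
  rcases abs_cases (m i : ℝ) with ⟨h, -⟩ | ⟨h, -⟩ <;> rw [h, le_abs]
  · exact Or.inr (by linarith)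
  · exact Or.inl (by linarith)

end LatticeSums

section LocalizedKernels

variable {V : Type*} [NormedAddCommGroup V] [InnerProductSpace ℝ V] [FiniteDimensional ℝ V]
  [MeasurableSpace V] [BorelSpace V] {K F G : V → ℂ}

lemma enorm_kernelForm_le_tsum_partition (hK : Continuous K) {B : ℝ} (hB : ∀ x, ‖K x‖ ≤ B)
    (hF : Integrable F) (hG : Integrable G) {ι : Type*} [Countable ι] {P : ι → Set V}
    (hPm : ∀ i, MeasurableSet (P i)) (hPd : Pairwise fun i j => Disjoint (P i) (P j))
    (hPu : ⋃ i, P i = Set.univ) :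
    ‖kernelForm K F G‖ₑ ≤
      ∑' i, ∑' j, ‖kernelForm K ((P j).indicator F) ((P i).indicator G)‖ₑ := by
  have hint : Integrable fun p : V × V => K (p.1 - p.2) * (F p.2 * G p.1) :=
    (integrable_mul_snd_fst hF hG).bdd_mul (c := B)
      (hK.comp (continuous_fst.sub continuous_snd)).aestronglyMeasurable
      (Eventually.of_forall fun p => hB _)
  have setIntegral_eq (q : ι × ι) : ∫ p in P q.1 ×ˢ P q.2, K (p.1 - p.2) * (F p.2 * G p.1) =
      kernelForm K ((P q.2).indicator F) ((P q.1).indicator G) := by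
    rw [← integral_indicator ((hPm _).prod (hPm _))]
    unfold kernelForm
    congr 1 with p
    by_cases h₁ : p.1 ∈ P q.1 <;> by_cases h₂ : p.2 ∈ P q.2 <;> simp [h₁, h₂]
  have pairwise_disjoint_prod : Pairwise fun q q' : ι × ι =>
      Disjoint (P q.1 ×ˢ P q.2) (P q'.1 ×ˢ P q'.2) := fun q q' hne => by
    refine Set.disjoint_prod.2 ?_
    rcases ne_or_eq q.1 q'.1 with h | h
    · exact Or.inl (hPd h)
    · exact Or.inr (hPd fun h' => hne (Prod.ext h h'))
  have iUnion_prod : ⋃ q : ι × ι, P q.1 ×ˢ P q.2 = Set.univ := by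
    rw [Set.iUnion_prod, hPu, Set.univ_prod_univ]
  have hsum := hasSum_integral_iUnion (μ := volume) (fun q : ι × ι => (hPm q.1).prod (hPm q.2))
    pairwise_disjoint_prod hint.integrableOn
  rw [iUnion_prod, setIntegral_univ] at hsum
  simp only [setIntegral_eq] at hsum
  calc ‖kernelForm K F G‖ₑ
      = ‖∑' q : ι × ι, kernelForm K ((P q.2).indicator F) ((P q.1).indicator G)‖ₑ := by
        rw [hsum.tsum_eq, kernelForm]
    _ ≤ _ := enorm_tsum_le_tsum_enorm
    _ = _ := ENNReal.tsum_prod'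

lemma enorm_kernelForm_indicator_le {S T : Set V} (hS : MeasurableSet S) (hT : MeasurableSet T)
    {D : ℝ} (hD : 0 ≤ D) (hK : ∀ x ∈ T, ∀ y ∈ S, ‖K (x - y)‖ ≤ D) (hF : Integrable F)
    (hG : Integrable G) {r : ℝ} (hr : 1 ≤ r) :
    ‖kernelForm K (S.indicator F) (T.indicator G)‖ₑ ≤
      ENNReal.ofReal D * (volume S ^ (1 - 1 / r) * volume T ^ (1 - 1 / r)) *
        (eLpNorm F (ENNReal.ofReal r) (volume.restrict S) *
          eLpNorm G (ENNReal.ofReal r) (volume.restrict T)) := by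
  have lintegral_le {Q : Set V} (hQ : MeasurableSet Q) {H : V → ℂ} (hH : Integrable H) :
      ∫⁻ x, ‖Q.indicator H x‖ₑ ≤
        eLpNorm H (ENNReal.ofReal r) (volume.restrict Q) * volume Q ^ (1 - 1 / r) := by
    rw [← eLpNorm_one_eq_lintegral_enorm, eLpNorm_indicator_eq_eLpNorm_restrict hQ]
    simpa only [Measure.restrict_apply_univ, ENNReal.toReal_ofReal (by linarith : 0 ≤ r),
      ENNReal.toReal_one, div_one] using
      eLpNorm_le_eLpNorm_mul_rpow_measure_univ (p := 1) (q := ENNReal.ofReal r)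
        (by simpa using hr) (hH.aestronglyMeasurable.restrict (s := Q))
  have hFS := hF.indicator hS
  have hGT := hG.indicator hT
  calc ‖kernelForm K (S.indicator F) (T.indicator G)‖ₑ
      ≤ ENNReal.ofReal (D * ((∫ x, ‖S.indicator F x‖) * ∫ x, ‖T.indicator G x‖)) := by
        rw [← ofReal_norm]
        exact ENNReal.ofReal_le_ofReal (norm_kernelForm_le (fun x y hy hx => hK x
          (Set.mem_of_indicator_ne_zero hx) y (Set.mem_of_indicator_ne_zero hy)) hFS hGT)
    _ = ENNReal.ofReal D * ((∫⁻ x, ‖S.indicator F x‖ₑ) * ∫⁻ x, ‖T.indicator G x‖ₑ) := by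
        rw [ENNReal.ofReal_mul hD, ENNReal.ofReal_mul (by positivity),
          ofReal_integral_norm_eq_lintegral_enorm hFS, ofReal_integral_norm_eq_lintegral_enorm hGT]
    _ ≤ ENNReal.ofReal D * ((eLpNorm F (ENNReal.ofReal r) (volume.restrict S) *
          volume S ^ (1 - 1 / r)) * (eLpNorm G (ENNReal.ofReal r) (volume.restrict T) *
          volume T ^ (1 - 1 / r))) := by
        gcongr
        · exact lintegral_le hS hF
        · exact lintegral_le hT hG
    _ = _ := by ring

/-- The multiplier `m` is integrable and bounded by `M`, and its kernel `𝓕⁻ m` is bounded by `B`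
and, at distances at least `ℓ`, by `D (ℓ / |x|) ^ N`. -/
structure KernelBounds (m : V → ℂ) (M : ℝ≥0) (B D ℓ : ℝ) (N : ℕ) : Prop where
  integrable : Integrable m
  nnnorm_le : ∀ ξ, ‖m ξ‖₊ ≤ M
  norm_kernel_le : ∀ x, ‖𝓕⁻ m x‖ ≤ B
  nonneg : 0 ≤ D
  norm_kernel_le_of_le : ∀ x, ℓ ≤ ‖x‖ → ‖𝓕⁻ m x‖ ≤ D * (ℓ / ‖x‖) ^ N

end LocalizedKernels

section SparseBound

variable {n N : ℕ} {m F G : E n → ℂ} {M : ℝ≥0} {B D ℓ r : ℝ}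

lemma enorm_kernelForm_gridCube_le (h : KernelBounds m M B D ℓ N) (hℓ : 0 < ℓ)
    (hF : ∀ p, MemLp F p) (hG : ∀ p, MemLp G p) (hr₁ : 1 ≤ r) (hr₂ : r ≤ 2) (k q : Fin n → ℤ) :
    ‖kernelForm (𝓕⁻ m) ((gridCube hℓ 0 (q + k)).toSet.indicator F)
        ((gridCube hℓ 0 q).toSet.indicator G)‖ₑ ≤
      ENNReal.ofReal ((B ^ (2 / r - 1) * (M : ℝ) ^ (2 - 2 / r) + D * (ℓ ^ n) ^ (2 - 2 / r)) *
        (5 / (2 * supNatAbs k + 1)) ^ N) *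
        (eLpNorm F (ENNReal.ofReal r) (volume.restrict (gridCube hℓ 0 (q + k)).toSet) *
          eLpNorm G (ENNReal.ofReal r) (volume.restrict (gridCube hℓ 0 q).toSet)) := by
  have hB : 0 ≤ B := (norm_nonneg _).trans (h.norm_kernel_le 0)
  have hD := h.nonneg
  set s := supNatAbs k
  have near_nonneg : 0 ≤ B ^ (2 / r - 1) * (M : ℝ) ^ (2 - 2 / r) := by positivity
  have far_nonneg : 0 ≤ D * (ℓ ^ n) ^ (2 - 2 / r) := by positivity
  rcases le_or_gt s 1 with hs | hs
  · have interp := enorm_kernelForm_le_interp h.integrable h.nnnorm_le h.norm_kernel_le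
      (fun p => (hF p).indicator (gridCube hℓ 0 (q + k)).measurableSet)
      (fun p => (hG p).indicator (gridCube hℓ 0 q).measurableSet) hr₁ hr₂
    rw [eLpNorm_indicator_eq_eLpNorm_restrict (Cube.measurableSet _),
      eLpNorm_indicator_eq_eLpNorm_restrict (Cube.measurableSet _)] at interp
    refine interp.trans (mul_le_mul_left (ENNReal.ofReal_le_ofReal ?_) _)
    have one_le : (1 : ℝ) ≤ (5 / (2 * s + 1)) ^ N := by
      refine one_le_pow₀ ((one_le_div (by positivity)).2 ?_)
      linarith [(by exact_mod_cast hs : (s : ℝ) ≤ 1)]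
    exact (le_add_of_nonneg_right far_nonneg).trans
      (le_mul_of_one_le_right (add_nonneg near_nonneg far_nonneg) one_le)
  · have hs₂ : (2 : ℝ) ≤ s := by exact_mod_cast hs
    have far (x) (hx : x ∈ (gridCube hℓ 0 q).toSet) (y)
        (hy : y ∈ (gridCube hℓ 0 (q + k)).toSet) : ‖𝓕⁻ m (x - y)‖ ≤ D * (5 / (2 * s + 1)) ^ N := by
      have hdist : (s - 1) * ℓ ≤ ‖x - y‖ := mul_le_norm_sub_of_mem_gridCube hℓ (by omega) hx hy
      have le_norm : ℓ ≤ ‖x - y‖ := (le_mul_of_one_le_left hℓ.le (by linarith)).trans hdist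
      have ratio_le : ℓ / ‖x - y‖ ≤ 5 / (2 * s + 1) := by
        rw [div_le_div_iff₀ (hℓ.trans_le le_norm) (by positivity)]
        nlinarith
      exact (h.norm_kernel_le_of_le _ le_norm).trans
        (mul_le_mul_of_nonneg_left (pow_le_pow_left₀ (by positivity) ratio_le N) hD)
    refine (enorm_kernelForm_indicator_le (Cube.measurableSet _) (Cube.measurableSet _)
      (by positivity) far (memLp_one_iff_integrable.1 (hF 1)) (memLp_one_iff_integrable.1 (hG 1))
      hr₁).trans (mul_le_mul_left ?_ _)
    rw [volume_gridCube, volume_gridCube, ENNReal.ofReal_rpow_of_pos (by positivity),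
      ← ENNReal.ofReal_mul (by positivity), ← Real.rpow_add (by positivity),
      ← ENNReal.ofReal_mul (by positivity)]
    refine ENNReal.ofReal_le_ofReal ?_
    calc _ = D * (ℓ ^ n) ^ (2 - 2 / r) * (5 / (2 * s + 1)) ^ N := by
          rw [Nat.cast_zero, mul_zero, zero_add, mul_one, mul_right_comm]
          congr 3
          ring
      _ ≤ _ := by
          gcongr
          exact le_add_of_nonneg_left near_nonneg

lemma tsum_eLpNorm_mul_shifted_gridCube_le {α : ℝ} (hα : 0 < α) (hα₁ : α ≤ 1) (hr : 1 ≤ r)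
    (hℓ : 0 < ℓ) (F G : E n → ℂ) (k : Fin n → ℤ) :
    ∑' q, eLpNorm F (ENNReal.ofReal r) (volume.restrict (gridCube hℓ 0 (q + k)).toSet) *
        eLpNorm G (ENNReal.ofReal r) (volume.restrict (gridCube hℓ 0 q).toSet) ≤
      ENNReal.ofReal ((2 * supNatAbs k + 1) ^ (2 * n) * (ℓ ^ n) ^ (2 / r - 1 / α)) *
        disjointSup α r F G := by
  set s := supNatAbs k
  have exponent_le_one : 2 / r - 1 / α ≤ 1 := by
    have : 2 / r ≤ 2 := by rw [div_le_iff₀ (by linarith)]; linarith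
    linarith [one_le_one_div hα hα₁]
  have enlarge (q : Fin n → ℤ) :
      eLpNorm F (ENNReal.ofReal r) (volume.restrict (gridCube hℓ 0 (q + k)).toSet) *
        eLpNorm G (ENNReal.ofReal r) (volume.restrict (gridCube hℓ 0 q).toSet) ≤
      eLpNorm F (ENNReal.ofReal r) (volume.restrict (gridCube hℓ s q).toSet) *
        eLpNorm G (ENNReal.ofReal r) (volume.restrict (gridCube hℓ s q).toSet) := by
    gcongr <;> refine gridCube_zero_subset hℓ fun i => ?_
    · simpa using natAbs_le_supNatAbs k i
    · simp
  refine (ENNReal.tsum_le_tsum enlarge).trans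
    ((tsum_eLpNorm_mul_gridCube_le hℓ hα hα₁ s F G).trans ?_)
  have cast_eq : ((2 * s + 1 : ℕ) : ℝ≥0∞) ^ n = ENNReal.ofReal ((2 * s + 1) ^ n) := by
    rw [ENNReal.ofReal_pow (by positivity), ← ENNReal.ofReal_natCast]
    push_cast
    rfl
  rw [← mul_assoc, cast_eq, ENNReal.ofReal_rpow_of_pos (by positivity),
    ← ENNReal.ofReal_mul (by positivity), mul_pow, Real.mul_rpow (by positivity) (by positivity)]
  refine mul_le_mul_left (ENNReal.ofReal_le_ofReal ?_) _
  calc (2 * s + 1 : ℝ) ^ n * ((ℓ ^ n) ^ (2 / r - 1 / α) * ((2 * s + 1) ^ n) ^ (2 / r - 1 / α))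
      ≤ (2 * s + 1) ^ n * ((ℓ ^ n) ^ (2 / r - 1 / α) * (2 * s + 1) ^ n) := by
        gcongr
        refine (Real.rpow_le_rpow_of_exponent_le (one_le_pow₀ ?_) exponent_le_one).trans_eq
          (Real.rpow_one _)
        linarith [(s.cast_nonneg : (0 : ℝ) ≤ s)]
    _ = _ := by ring

lemma enorm_kernelForm_le_tsum_gridCube (h : KernelBounds m M B D ℓ N) (hℓ : 0 < ℓ)
    (hF : Integrable F) (hG : Integrable G) :
    ‖kernelForm (𝓕⁻ m) F G‖ₑ ≤ ∑' k : Fin n → ℤ, ∑' q : Fin n → ℤ,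
      ‖kernelForm (𝓕⁻ m) ((gridCube hℓ 0 (q + k)).toSet.indicator F)
        ((gridCube hℓ 0 q).toSet.indicator G)‖ₑ := by
  refine (enorm_kernelForm_le_tsum_partition (continuous_fourierInv_of_integrable h.integrable)
    h.norm_kernel_le hF hG (P := fun q => (gridCube hℓ 0 q).toSet) (fun q => Cube.measurableSet _)
    (fun q q' hne => Set.disjoint_left.2 fun x hx hx' => hne
      (((mem_gridCube_zero hℓ).1 hx).trans ((mem_gridCube_zero hℓ).1 hx').symm))
    (Set.eq_univ_of_forall fun x => Set.mem_iUnion.2 ⟨_, (mem_gridCube_zero hℓ).2 rfl⟩)).trans_eq ?_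
  rw [ENNReal.tsum_comm (α := Fin n → ℤ) (β := Fin n → ℤ) (f := fun k q => ‖kernelForm (𝓕⁻ m)
    ((gridCube hℓ 0 (q + k)).toSet.indicator F) ((gridCube hℓ 0 q).toSet.indicator G)‖ₑ)]
  exact tsum_congr fun q => ((Equiv.addLeft q).tsum_eq fun q' => ‖kernelForm (𝓕⁻ m)
    ((gridCube hℓ 0 q').toSet.indicator F) ((gridCube hℓ 0 q).toSet.indicator G)‖ₑ).symm

/-- The constant with which a multiplier satisfying `KernelBounds m M B D ℓ (4 * n)` is controlled
by sparse forms: the first summand comes from interpolation close to the diagonal, the second from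
the decay of the kernel away from it. -/
def sparseConst (n : ℕ) (M B D ℓ r α : ℝ) : ℝ :=
  (B ^ (2 / r - 1) * M ^ (2 - 2 / r) + D * (ℓ ^ n) ^ (2 - 2 / r)) * (ℓ ^ n) ^ (2 / r - 1 / α)

lemma tsum_enorm_kernelForm_gridCube_le {α : ℝ} (h : KernelBounds m M B D ℓ (4 * n)) (hℓ : 0 < ℓ)
    (hF : ∀ p, MemLp F p) (hG : ∀ p, MemLp G p) (hr₁ : 1 ≤ r) (hr₂ : r ≤ 2) (hα : 0 < α)
    (hα₁ : α ≤ 1) (k : Fin n → ℤ) :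
    ∑' q, ‖kernelForm (𝓕⁻ m) ((gridCube hℓ 0 (q + k)).toSet.indicator F)
        ((gridCube hℓ 0 q).toSet.indicator G)‖ₑ ≤
      ENNReal.ofReal (((2 * (supNatAbs k : ℝ) + 1) ^ (2 * n))⁻¹) * (ENNReal.ofReal (5 ^ (4 * n) *
        sparseConst n M B D ℓ r α) * disjointSup α r F G) := by
  refine (ENNReal.tsum_le_tsum (enorm_kernelForm_gridCube_le h hℓ hF hG hr₁ hr₂ k)).trans ?_
  have hB : 0 ≤ B := (norm_nonneg _).trans (h.norm_kernel_le 0)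
  have hD := h.nonneg
  have hA : 0 ≤ B ^ (2 / r - 1) * (M : ℝ) ^ (2 - 2 / r) + D * (ℓ ^ n) ^ (2 - 2 / r) := by positivity
  unfold sparseConst
  generalize B ^ (2 / r - 1) * (M : ℝ) ^ (2 - 2 / r) + D * (ℓ ^ n) ^ (2 - 2 / r) = A at hA ⊢
  rw [ENNReal.tsum_mul_left]
  refine (mul_le_mul_right (tsum_eLpNorm_mul_shifted_gridCube_le hα hα₁ hr₁ hℓ F G k)
    _).trans_eq ?_
  rw [← mul_assoc, ← mul_assoc, ← ENNReal.ofReal_mul (by positivity),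
    ← ENNReal.ofReal_mul (by positivity)]
  congr 2
  rw [div_pow, show 4 * n = 2 * n + 2 * n by ring, pow_add (2 * (supNatAbs k : ℝ) + 1)]
  field_simp

lemma exists_enorm_kernelForm_le_disjointSup (n : ℕ) : ∃ C : ℝ≥0, ∀ {m F G : E n → ℂ} {M : ℝ≥0}
    {B D ℓ r α : ℝ}, KernelBounds m M B D ℓ (4 * n) → 0 < ℓ → (∀ p, MemLp F p) →
    (∀ p, MemLp G p) → 1 ≤ r → r ≤ 2 → 0 < α → α ≤ 1 →
    ‖kernelForm (𝓕⁻ m) F G‖ₑ ≤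
      C * ENNReal.ofReal (sparseConst n M B D ℓ r α) * disjointSup α r F G := by
  set Z := ∑' k : Fin n → ℤ, ENNReal.ofReal (((2 * (supNatAbs k : ℝ) + 1) ^ (2 * n))⁻¹)
  refine ⟨5 ^ (4 * n) * Z.toNNReal, fun {m F G M B D ℓ r α} h hℓ hF hG hr₁ hr₂ hα hα₁ => ?_⟩
  calc ‖kernelForm (𝓕⁻ m) F G‖ₑ
      ≤ _ := enorm_kernelForm_le_tsum_gridCube h hℓ (memLp_one_iff_integrable.1 (hF 1))
        (memLp_one_iff_integrable.1 (hG 1))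
    _ ≤ _ := ENNReal.tsum_le_tsum
        (tsum_enorm_kernelForm_gridCube_le h hℓ hF hG hr₁ hr₂ hα hα₁)
    _ = Z * (ENNReal.ofReal (5 ^ (4 * n) * sparseConst n M B D ℓ r α) * disjointSup α r F G) :=
        ENNReal.tsum_mul_right
    _ = _ := by
        rw [ENNReal.coe_mul, ENNReal.coe_toNNReal (tsum_supNatAbs_ne_top n),
          ENNReal.ofReal_mul (by positivity), ENNReal.ofReal_pow (by norm_num)]
        push_cast
        rw [ENNReal.ofReal_ofNat]
        ring

end SparseBound

section Scaling

variable {V : Type*} [NormedAddCommGroup V] [InnerProductSpace ℝ V] [FiniteDimensional ℝ V]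
  [MeasurableSpace V] [BorelSpace V] {m b : V → ℂ} {c₁ c₂ : ℝ}

lemma fourierInv_comp_inv_smul (m : V → ℂ) {l : ℝ} (hl : 0 < l) (x : V) :
    𝓕⁻ (fun ξ => m (l⁻¹ • ξ)) x = ((l ^ Module.finrank ℝ V : ℝ) : ℂ) * 𝓕⁻ m (l • x) := by
  have change_variables := Measure.integral_comp_inv_smul (μ := (volume : Measure V))
    (fun v : V => Real.fourierChar (inner ℝ v (l • x)) • m v) l
  rw [abs_of_pos (by positivity)] at change_variables
  rw [Real.fourierInv_eq, Real.fourierInv_eq, ← Complex.real_smul, ← change_variables]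
  congr 1 with v
  rw [inner_smul_left, inner_smul_right]
  simp [hl.ne']

lemma KernelBounds.comp_inv_smul {M : ℝ≥0} {B D ℓ : ℝ} {N : ℕ} (h : KernelBounds m M B D ℓ N)
    {l : ℝ} (hl : 0 < l) :
    KernelBounds (fun ξ => m (l⁻¹ • ξ)) M (l ^ Module.finrank ℝ V * B)
      (l ^ Module.finrank ℝ V * D) (ℓ / l) N := by
  have norm_eq (x : V) : ‖𝓕⁻ (fun ξ => m (l⁻¹ • ξ)) x‖ =
      l ^ Module.finrank ℝ V * ‖𝓕⁻ m (l • x)‖ := by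
    rw [fourierInv_comp_inv_smul m hl, norm_mul, Complex.norm_real,
      Real.norm_of_nonneg (by positivity)]
  have norm_smul_eq (x : V) : ‖l • x‖ = l * ‖x‖ := by rw [norm_smul, Real.norm_of_nonneg hl.le]
  refine ⟨h.integrable.comp_smul (inv_ne_zero hl.ne'), fun ξ => h.nnnorm_le _, fun x => ?_,
    mul_nonneg (by positivity) h.nonneg, fun x hx => ?_⟩
  · rw [norm_eq]
    exact mul_le_mul_of_nonneg_left (h.norm_kernel_le _) (by positivity)
  · rw [norm_eq, mul_assoc, div_div, ← norm_smul_eq]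
    refine mul_le_mul_of_nonneg_left (h.norm_kernel_le_of_le _ ?_) (by positivity)
    rwa [norm_smul_eq, ← div_le_iff₀' hl]

lemma exists_kernelBounds_propagator_mul {d : ℕ} {a : ℝ} (ha : 0 < a)
    (hd : (a ≠ 1 ∧ d = Module.finrank ℝ V) ∨ d + 1 = Module.finrank ℝ V) (h₁ : 0 < c₁)
    (h₂ : c₁ ≤ c₂) (hb : ContDiff ℝ ∞ b) (hbs : Function.support b ⊆ annulus V c₁ c₂) (N : ℕ) :
    ∃ (M : ℝ≥0) (C₁ C₂ C₀ : ℝ), 0 ≤ C₁ ∧ 0 ≤ C₂ ∧ 0 < C₀ ∧ ∀ τ : ℝ, 0 ≤ τ →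
      KernelBounds (fun ξ => propagator a τ ξ * b ξ) M (C₁ * (√(1 + τ) ^ d)⁻¹)
        (C₂ * (√(1 + τ) ^ N)⁻¹) (C₀ * (1 + τ)) N := by
  have hbc : HasCompactSupport b :=
    HasCompactSupport.of_support_subset_isCompact (isCompact_annulus c₁ c₂) hbs
  obtain ⟨M, hM⟩ := hbc.exists_bound_of_continuous hb.continuous
  lift M to ℝ≥0 using (norm_nonneg _).trans (hM 0)
  obtain ⟨C₁, hC₁, norm_le⟩ := exists_norm_oscKernel_le_inv_sqrt_pow ha hd h₁ h₂
    (contDiff_infty.1 hb _) hbs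
  obtain ⟨C, C₀, hC, hC₀, norm_le_of_le⟩ :=
    exists_norm_oscKernel_le_of_le_norm a h₁ h₂ (contDiff_infty.1 hb N) hbs
  refine ⟨M, C₁, C / C₀ ^ N, C₀, hC₁, by positivity, hC₀, fun τ hτ => ⟨?_, fun ξ => ?_,
    norm_le τ hτ, by positivity, fun x hx => (norm_le_of_le τ hτ x hx).trans_eq ?_⟩⟩
  · exact ((continuous_propagator ha τ).mul hb.continuous).integrable_of_hasCompactSupport
      hbc.mul_left
  · rw [← NNReal.coe_le_coe, coe_nnnorm, norm_mul, norm_propagator, one_mul]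
    exact hM ξ
  · have sqrt_pos : 0 < √(1 + τ) := Real.sqrt_pos.2 (by linarith)
    have pow_eq : (1 + τ) ^ N = √(1 + τ) ^ N * √(1 + τ) ^ N := by
      rw [← mul_pow, Real.mul_self_sqrt (by linarith)]
    have norm_pos : 0 < ‖x‖ := (by positivity : 0 < C₀ * (1 + τ)).trans_le hx
    rw [div_pow, div_pow, mul_pow, pow_eq]
    field_simp

end Scaling

section FrequencyLocalized

variable {n d : ℕ} {M B D ℓ r α : ℝ}

lemma sparseConst_scale (hB : 0 ≤ B) (hℓ : 0 < ℓ) {l : ℝ} (hl : 0 < l) :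
    sparseConst n M (l ^ n * B) (l ^ n * D) (ℓ / l) r α =
      l ^ (n * (1 / α - 1)) * sparseConst n M B D ℓ r α := by
  have hln : 0 < l ^ n := by positivity
  have split_far : (l ^ n)⁻¹ ^ (2 - 2 / r) * l ^ n = (l ^ n) ^ (2 / r - 1) := by
    rw [Real.inv_rpow hln.le, ← Real.rpow_neg hln.le]
    nth_rw 2 [← Real.rpow_one (l ^ n)]
    rw [← Real.rpow_add hln]
    ring_nf
  have combine : (l ^ n) ^ (2 / r - 1) * (l ^ n)⁻¹ ^ (2 / r - 1 / α) = l ^ (n * (1 / α - 1)) := by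
    rw [Real.inv_rpow hln.le, ← Real.rpow_neg hln.le, ← Real.rpow_add hln, Real.rpow_mul hl.le,
      Real.rpow_natCast]
    ring_nf
  unfold sparseConst
  rw [div_pow, div_eq_mul_inv (ℓ ^ n), Real.mul_rpow hln.le hB,
    Real.mul_rpow (by positivity) (by positivity), Real.mul_rpow (by positivity) (by positivity),
    ← combine]
  linear_combination D * (ℓ ^ n) ^ (2 - 2 / r) * (ℓ ^ n) ^ (2 / r - 1 / α) *
    (l ^ n)⁻¹ ^ (2 / r - 1 / α) * split_far

/-- With `y = 1 + τ`, the dispersion gains `√y ^ (-d)` near the diagonal, while the sparse form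
loses a power of the length `ℓ y` up to which the waves have spread. -/
lemma sparseConst_le_rpow_mul (hd : d ≤ n) (hB : 0 ≤ B) (hD : 0 ≤ D) (hℓ : 0 < ℓ)
    (hr : 0 < r) {y : ℝ} (hy : 1 ≤ y) :
    sparseConst n M (B * (√y ^ d)⁻¹) (D * (√y ^ (4 * n))⁻¹) (ℓ * y) r α ≤
      y ^ (n * (2 / r - 1 / α) - d * (1 / r - 1 / 2)) * sparseConst n M B D ℓ r α := by
  have hy₀ : 0 < y := by linarith
  have near : (√y ^ d)⁻¹ ^ (2 / r - 1) = y ^ (-(d * (1 / r - 1 / 2))) := by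
    rw [Real.sqrt_eq_rpow, ← Real.rpow_natCast, ← Real.rpow_mul hy₀.le, ← Real.rpow_neg hy₀.le,
      ← Real.rpow_mul hy₀.le]
    ring_nf
  have far : (√y ^ (4 * n))⁻¹ * (y ^ n) ^ (2 - 2 / r) ≤ y ^ (-(d * (1 / r - 1 / 2))) := by
    rw [Real.sqrt_eq_rpow, ← Real.rpow_natCast, ← Real.rpow_natCast, ← Real.rpow_mul hy₀.le,
      ← Real.rpow_neg hy₀.le, ← Real.rpow_mul hy₀.le, ← Real.rpow_add hy₀]
    refine Real.rpow_le_rpow_of_exponent_le hy ?_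
    have hdn : (d : ℝ) * (1 / r) ≤ n * (1 / r) := by gcongr
    have hnr : 0 ≤ n * (1 / r) := by positivity
    push_cast
    linear_combination hdn + hnr + (d.cast_nonneg : (0 : ℝ) ≤ d) / 2
  have spread : ((ℓ * y) ^ n) ^ (2 / r - 1 / α) =
      (ℓ ^ n) ^ (2 / r - 1 / α) * y ^ (n * (2 / r - 1 / α)) := by
    rw [mul_pow, Real.mul_rpow (by positivity) (by positivity), Real.rpow_mul hy₀.le,
      Real.rpow_natCast]
  set γ := y ^ (-(d * (1 / r - 1 / 2)))
  unfold sparseConst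
  rw [spread, mul_pow, Real.mul_rpow hB (by positivity), near,
    Real.mul_rpow (by positivity) (by positivity), sub_eq_add_neg (n * (2 / r - 1 / α)),
    Real.rpow_add hy₀]
  calc _ = (B ^ (2 / r - 1) * M ^ (2 - 2 / r) * γ + D * (ℓ ^ n) ^ (2 - 2 / r) *
        ((√y ^ (4 * n))⁻¹ * (y ^ n) ^ (2 - 2 / r))) *
          ((ℓ ^ n) ^ (2 / r - 1 / α) * y ^ (n * (2 / r - 1 / α))) := by ring
    _ ≤ (B ^ (2 / r - 1) * M ^ (2 - 2 / r) * γ + D * (ℓ ^ n) ^ (2 - 2 / r) * γ) *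
          ((ℓ ^ n) ^ (2 / r - 1 / α) * y ^ (n * (2 / r - 1 / α))) := by gcongr
    _ = _ := by ring

lemma exists_enorm_multiplierForm_le_disjointSup {a : ℝ} (ha : 0 < a)
    (hd : (a ≠ 1 ∧ d = n) ∨ d + 1 = n) {c₁ c₂ : ℝ} (h₁ : 0 < c₁) (h₂ : c₁ ≤ c₂) {b : E n → ℂ}
    (hb : ContDiff ℝ ∞ b) (hbs : Function.support b ⊆ annulus (E n) c₁ c₂) (hr₁ : 1 ≤ r)
    (hr₂ : r ≤ 2) (hα : 0 < α) (hα₁ : α ≤ 1) {e : ℝ}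
    (he : e = n * (2 / r - 1 / α) - d * (1 / r - 1 / 2)) (he₀ : e ≤ 0) :
    ∃ C : ℝ≥0, ∀ t l : ℝ, 0 < t → 0 < l → ∀ F G : E n → ℂ, (∀ p, MemLp F p) → (∀ p, MemLp G p) →
      ‖multiplierForm (fun ξ => propagator a t ξ * b (l⁻¹ • ξ)) F G‖ₑ ≤
        C * ENNReal.ofReal (t ^ e) * ENNReal.ofReal (l ^ (n * (1 / α - 1) + a * e)) *
          disjointSup α r F G := by
  obtain ⟨C, enorm_le⟩ := exists_enorm_kernelForm_le_disjointSup n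
  obtain ⟨M, C₁, C₂, C₀, hC₁, hC₂, hC₀, bounds⟩ := exists_kernelBounds_propagator_mul (V := E n) ha
    (by simpa only [finrank_euclideanSpace_fin] using hd) h₁ h₂ hb hbs (4 * n)
  refine ⟨C * (sparseConst n M C₁ C₂ C₀ r α).toNNReal, fun t l ht hl F G hF hG => ?_⟩
  set τ := t * l ^ a
  have hτ : 0 < τ := by positivity
  have symbol_eq : (fun ξ : E n => propagator a t ξ * b (l⁻¹ • ξ)) =
      fun ξ => propagator a τ (l⁻¹ • ξ) * b (l⁻¹ • ξ) := by
    ext ξ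
    rw [← propagator_smul a t hl, smul_inv_smul₀ hl.ne']
  have scaled := (bounds τ hτ.le).comp_inv_smul hl
  rw [finrank_euclideanSpace_fin] at scaled
  have const_le : sparseConst n M (l ^ n * (C₁ * (√(1 + τ) ^ d)⁻¹))
      (l ^ n * (C₂ * (√(1 + τ) ^ (4 * n))⁻¹)) (C₀ * (1 + τ) / l) r α ≤
      sparseConst n M C₁ C₂ C₀ r α * (t ^ e * l ^ (n * (1 / α - 1) + a * e)) := by
    have hdn : d ≤ n := by omega
    have const_nonneg : 0 ≤ sparseConst n M C₁ C₂ C₀ r α := by unfold sparseConst; positivity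
    have decay : (1 + τ) ^ e ≤ τ ^ e :=
      Real.rpow_le_rpow_of_nonpos hτ (le_add_of_nonneg_left zero_le_one) he₀
    calc _ ≤ l ^ (n * (1 / α - 1)) * ((1 + τ) ^ e * sparseConst n M C₁ C₂ C₀ r α) := by
          rw [sparseConst_scale (by positivity) (by positivity) hl, he]
          gcongr
          exact sparseConst_le_rpow_mul hdn hC₁ hC₂ hC₀ (by linarith) (by linarith)
      _ ≤ l ^ (n * (1 / α - 1)) * (τ ^ e * sparseConst n M C₁ C₂ C₀ r α) := by
          gcongr
      _ = _ := by
          rw [Real.mul_rpow ht.le (by positivity), ← Real.rpow_mul hl.le, Real.rpow_add hl]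
          ring
  rw [symbol_eq, multiplierForm_eq_kernelForm scaled.integrable (memLp_one_iff_integrable.1 (hF 1))
    (memLp_one_iff_integrable.1 (hG 1))]
  refine (enorm_le scaled (by positivity) hF hG hr₁ hr₂ hα hα₁).trans
    (mul_le_mul_left ?_ (disjointSup α r F G))
  rw [ENNReal.coe_mul, ← ENNReal.ofReal, mul_assoc (C : ℝ≥0∞), mul_assoc (C : ℝ≥0∞),
    mul_assoc (ENNReal.ofReal _), ← ENNReal.ofReal_mul (by positivity)]
  gcongr
  exact (ENNReal.ofReal_le_ofReal const_le).trans_eq (ENNReal.ofReal_mul' (by positivity))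

end FrequencyLocalized

section Pairing

variable {n : ℕ}

lemma pairing_fourierInv {H g : E n → ℂ} (hH : Integrable H) (hg : Integrable g) :
    pairing (𝓕⁻ H) g = ∫ ξ, H ξ * 𝓕⁻ g ξ := by
  have self_adjoint : ∫ x, 𝓕 H x * g (-x) = ∫ ξ, H ξ * 𝓕 (fun x => g (-x)) ξ := by
    have flip := VectorFourier.integral_fourierIntegral_smul_eq_flip (L := innerₗ (E n))
      (μ := volume) (ν := volume) (f := H) (g := fun x => g (-x)) Real.continuous_fourierChar
      (by exact continuous_inner) hH hg.comp_neg
    simpa only [smul_eq_mul, flip_innerₗ] using! flip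
  calc pairing (𝓕⁻ H) g = ∫ x, 𝓕 H x * g (-x) := by
        rw [pairing, ← integral_neg_eq_self]
        simp only [fourierInv_eq_fourier_comp_neg, Function.comp_apply, neg_neg]
    _ = ∫ ξ, H ξ * 𝓕 (fun x => g (-x)) ξ := self_adjoint
    _ = ∫ ξ, H ξ * 𝓕⁻ g ξ := by simp only [Real.fourierInv_eq_fourier_comp_neg]

lemma pairing_U {ρ : ℝ} (hρ : ρ < 1) (t : ℝ) (f g : 𝓢(E n, ℂ)) :
    pairing (U ρ t f) g = multiplierForm (propagator (1 - ρ) t) f g := by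
  have integrable_fourier : Integrable (𝓕 (f : E n → ℂ)) := by
    rw [← SchwartzMap.fourier_coe]
    exact (𝓕 f).integrable
  have integrable_symbol :
      Integrable fun ξ : E n => propagator (1 - ρ) t ξ * 𝓕 (f : E n → ℂ) ξ :=
    integrable_fourier.bdd_mul (c := 1)
      (continuous_propagator (by linarith) t).aestronglyMeasurable
      (Eventually.of_forall fun ξ => (norm_propagator _ _ _).le)
  refine (pairing_fourierInv integrable_symbol g.integrable).trans ?_
  simp only [multiplierForm, mul_assoc]

end Pairing

section SymbolDecomposition

variable {V : Type*} [NormedAddCommGroup V] [InnerProductSpace ℝ V] [FiniteDimensional ℝ V]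
  [MeasurableSpace V] [BorelSpace V]

lemma multiplierForm_mul_eq_of_fourier_eq {m b w F f G : V → ℂ} (hbw : b * w = w)
    (hF : 𝓕 F = w * 𝓕 f) :
    multiplierForm (fun ξ => m ξ * w ξ) f G = multiplierForm (fun ξ => m ξ * b ξ) F G := by
  unfold multiplierForm
  congr 1 with ξ
  have := congrFun hbw ξ
  simp only [Pi.mul_apply] at this
  rw [hF, Pi.mul_apply]
  linear_combination -m ξ * (𝓕 f ξ * 𝓕⁻ G ξ) * this

lemma integrable_fourier_mul_fourierInv (f g : 𝓢(V, ℂ)) :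
    Integrable fun ξ : V => 𝓕 (f : V → ℂ) ξ * 𝓕⁻ (g : V → ℂ) ξ := by
  rw [← SchwartzMap.fourier_coe, ← SchwartzMap.fourierInv_coe]
  exact ((𝓕 f).memLp 2).integrable_mul ((𝓕⁻ g).memLp 2)

lemma tendsto_multiplierForm (f g : 𝓢(V, ℂ)) {m : V → ℂ} {w : ℕ → V → ℂ}
    (hw : ∀ K, Continuous (w K)) {M : ℝ} (hM : ∀ K ξ, ‖w K ξ‖ ≤ M)
    (hlim : ∀ᵐ ξ, Tendsto (fun K => w K ξ) atTop (nhds (m ξ))) :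
    Tendsto (fun K => multiplierForm (w K) f g) atTop (nhds (multiplierForm m f g)) := by
  have integrable_fourier := integrable_fourier_mul_fourierInv f g
  refine tendsto_integral_of_dominated_convergence
    (fun ξ => M * ‖𝓕 (f : V → ℂ) ξ * 𝓕⁻ (g : V → ℂ) ξ‖)
    (fun K => (hw K).aestronglyMeasurable.mul integrable_fourier.aestronglyMeasurable)
    (integrable_fourier.norm.const_mul M) (fun K => Eventually.of_forall fun ξ => ?_) ?_
  · rw [norm_mul]
    exact mul_le_mul_of_nonneg_right (hM K ξ) (norm_nonneg _)
  · filter_upwards [hlim] with ξ hξ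
    exact hξ.mul_const _

lemma enorm_multiplierForm_propagator_mul_le_tsum {a : ℝ} (ha : 0 < a) (t : ℝ) (f g : 𝓢(V, ℂ))
    {m : V → ℂ} {w : ℕ → V → ℂ} (hw : ∀ k, Continuous (w k)) {M : ℝ}
    (hM : ∀ K ξ, ‖∑ k ∈ Finset.range K, w k ξ‖ ≤ M)
    (hlim : ∀ᵐ ξ, Tendsto (fun K => ∑ k ∈ Finset.range K, w k ξ) atTop (nhds (m ξ))) :
    ‖multiplierForm (fun ξ => propagator a t ξ * m ξ) f g‖ₑ ≤
      ∑' k, ‖multiplierForm (fun ξ => propagator a t ξ * w k ξ) f g‖ₑ := by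
  have continuous_piece (k : ℕ) : Continuous fun ξ => propagator a t ξ * w k ξ :=
    (continuous_propagator ha t).mul (hw k)
  have norm_piece_le (k : ℕ) (ξ : V) : ‖propagator a t ξ * w k ξ‖ ≤ M + M := by
    rw [norm_mul, norm_propagator, one_mul, ← Finset.sum_range_succ_sub_sum (fun k => w k ξ)]
    exact (norm_sub_le _ _).trans (add_le_add (hM _ _) (hM _ _))
  have sum_eq (K : ℕ) :
      ∑ k ∈ Finset.range K, multiplierForm (fun ξ => propagator a t ξ * w k ξ) f g =
        multiplierForm (fun ξ => propagator a t ξ * ∑ k ∈ Finset.range K, w k ξ) f g := by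
    simp only [multiplierForm, Finset.mul_sum, Finset.sum_mul]
    exact (integral_finsetSum _ fun k _ => (integrable_fourier_mul_fourierInv f g).bdd_mul
      (continuous_piece k).aestronglyMeasurable (Eventually.of_forall (norm_piece_le k))).symm
  have tendsto_sum := tendsto_multiplierForm f g
    (m := fun ξ => propagator a t ξ * m ξ)
    (w := fun K ξ => propagator a t ξ * ∑ k ∈ Finset.range K, w k ξ)
    (fun K => (continuous_propagator ha t).mul (continuous_finsetSum _ fun k _ => hw k))
    (fun K ξ => by simpa only [norm_mul, norm_propagator, one_mul] using hM K ξ)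
    (hlim.mono fun ξ hξ => hξ.const_mul _)
  simp only [← sum_eq] at tendsto_sum
  exact le_of_tendsto tendsto_sum.enorm
    (Eventually.of_forall fun K => (enorm_sum_le _ _).trans (ENNReal.sum_le_tsum _))

end SymbolDecomposition

section LittlewoodPaley

variable {n : ℕ} {χ : E n → ℝ}

lemma IsCutoff.eq_zero (hχ : IsCutoff χ) {ξ : E n} (hξ : 2 < ‖ξ‖) : χ ξ = 0 := by
  refine image_eq_zero_of_notMem_tsupport fun h => hξ.not_ge ?_
  simpa only [mem_closedBall_zero_iff] using hχ.tsupport_subset h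

lemma IsCutoff.hasCompactSupport (hχ : IsCutoff χ) : HasCompactSupport χ :=
  (isCompact_closedBall (0 : E n) 2).of_isClosed_subset (isClosed_tsupport χ) hχ.tsupport_subset

/-- The dilated cutoff `χ(s · 2πξ)`, in the frequency variable of the kernel `e^{-2πi x·ξ}`. -/
def dilatedCutoff (χ : E n → ℝ) (s : ℝ) : E n → ℂ := fun ξ => (χ (s • (2 * Real.pi) • ξ) : ℂ)

/-- The symbol `φ̂_j(2πξ)` of the Littlewood–Paley piece `f ↦ φ_j * f`, in the frequency variable
of the kernel `e^{-2πi x·ξ}`. -/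
def lpSymbol (χ : E n → ℝ) (j : ℕ) : E n → ℂ := fun ξ => (phiHat χ j ((2 * Real.pi) • ξ) : ℂ)

lemma lpSymbol_zero (χ : E n → ℝ) : lpSymbol χ 0 = dilatedCutoff χ 1 := by
  ext ξ
  simp only [lpSymbol, phiHat, dilatedCutoff, one_smul]

lemma lpSymbol_succ (χ : E n → ℝ) (j : ℕ) :
    lpSymbol χ (j + 1) = dilatedCutoff χ (2 ^ (j + 1))⁻¹ - dilatedCutoff χ (2 ^ j)⁻¹ := by
  ext ξ
  simp only [lpSymbol, phiHat, dilatedCutoff, Complex.ofReal_sub, Pi.sub_apply]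

lemma dilatedCutoff_smul (χ : E n → ℝ) (s c : ℝ) (ξ : E n) :
    dilatedCutoff χ s (c • ξ) = dilatedCutoff χ (c * s) ξ := by
  simp only [dilatedCutoff, smul_smul]
  ring_nf

lemma contDiff_dilatedCutoff (hχ : IsCutoff χ) (s : ℝ) : ContDiff ℝ ∞ (dilatedCutoff χ s) :=
  Complex.ofRealCLM.contDiff.comp (hχ.smooth.comp (by fun_prop))

lemma hasCompactSupport_dilatedCutoff (hχ : IsCutoff χ) {s : ℝ} (hs : s ≠ 0) :
    HasCompactSupport (dilatedCutoff χ s) :=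
  ((hχ.hasCompactSupport.comp_smul hs).comp_smul Real.two_pi_pos.ne').comp_left
    Complex.ofReal_zero

lemma exists_norm_dilatedCutoff_le (hχ : IsCutoff χ) :
    ∃ M : ℝ, 0 ≤ M ∧ ∀ s ξ, ‖dilatedCutoff χ s ξ‖ ≤ M := by
  obtain ⟨M, hM⟩ := hχ.hasCompactSupport.exists_bound_of_continuous hχ.smooth.continuous
  exact ⟨M, (norm_nonneg _).trans (hM 0), fun s ξ => (Complex.norm_real _).trans_le (hM _)⟩

lemma norm_smul_two_pi_smul {s : ℝ} (hs : 0 ≤ s) (ξ : E n) :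
    ‖s • (2 * Real.pi) • ξ‖ = s * (2 * Real.pi * ‖ξ‖) := by
  rw [norm_smul, norm_smul, Real.norm_of_nonneg hs, Real.norm_of_nonneg Real.two_pi_pos.le]

lemma dilatedCutoff_eq_one (hχ : IsCutoff χ) {s : ℝ} (hs : 0 ≤ s) {ξ : E n}
    (h : s * (2 * Real.pi * ‖ξ‖) ≤ 1) : dilatedCutoff χ s ξ = 1 := by
  rw [dilatedCutoff, hχ.eq_one _ (mem_closedBall_zero_iff.2 ?_), Complex.ofReal_one]
  rwa [norm_smul_two_pi_smul hs]

lemma dilatedCutoff_eq_zero (hχ : IsCutoff χ) {s : ℝ} (hs : 0 ≤ s) {ξ : E n}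
    (h : 2 < s * (2 * Real.pi * ‖ξ‖)) : dilatedCutoff χ s ξ = 0 := by
  rw [dilatedCutoff, hχ.eq_zero ((norm_smul_two_pi_smul hs ξ).symm ▸ h), Complex.ofReal_zero]

lemma dilatedCutoff_mul_of_two_mul_le (hχ : IsCutoff χ) {p q : ℝ} (hp : 0 ≤ p) (hpq : 2 * p ≤ q) :
    dilatedCutoff χ p * dilatedCutoff χ q = dilatedCutoff χ q := by
  ext ξ
  have scaled_le := mul_le_mul_of_nonneg_right hpq (by positivity : 0 ≤ 2 * Real.pi * ‖ξ‖)
  rcases lt_or_ge 2 (q * (2 * Real.pi * ‖ξ‖)) with h | h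
  · rw [Pi.mul_apply, dilatedCutoff_eq_zero hχ (by linarith) h, mul_zero]
  · rw [Pi.mul_apply, dilatedCutoff_eq_one hχ hp (by linarith), one_mul]

lemma support_dilatedCutoff_sub_subset (hχ : IsCutoff χ) {p q : ℝ} (hp : 0 < p) (hpq : p ≤ q) :
    Function.support (dilatedCutoff χ p - dilatedCutoff χ q) ⊆
      annulus (E n) (q * (2 * Real.pi))⁻¹ (2 * (p * (2 * Real.pi))⁻¹) := by
  intro ξ hξ
  have hq : 0 < q := hp.trans_le hpq
  have scaled_le : p * (2 * Real.pi * ‖ξ‖) ≤ q * (2 * Real.pi * ‖ξ‖) := by gcongr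
  constructor
  · by_contra! h
    rw [← one_div, lt_div_iff₀ (by positivity)] at h
    refine hξ ?_
    rw [Pi.sub_apply, dilatedCutoff_eq_one hχ hp.le (by linarith),
      dilatedCutoff_eq_one hχ hq.le (by linarith), sub_self]
  · by_contra! h
    rw [← div_eq_mul_inv, div_lt_iff₀ (by positivity)] at h
    refine hξ ?_
    rw [Pi.sub_apply, dilatedCutoff_eq_zero hχ hp.le (by linarith),
      dilatedCutoff_eq_zero hχ hq.le (by linarith), sub_self]

lemma dilatedCutoff_sub_mul_lpSymbol_succ (hχ : IsCutoff χ) (j : ℕ) :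
    (fun ξ => (dilatedCutoff χ (1 / 2) - dilatedCutoff χ 4) (((2 : ℝ) ^ (j + 1))⁻¹ • ξ)) *
      lpSymbol χ (j + 1) = lpSymbol χ (j + 1) := by
  set p : ℝ := (2 ^ (j + 1))⁻¹
  have hp : 0 < p := by positivity
  have inv_pow_eq : ((2 : ℝ) ^ j)⁻¹ = p * 2 := by simp only [p, pow_succ]; field_simp
  have absorb {u v : ℝ} (hu : 0 ≤ u) (huv : 2 * u ≤ v) (ξ : E n) :
      dilatedCutoff χ (p * u) ξ * dilatedCutoff χ (p * v) ξ = dilatedCutoff χ (p * v) ξ :=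
    congrFun (dilatedCutoff_mul_of_two_mul_le hχ (by positivity)
      (by linear_combination p * huv)) ξ
  ext ξ
  rw [lpSymbol_succ, inv_pow_eq]
  simp only [Pi.mul_apply, Pi.sub_apply, dilatedCutoff_smul]
  have wide_one := absorb (u := 1 / 2) (v := 1) (by norm_num) (by norm_num) ξ
  have wide_two := absorb (u := 1 / 2) (v := 2) (by norm_num) (by norm_num) ξ
  have narrow_one := absorb (u := 1) (v := 4) (by norm_num) (by norm_num) ξ
  have narrow_two := absorb (u := 2) (v := 4) (by norm_num) (by norm_num) ξ
  rw [mul_one] at wide_one narrow_one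
  linear_combination wide_one - wide_two - narrow_one + narrow_two

lemma contDiff_lpSymbol (hχ : IsCutoff χ) (j : ℕ) : ContDiff ℝ ∞ (lpSymbol χ j) := by
  cases j with
  | zero => exact lpSymbol_zero χ ▸ contDiff_dilatedCutoff hχ 1
  | succ j =>
    exact lpSymbol_succ χ j ▸ (contDiff_dilatedCutoff hχ _).sub (contDiff_dilatedCutoff hχ _)

lemma hasCompactSupport_lpSymbol (hχ : IsCutoff χ) (j : ℕ) :
    HasCompactSupport (lpSymbol χ j) := by
  cases j with
  | zero => exact lpSymbol_zero χ ▸ hasCompactSupport_dilatedCutoff hχ one_ne_zero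
  | succ j =>
    exact lpSymbol_succ χ j ▸ (hasCompactSupport_dilatedCutoff hχ (by positivity)).sub
      (hasCompactSupport_dilatedCutoff hχ (by positivity))

lemma sum_lpSymbol (χ : E n → ℝ) (J : ℕ) (ξ : E n) :
    ∑ j ∈ Finset.range (J + 1), lpSymbol χ j ξ = dilatedCutoff χ (2 ^ J)⁻¹ ξ := by
  simp only [Finset.sum_range_succ', lpSymbol_succ, lpSymbol_zero, Pi.sub_apply]
  rw [Finset.sum_range_sub (fun j => dilatedCutoff χ (2 ^ j)⁻¹ ξ), pow_zero, inv_one,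
    sub_add_cancel]

lemma exists_schwartz_lpPiece (hχ : IsCutoff χ) (j : ℕ) (f : 𝓢(E n, ℂ)) :
    ∃ F : 𝓢(E n, ℂ), ⇑F = lpPiece χ j f ∧ 𝓕 ⇑F = lpSymbol χ j * 𝓕 ⇑f := by
  set w : 𝓢(E n, ℂ) := (hasCompactSupport_lpSymbol hχ j).toSchwartzMap (contDiff_lpSymbol hχ j)
  have kernel_eq : ⇑(𝓕⁻ w : 𝓢(E n, ℂ)) = phi χ j := SchwartzMap.fourierInv_coe w
  refine ⟨SchwartzMap.convolution (ContinuousLinearMap.mul ℂ ℂ) (𝓕⁻ w) f, ?_, ?_⟩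
  · ext x
    rw [SchwartzMap.convolution_apply, kernel_eq]
    rfl
  · ext ξ
    rw [← SchwartzMap.fourier_coe, SchwartzMap.fourier_convolution,
      FourierTransform.fourier_fourierInv_eq]
    rfl

lemma enorm_multiplierForm_propagator_le_tsum_lpSymbol (hχ : IsCutoff χ) {a : ℝ} (ha : 0 < a)
    (t : ℝ) (f g : 𝓢(E n, ℂ)) :
    ‖multiplierForm (propagator a t) f g‖ₑ ≤
      ∑' j, ‖multiplierForm (fun ξ => propagator a t ξ * lpSymbol χ j ξ) f g‖ₑ := by
  obtain ⟨M, hM₀, hM⟩ := exists_norm_dilatedCutoff_le hχ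
  simpa only [mul_one] using enorm_multiplierForm_propagator_mul_le_tsum ha t f g
    (m := fun _ => 1) (fun j => (contDiff_lpSymbol hχ j).continuous) (M := M) (fun K ξ => by
      cases K with
      | zero => simpa using hM₀
      | succ J => exact sum_lpSymbol χ J ξ ▸ hM _ ξ) <| Eventually.of_forall fun ξ => by
      rw [← tendsto_add_atTop_iff_nat 1]
      obtain ⟨J₀, hJ₀⟩ := pow_unbounded_of_one_lt (2 * Real.pi * ‖ξ‖) (one_lt_two (α := ℝ))
      refine tendsto_const_nhds.congr' ?_
      filter_upwards [eventually_ge_atTop J₀] with J hJ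
      rw [sum_lpSymbol, dilatedCutoff_eq_one hχ (by positivity)]
      rw [inv_mul_le_iff₀ (by positivity), mul_one]
      exact hJ₀.le.trans (pow_le_pow_right₀ one_le_two hJ)

lemma enorm_multiplierForm_propagator_mul_dilatedCutoff_le_tsum (hn : 1 ≤ n) (hχ : IsCutoff χ)
    {a : ℝ} (ha : 0 < a) (t : ℝ) (f g : 𝓢(E n, ℂ)) :
    ‖multiplierForm (fun ξ => propagator a t ξ * dilatedCutoff χ (1 / 2) ξ) f g‖ₑ ≤
      ∑' k : ℕ, ‖multiplierForm (fun ξ => propagator a t ξ *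
        (dilatedCutoff χ (1 / 2) - dilatedCutoff χ 1) (((2 : ℝ) ^ k)⁻¹⁻¹ • ξ)) f g‖ₑ := by
  have : Nonempty (Fin n) := ⟨⟨0, hn⟩⟩
  obtain ⟨M, hM₀, hM⟩ := exists_norm_dilatedCutoff_le hχ
  have piece_eq (k : ℕ) (ξ : E n) :
      (dilatedCutoff χ (1 / 2) - dilatedCutoff χ 1) (((2 : ℝ) ^ k)⁻¹⁻¹ • ξ) =
        dilatedCutoff χ (2 ^ k * (1 / 2)) ξ - dilatedCutoff χ (2 ^ (k + 1) * (1 / 2)) ξ := by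
    rw [Pi.sub_apply, dilatedCutoff_smul, dilatedCutoff_smul, inv_inv, pow_succ]
    ring_nf
  have sum_eq (K : ℕ) (ξ : E n) : ∑ k ∈ Finset.range K,
      (dilatedCutoff χ (1 / 2) - dilatedCutoff χ 1) (((2 : ℝ) ^ k)⁻¹⁻¹ • ξ) =
        dilatedCutoff χ (1 / 2) ξ - dilatedCutoff χ (2 ^ K * (1 / 2)) ξ := by
    simp only [piece_eq]
    rw [Finset.sum_range_sub' (fun k => dilatedCutoff χ (2 ^ k * (1 / 2)) ξ), pow_zero, one_mul]
  refine enorm_multiplierForm_propagator_mul_le_tsum ha t f g (M := M + M)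
    (fun k => ((contDiff_dilatedCutoff hχ _).continuous.sub
      (contDiff_dilatedCutoff hχ _).continuous).comp (continuous_const_smul _))
    (fun K ξ => sum_eq K ξ ▸ (norm_sub_le _ _).trans (add_le_add (hM _ _) (hM _ _))) ?_
  filter_upwards [compl_mem_ae_iff.2 (measure_singleton (0 : E n))] with ξ hξ
  have norm_pos : 0 < 2 * Real.pi * ‖ξ‖ := mul_pos Real.two_pi_pos (norm_pos_iff.2 hξ)
  obtain ⟨K₀, hK₀⟩ := pow_unbounded_of_one_lt (4 / (2 * Real.pi * ‖ξ‖)) (one_lt_two (α := ℝ))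
  refine tendsto_const_nhds.congr' ?_
  filter_upwards [eventually_ge_atTop K₀] with K hK
  have large := hK₀.trans_le (pow_le_pow_right₀ one_le_two hK)
  rw [div_lt_iff₀ norm_pos] at large
  rw [sum_eq, dilatedCutoff_eq_zero hχ (s := 2 ^ K * (1 / 2)) (by positivity) (by linarith),
    sub_zero]

end LittlewoodPaley

section Summation

variable {n : ℕ} {χ : E n → ℝ} {a t r α κ : ℝ} {A : ℝ≥0∞}

lemma tsum_inv_two_pow_rpow_ne_top (hκ : 0 < κ) :
    ∑' k : ℕ, ENNReal.ofReal (((2 : ℝ) ^ k)⁻¹ ^ κ) ≠ ⊤ := by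
  have geometric (k : ℕ) : ((2 : ℝ) ^ k)⁻¹ ^ κ = ((2 : ℝ) ^ (-κ)) ^ k := by
    rw [Real.inv_rpow (by positivity), ← Real.rpow_neg (by positivity),
      Real.rpow_pow_comm (by norm_num)]
  simp only [geometric]
  exact (summable_geometric_of_lt_one (by positivity)
    (Real.rpow_lt_one_of_one_lt_of_neg one_lt_two (by linarith))).tsum_ofReal_ne_top

lemma enorm_multiplierForm_lpSymbol_succ_le (hχ : IsCutoff χ)
    (localized : ∀ l : ℝ, 0 < l → ∀ F G : 𝓢(E n, ℂ), ‖multiplierForm (fun ξ =>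
      propagator a t ξ * (dilatedCutoff χ (1 / 2) - dilatedCutoff χ 4) (l⁻¹ • ξ)) F G‖ₑ ≤
        A * ENNReal.ofReal (l ^ κ) * disjointSup α r F G) (j : ℕ) (f g : 𝓢(E n, ℂ)) :
    ‖multiplierForm (fun ξ => propagator a t ξ * lpSymbol χ (j + 1) ξ) f g‖ₑ ≤
      A * ENNReal.ofReal (2 ^ (((j + 1 : ℕ) : ℝ) * κ)) *
        disjointSup α r (lpPiece χ (j + 1) f) g := by
  obtain ⟨F, hF, fourier_eq⟩ := exists_schwartz_lpPiece hχ (j + 1) f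
  rw [multiplierForm_mul_eq_of_fourier_eq (dilatedCutoff_sub_mul_lpSymbol_succ hχ j) fourier_eq,
    ← hF, Real.rpow_mul zero_le_two, Real.rpow_natCast]
  exact localized _ (by positivity) F g

lemma enorm_multiplierForm_lpSymbol_zero_le (hn : 1 ≤ n) (hχ : IsCutoff χ) (ha : 0 < a)
    (localized : ∀ l : ℝ, 0 < l → ∀ F G : 𝓢(E n, ℂ), ‖multiplierForm (fun ξ =>
      propagator a t ξ * (dilatedCutoff χ (1 / 2) - dilatedCutoff χ 1) (l⁻¹ • ξ)) F G‖ₑ ≤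
        A * ENNReal.ofReal (l ^ κ) * disjointSup α r F G) (f g : 𝓢(E n, ℂ)) :
    ‖multiplierForm (fun ξ => propagator a t ξ * lpSymbol χ 0 ξ) f g‖ₑ ≤
      A * (∑' k : ℕ, ENNReal.ofReal (((2 : ℝ) ^ k)⁻¹ ^ κ)) *
        disjointSup α r (lpPiece χ 0 f) g := by
  obtain ⟨F, hF, fourier_eq⟩ := exists_schwartz_lpPiece hχ 0 f
  have absorb : dilatedCutoff χ (1 / 2) * lpSymbol χ 0 = lpSymbol χ 0 :=
    lpSymbol_zero χ ▸ dilatedCutoff_mul_of_two_mul_le hχ (by norm_num) (by norm_num)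
  rw [multiplierForm_mul_eq_of_fourier_eq absorb fourier_eq, ← hF]
  calc _ ≤ ∑' k : ℕ, A * ENNReal.ofReal (((2 : ℝ) ^ k)⁻¹ ^ κ) * disjointSup α r F g :=
        (enorm_multiplierForm_propagator_mul_dilatedCutoff_le_tsum hn hχ ha t F g).trans
          (ENNReal.tsum_le_tsum fun k => localized _ (by positivity) F g)
    _ = _ := by rw [ENNReal.tsum_mul_right, ENNReal.tsum_mul_left]

lemma exists_enorm_multiplierForm_propagator_le {d : ℕ} (hn : 1 ≤ n) (hχ : IsCutoff χ)
    (ha : 0 < a) (hd : (a ≠ 1 ∧ d = n) ∨ d + 1 = n) (hr₁ : 1 ≤ r) (hr₂ : r ≤ 2) (hα : 0 < α)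
    (hα₁ : α ≤ 1) {e : ℝ} (he : e = n * (2 / r - 1 / α) - d * (1 / r - 1 / 2)) (he₀ : e ≤ 0)
    (hκ : κ = n * (1 / α - 1) + a * e) (hκ₀ : 0 < κ) :
    ∃ C : ℝ≥0, ∀ (f g : 𝓢(E n, ℂ)) (t : ℝ), 0 < t →
      ‖multiplierForm (propagator a t) f g‖ₑ ≤ C * ENNReal.ofReal (t ^ e) *
        ∑' j : ℕ, ENNReal.ofReal ((2 : ℝ) ^ ((j : ℝ) * κ)) *
          disjointSup α r (lpPiece χ j f) g := by
  have localized {p q : ℝ} (hp : 0 < p) (hpq : p ≤ q) : ∃ C : ℝ≥0, ∀ t l : ℝ, 0 < t → 0 < l →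
      ∀ F G : 𝓢(E n, ℂ), ‖multiplierForm (fun ξ =>
        propagator a t ξ * (dilatedCutoff χ p - dilatedCutoff χ q) (l⁻¹ • ξ)) F G‖ₑ ≤
          C * ENNReal.ofReal (t ^ e) * ENNReal.ofReal (l ^ κ) * disjointSup α r F G := by
    have radii_le : (q * (2 * Real.pi))⁻¹ ≤ 2 * (p * (2 * Real.pi))⁻¹ :=
      (inv_anti₀ (by positivity) (by gcongr)).trans (le_mul_of_one_le_left (by positivity)
        one_le_two)
    obtain ⟨C, bound⟩ := exists_enorm_multiplierForm_le_disjointSup ha hd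
      (have := hp.trans_le hpq; by positivity) radii_le
      ((contDiff_dilatedCutoff hχ p).sub (contDiff_dilatedCutoff hχ q))
      (support_dilatedCutoff_sub_subset hχ hp hpq) hr₁ hr₂ hα hα₁ he he₀
    exact ⟨C, fun t l ht hl F G =>
      hκ ▸ bound t l ht hl F G (fun p => F.memLp p) (fun p => G.memLp p)⟩
  obtain ⟨C_high, high⟩ := localized (p := 1 / 2) (q := 4) (by norm_num) (by norm_num)
  obtain ⟨C_low, low⟩ := localized (p := 1 / 2) (q := 1) (by norm_num) (by norm_num)
  set Z := ∑' k : ℕ, ENNReal.ofReal (((2 : ℝ) ^ k)⁻¹ ^ κ)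
  have hZ : Z ≠ ⊤ := tsum_inv_two_pow_rpow_ne_top hκ₀
  refine ⟨C_high + C_low * Z.toNNReal, fun f g t ht =>
    (enorm_multiplierForm_propagator_le_tsum_lpSymbol hχ ha t f g).trans ?_⟩
  rw [← ENNReal.tsum_mul_left, ENNReal.coe_add, ENNReal.coe_mul, ENNReal.coe_toNNReal hZ]
  refine ENNReal.tsum_le_tsum fun j => ?_
  cases j with
  | zero =>
    refine (enorm_multiplierForm_lpSymbol_zero_le hn hχ ha
      (fun l hl => low t l ht hl) f g).trans ?_
    rw [Nat.cast_zero, zero_mul, Real.rpow_zero, ENNReal.ofReal_one, one_mul,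
      mul_right_comm (C_low : ℝ≥0∞)]
    gcongr
    exact le_add_self
  | succ j =>
    refine (enorm_multiplierForm_lpSymbol_succ_le hχ (fun l hl => high t l ht hl) j f g).trans ?_
    rw [mul_assoc]
    gcongr
    exact le_self_add

end Summation

section Truncation

variable {n : ℕ}

lemma tendsto_tsum_of_le_of_eventually_eq {ι κ : Type*} {l : Filter κ} {u : κ → ι → ℝ≥0∞}
    {v : ι → ℝ≥0∞} (hle : ∀ R i, u R i ≤ v i) (hev : ∀ i, ∀ᶠ R in l, u R i = v i) :
    Tendsto (fun R => ∑' i, u R i) l (nhds (∑' i, v i)) := by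
  refine tendsto_order.2 ⟨fun c hc => ?_, fun c hc =>
    Eventually.of_forall fun R => (ENNReal.tsum_le_tsum (hle R)).trans_lt hc⟩
  rw [ENNReal.tsum_eq_iSup_sum, lt_iSup_iff] at hc
  obtain ⟨s, hs⟩ := hc
  filter_upwards [(eventually_all_finset s).2 fun i _ => hev i] with R hR
  exact (hs.trans_eq (Finset.sum_congr rfl hR).symm).trans_le (ENNReal.sum_le_tsum _)

lemma Cube.eventually_subset (Q : Cube n) : ∀ᶠ R : ℝ in atTop, Q.toSet ⊆ cubeSet 0 R := by
  filter_upwards [eventually_ge_atTop (2 * (‖Q.center‖ + Q.side))] with R hR x hx i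
  have center_bound := abs_le.1 (PiLp.norm_apply_le Q.center i)
  have side_pos := Q.side_pos
  simp only [PiLp.zero_apply]
  constructor <;> linarith [hx i]

lemma avg_indicator_le (p : ℝ) (Q : Cube n) (h : E n → ℂ) (s : Set (E n)) :
    avg p Q (s.indicator h) ≤ avg p Q h :=
  mul_le_mul' le_rfl (eLpNorm_mono fun x => norm_indicator_le_norm_self h x)

lemma avg_indicator_of_subset (p : ℝ) {Q : Cube n} (h : E n → ℂ) {s : Set (E n)}
    (hs : Q.toSet ⊆ s) : avg p Q (s.indicator h) = avg p Q h := by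
  unfold avg
  rw [eLpNorm_congr_ae (ae_restrict_of_forall_mem Q.measurableSet fun x hx =>
    Set.indicator_of_mem (hs hx) h)]

lemma tendsto_sparseForm_indicator {α : ℝ} (hα : 0 < α) (S : Set (Cube n)) (r s : ℝ)
    (h g : E n → ℂ) : Tendsto (fun R : ℝ => sparseForm α S r s ((cubeSet 0 R).indicator h) g)
      atTop (nhds (sparseForm α S r s h g)) := by
  refine (ENNReal.continuous_rpow_const.tendsto _).comp
    (tendsto_tsum_of_le_of_eventually_eq (fun R Q => ?_) fun Q => ?_)
  · gcongr
    exact avg_indicator_le _ _ _ _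
  · filter_upwards [(Q : Cube n).eventually_subset] with R hR
    rw [avg_indicator_of_subset _ _ hR]

lemma tsum_sparseForm_le_besovSparseForm (χ : E n → ℝ) (κ : ℝ) {α : ℝ} (hα : 0 < α) (r : ℝ)
    (S : ℕ → Set (Cube n)) (f g : E n → ℂ) :
    ∑' j : ℕ, ENNReal.ofReal ((2 : ℝ) ^ ((j : ℝ) * κ)) *
      sparseForm α (S j) r r (lpPiece χ j f) g ≤ besovSparseForm χ κ α r S f g := by
  rw [ENNReal.tsum_eq_iSup_sum]
  refine iSup_le fun s => ?_
  have tendsto_partial_sum :=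
    tendsto_finsetSum (f := fun (j : ℕ) (R : ℝ) => ENNReal.ofReal ((2 : ℝ) ^ ((j : ℝ) * κ)) *
      sparseForm α (S j) r r ((cubeSet (0 : E n) R).indicator (lpPiece χ j f)) g) s fun j _ =>
    ENNReal.Tendsto.const_mul (tendsto_sparseForm_indicator hα _ _ _ _ _)
      (Or.inr ENNReal.ofReal_ne_top)
  rw [← tendsto_partial_sum.liminf_eq]
  exact liminf_le_liminf (Eventually.of_forall fun R => ENNReal.sum_le_tsum _)

end Truncation

lemma exists_sparse_disjointSup_lpPiece_le {n : ℕ} {χ : E n → ℝ} (hχ : IsCutoff χ) {r α : ℝ}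
    (hr : 0 < r) (hα : r ≤ 2 * α) (f g : 𝓢(E n, ℂ)) (j : ℕ) :
    ∃ S : Set (Cube n), IsSparse (1 / 2) S ∧
      disjointSup α r (lpPiece χ j f) g ≤ 2 * sparseForm α S r r (lpPiece χ j f) g := by
  obtain ⟨F, hF, -⟩ := exists_schwartz_lpPiece hχ j f
  obtain ⟨S, disjoint, le_sparseForm⟩ :=
    exists_pairwiseDisjoint_disjointSup_le hr hα (F.memLp _) (g.memLp _)
  exact ⟨S, isSparse_of_pairwiseDisjoint (by norm_num) disjoint, hF ▸ le_sparseForm⟩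

lemma dispersive_frequency_exponent_pos {ρ u v : ℝ} (hρ₁ : -1 ≤ ρ) (hρ₂ : ρ < 1) (hρ₀ : ρ ≠ 0)
    (hu : 1 / 2 ≤ u) (h₁ : u + 1 / 2 < v) (h₂ : v < 2 * u) :
    0 < (1 - ρ) * (u - 1 / 2) + ρ * (v - 1) := by
  rcases lt_or_gt_of_ne hρ₀ with hneg | hpos
  · have := mul_lt_mul_of_neg_left (sub_lt_sub_right h₂ 1) hneg
    have := mul_nonneg (by linarith : 0 ≤ 1 + ρ) (sub_nonneg.2 hu)
    linarith
  · have := mul_pos hpos (by linarith : 0 < v - 1)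
    have := mul_nonneg (by linarith : 0 ≤ 1 - ρ) (sub_nonneg.2 hu)
    linarith

lemma wave_time_exponent_neg {n r v : ℝ} (hn : 0 < n) (hr : r ≠ 0)
    (h : (n + 1) / (r * n) + (n - 1) / (2 * n) < v) :
    (n + 1) * (1 / r - 1 / 2) - n * (v - 1) < 0 := by
  have scaled := mul_lt_mul_of_pos_left h hn
  have scaled_eq : n * ((n + 1) / (r * n) + (n - 1) / (2 * n)) =
      (n + 1) * (1 / r - 1 / 2) + n := by field_simp; ring
  linarith

lemma half_lt_of_wave_time_exponent_neg {n u v : ℝ} (hn : 1 ≤ n)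
    (h₁ : (n + 1) * (u - 1 / 2) - n * (v - 1) < 0) (h₂ : v < 2 * u) : 1 / 2 < u := by
  have : n * v < n * (2 * u) := by gcongr
  have : 0 < (n - 1) * (u - 1 / 2) := by linarith
  exact sub_pos.1 (pos_of_mul_pos_right this (by linarith))

end SparseDispersive

end

open SparseDispersive in
theorem theorem3p3_general {n d : ℕ} (hn : 1 ≤ n) {χ : E n → ℝ} (hχ : IsCutoff χ) {ρ : ℝ}
    (hρ : ρ < 1) (hd : (ρ ≠ 0 ∧ d = n) ∨ d + 1 = n) {r α : ℝ} (hr₁ : 1 ≤ r) (hr₂ : r ≤ 2)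
    (hα : 1 / α ≤ 2 / r) {e κ : ℝ} (he : e = n * (2 / r - 1 / α) - d * (1 / r - 1 / 2))
    (he₀ : e ≤ 0) (hκ : κ = n * (1 / α - 1) + (1 - ρ) * e) (hκ₀ : 0 < κ) :
    ∃ C : ℝ≥0, ∀ f g : 𝓢(E n, ℂ), ∃ S : ℕ → Set (Cube n), (∀ j, IsSparse (1 / 2) (S j)) ∧
      ∀ t : ℝ, 0 < t → ‖pairing (U ρ t f) g‖ₑ ≤
        C * ENNReal.ofReal (t ^ e) * besovSparseForm χ κ α r S f g := by
  have hr : 0 < r := by linarith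
  have one_le_inv : 1 ≤ 1 / α := by
    have hn₀ : (0 : ℝ) < n := by exact_mod_cast hn
    have hdn : (d : ℝ) ≤ n := by exact_mod_cast (by omega : d ≤ n)
    have half_le : 1 / 2 ≤ 1 / r := one_div_le_one_div_of_le hr hr₂
    have dim_le := mul_le_mul_of_nonneg_right hdn (sub_nonneg.2 half_le)
    refine le_of_mul_le_mul_left ?_ hn₀
    linear_combination he₀ + dim_le - he + (n : ℝ) * half_le
  have hα₀ : 0 < α := one_div_pos.1 (by linarith)
  have hα₁ : α ≤ 1 := by rwa [le_div_iff₀ hα₀, one_mul] at one_le_inv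
  have hrα : r ≤ 2 * α := by rwa [div_le_div_iff₀ hα₀ hr, one_mul] at hα
  obtain ⟨C, bound⟩ := exists_enorm_multiplierForm_propagator_le hn hχ (a := 1 - ρ)
    (by linarith) (hd.imp_left (And.imp_left (by grind))) hr₁ hr₂ hα₀ hα₁ he he₀ hκ hκ₀
  refine ⟨C * 2, fun f g => ?_⟩
  choose S sparse le_sparseForm using exists_sparse_disjointSup_lpPiece_le hχ hr hrα f g
  refine ⟨S, sparse, fun t ht => ?_⟩
  calc ‖pairing (U ρ t f) g‖ₑ ≤ C * ENNReal.ofReal (t ^ e) * ∑' j : ℕ,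
        ENNReal.ofReal (2 ^ ((j : ℝ) * κ)) * disjointSup α r (lpPiece χ j f) g :=
        pairing_U hρ t f g ▸ bound f g t ht
    _ ≤ C * ENNReal.ofReal (t ^ e) * ∑' j : ℕ, ENNReal.ofReal (2 ^ ((j : ℝ) * κ)) *
        (2 * sparseForm α (S j) r r (lpPiece χ j f) g) := by
        gcongr with j
        exact le_sparseForm j
    _ = ↑(C * 2) * ENNReal.ofReal (t ^ e) * ∑' j : ℕ, ENNReal.ofReal (2 ^ ((j : ℝ) * κ)) *
        sparseForm α (S j) r r (lpPiece χ j f) g := by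
        simp only [mul_left_comm _ (2 : ℝ≥0∞)]
        rw [ENNReal.tsum_mul_left, ENNReal.coe_mul, ENNReal.coe_ofNat]
        ring
    _ ≤ _ := by
        gcongr
        exact tsum_sparseForm_le_besovSparseForm χ κ hα₀ r S f g

theorem theorem3p3 (n : ℕ) (hn : 1 ≤ n) :
    ∃ η : ℝ, 0 < η ∧ η < 1 ∧
      ∀ χ : SparseDispersive.E n → ℝ, SparseDispersive.IsCutoff χ →
      ∀ r : ℝ, 1 ≤ r → r ≤ 2 →
      (∀ ρ α : ℝ, -1 ≤ ρ → ρ < 1 → ρ ≠ 0 → 1 / r + 1 / 2 < 1 / α → 1 / α < 2 / r →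
        ∃ C : ℝ≥0, ∀ f g : 𝓢(SparseDispersive.E n, ℂ),
          ∃ S : ℕ → Set (SparseDispersive.Cube n),
            (∀ j, SparseDispersive.IsSparse η (S j)) ∧
            ∀ t : ℝ, 0 < t →
              ‖SparseDispersive.pairing (SparseDispersive.U ρ t f) g‖ₑ ≤
                C * ENNReal.ofReal (t ^ ((n : ℝ) * (1 / r - 1 / 2 - (1 / α - 1)))) *
                  SparseDispersive.besovSparseForm χ
                    ((n : ℝ) * (1 - ρ) * (1 / r - 1 / 2) + ρ * n * (1 / α - 1)) α r S f g) ∧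
      (∀ α : ℝ, ((n : ℝ) + 1) / (r * n) + ((n : ℝ) - 1) / (2 * n) < 1 / α → 1 / α < 2 / r →
        ∃ C : ℝ≥0, ∀ f g : 𝓢(SparseDispersive.E n, ℂ),
          ∃ S : ℕ → Set (SparseDispersive.Cube n),
            (∀ j, SparseDispersive.IsSparse η (S j)) ∧
            ∀ t : ℝ, 0 < t →
              ‖SparseDispersive.pairing (SparseDispersive.U 0 t f) g‖ₑ ≤
                C * ENNReal.ofReal
                    (t ^ (((n : ℝ) + 1) * (1 / r - 1 / 2) - (n : ℝ) * (1 / α - 1))) *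
                  SparseDispersive.besovSparseForm χ
                    (((n : ℝ) + 1) * (1 / r - 1 / 2)) α r S f g) := by
  have hn₁ : (1 : ℝ) ≤ n := by exact_mod_cast hn
  have hn₀ : (0 : ℝ) < n := by linarith
  refine ⟨1 / 2, by norm_num, by norm_num, fun χ hχ r hr₁ hr₂ =>
    ⟨fun ρ α hρ₁ hρ₂ hρ₀ h₁ h₂ => ?_, fun α h₁ h₂ => ?_⟩⟩
  all_goals
    have two_div : 2 / r = 2 * (1 / r) := by ring
    have hr : 0 < r := by linarith
  · have half_le : 1 / 2 ≤ 1 / r := one_div_le_one_div_of_le hr hr₂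
    have frequency_pos :=
      SparseDispersive.dispersive_frequency_exponent_pos hρ₁ hρ₂ hρ₀ half_le h₁ (two_div ▸ h₂)
    exact theorem3p3_general hn hχ hρ₂ (.inl ⟨hρ₀, rfl⟩) hr₁ hr₂ h₂.le (by ring)
      (mul_nonpos_of_nonneg_of_nonpos hn₀.le (by linarith)) (by ring)
      (by linarith [mul_pos hn₀ frequency_pos])
  · have time_neg := SparseDispersive.wave_time_exponent_neg hn₀ hr.ne' h₁
    have half_lt :=
      SparseDispersive.half_lt_of_wave_time_exponent_neg hn₁ time_neg (two_div ▸ h₂)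
    exact theorem3p3_general hn hχ one_pos (.inr (Nat.sub_add_cancel hn)) hr₁ hr₂ h₂.le
      (by rw [Nat.cast_pred hn]; ring) time_neg.le (by ring)
      (mul_pos (by linarith) (by linarith))
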